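/- Let $p$ be a prime, let $k_0$ be a finite field of characteristic $p$, let $G=\operatorname{Spec}A$ be a flat affine group scheme of finite type over $\mathbb Z_p$, and let $\mu:\mathbb G_{m,W(k_0)}\to G_{W(k_0)}$ be a cocharacter. Let $R$ be a $W(k_0)$-algebra in which $p$ is nilpotent. View $W(R)$ as a $W(k_0)$-algebra through the Cartier homomorphism $W(k_0)\to W(W(k_0))\to W(R)$. **The Witt frame.** Let $f$ and $v$ be the Frobenius and the Verschiebung of $W(R)$ and $I_R=v(W(R))$. The graded ring $W(R)^\oplus=\bigoplus_{n\in\mathbb Z}W(R)^\oplus_n$ has $W(R)^\oplus_n=W(R)\,t^{-n}$ for $n\le 0$ and $W(R)^\oplus_n=I_R$ for $n\ge 1$. The ring homomorphisms $\sigma,\tau:W(R)^\oplus\to W(R)$ are given by $\tau(\xi t^{-n})=\xi$, $\sigma(\xi t^{-n})=p^{-n}f(\xi)$ for $n\le 0$, and by $\tau(v(a))=p^{n-1}v(a)$, $\sigma(v(a))=a$ on $W(R)^\oplus_n$ for $n\ge 1$; the multiplication is the one for which the pair $(\tau,\sigma)$, which is injective on each graded piece, is a ring homomorphism. A display over $R$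 is a finite projective graded $W(R)^\oplus$-module $M$ with a $\sigma$-linear bijection $F:M\to M^\tau$, i.e. a $\sigma$-linear map whose linearization $F^\sharp:M^\sigma\to M^\tau$ is an isomorphism, where $M^\sigma=M\otimes_{W(R)^\oplus,\sigma}W(R)$ and $M^\tau=M\otimes_{W(R)^\oplus,\tau}W(R)$. **Tannakian displays.** Let $\mathrm{Rep}_{\mathbb Z_p}(G)$ be the category of representations of $G$ on finite free $\mathbb Z_p$-modules. A graded fiber functor over $W(R)^\oplus$ is an exact tensor functor from $\mathrm{Rep}_{\mathbb Z_p}(G)$ to finite projective graded $W(R)^\oplus$-modules; an example is $\mathscr C_{\mu,R}: V\mapsto V_{W(k_0)}\otimes_{W(k_0)}W(R)^\oplus$, where $V_{W(k_0)}=V\otimes_{\mathbb Z_p}W(k_0)=\bigoplus_iV^i$ is graded by the weights of $\mu$. A graded fiber functor $\mathscr F$ is of type $\mu$ if $\mathscr F_{R'}\cong\mathscr C_{\mu,R'}$ for some faithfully flat $R\to R'$. A Tannakian $(G,\mu)$-display over $R$ is an exact tensor functor $\mathscr D$ from $\mathrm{Rep}_{\mathbb Z_p}(G)$ to displays over $R$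 whose underlying graded fiber functor is of type $\mu$; it is banal if its underlying graded fiber functor is isomorphic to $\mathscr C_{\mu,R}$. Morphisms are morphisms of tensor functors. **The groupoid.** Let $L^+G(R)=G(W(R))$, and let the display group $L^+_\mu G(R)\subseteq G(W(R)^\oplus)$ be the subgroup of those morphisms $\operatorname{Spec}W(R)^\oplus\to G$ which are $\mathbb G_m$-equivariant for the action given by the grading on the source and the action $g\cdot\lambda=\mu(\lambda)^{-1}g\mu(\lambda)$ on the target. The groupoid $[L^+G/L^+_\mu G]^{\mathrm{pre}}(R)$ has as objects the elements $U\in L^+G(R)$, and as morphisms $U\to U'$ the $h\in L^+_\mu G(R)$ with $\tau(h)^{-1}U'\sigma(h)=U$; composition is multiplication in $L^+_\mu G(R)$. For $U\in L^+G(R)$, let $\mathscr D_U$ be the banal Tannakian $(G,\mu)$-display which sends a representation $(V,\rho)$ to $V\otimes_{\mathbb Z_p}W(R)^\oplus$ with the grading of $\mathscr C_{\mu,R}(V)$ and with $F_U(x\otimes s)=\sigma(s)\,\rho(U)(x\otimes 1)$ for $x\in V$, $s\in W(R)^\oplus$. **Proposition.** The assignment $U\mapsto\mathscr D_U$ on objects,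 which sends a morphism $h:U\to U'$ to the morphism $\mathscr D_U\to\mathscr D_{U'}$ given on every representation $(V,\rho)$ by the action $\rho(h)$ on $V\otimes_{\mathbb Z_p}W(R)^\oplus$, is a well-defined functor, and this functor is an equivalence of categories from $[L^+G/L^+_\mu G]^{\mathrm{pre}}(R)$ to the category of banal Tannakian $(G,\mu)$-displays over $R$. -/

import Mathlib

open CategoryTheory MonoidalCategory TensorProduct
open scoped LaurentPolynomial

noncomputable section

namespace GDisplay

set_option linter.unusedSectionVars false

universe r

/-! ### The Cartier homomorphism `W(k) → W(W(k))` -/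

section Cartier

theorem ghost_ext {p : ℕ} [Fact p.Prime] {k : Type*} [Field k] [CharP k p]
    {x y : WittVector p (WittVector p k)}
    (h : ∀ n, WittVector.ghostComponent n x = WittVector.ghostComponent n y) : x = y := by
  let K := FractionRing (WittVector p k)
  have hpK : (p : K) ≠ 0 := WittVector.FractionRing.p_nonzero p k
  let _ : Invertible (p : K) := invertibleOfNonzero hpK
  apply WittVector.map_injective (algebraMap (WittVector p k) K)
    (IsFractionRing.injective (WittVector p k) K)
  apply (WittVector.ghostMap.bijective_of_invertible p K).1
  funext n
  rw [WittVector.ghostMap_apply, WittVector.ghostMap_apply]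
  have aux : ∀ z : WittVector p (WittVector p k), WittVector.ghostComponent n
      (WittVector.map (algebraMap (WittVector p k) K) z) =
        algebraMap (WittVector p k) K (WittVector.ghostComponent n z) := by
    intro z
    simp only [WittVector.ghostComponent_apply, aeval_wittPolynomial, map_sum, map_mul, map_pow,
      map_natCast, WittVector.map_coeff]
  rw [aux, aux, h n]

variable (p : ℕ) [hp : Fact p.Prime] (k : Type*) [Field k] [CharP k p] [PerfectRing k p]

variable {p k} in
theorem dvd_frobenius_sub_pow (x : WittVector p k) :
    (p : WittVector p k) ∣ WittVector.frobenius x - x ^ p := by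
  rw [← Ideal.mem_span_singleton, WittVector.mem_span_p_iff_coeff_zero_eq_zero]
  have h : WittVector.constantCoeff (WittVector.frobenius x - x ^ p) = 0 := by
    rw [map_sub, map_pow, sub_eq_zero]
    exact WittVector.coeff_frobenius_charP p x 0
  exact h

/-- The Witt components of `Δ(x)`, determined recursively by the ghost components
`w_n(Δ(x)) = f^n(x)`. -/
theorem exists_cartier_coeff (x : WittVector p k) :
    ∃ y : ℕ → WittVector p k, ∀ n,
      ∑ i ∈ Finset.range (n + 1), (p : WittVector p k) ^ i * y i ^ p ^ (n - i) =
        (WittVector.frobenius^[n]) x := by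
  classical
  have step : ∀ (n : ℕ) (y : ℕ → WittVector p k),
      (∀ m < n, ∑ i ∈ Finset.range (m + 1), (p : WittVector p k) ^ i * y i ^ p ^ (m - i) =
        (WittVector.frobenius^[m]) x) →
      ∃ z, (p : WittVector p k) ^ n * z =
        (WittVector.frobenius^[n]) x -
          ∑ i ∈ Finset.range n, (p : WittVector p k) ^ i * y i ^ p ^ (n - i) := by
    intro n y hy
    suffices h : (p : WittVector p k) ^ n ∣ (WittVector.frobenius^[n]) x -
          ∑ i ∈ Finset.range n, (p : WittVector p k) ^ i * y i ^ p ^ (n - i) by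
      obtain ⟨z, hz⟩ := h
      exact ⟨z, hz.symm⟩
    cases n with
    | zero => simp
    | succ m =>
      rw [Function.iterate_succ_apply', ← hy m (Nat.lt_succ_self m), map_sum,
        ← Finset.sum_sub_distrib]
      refine Finset.dvd_sum fun i hi => ?_
      have him : i ≤ m := Nat.lt_succ_iff.mp (Finset.mem_range.mp hi)
      rw [map_mul, map_pow, map_natCast, map_pow, ← mul_sub]
      have h1 := dvd_sub_pow_of_dvd_sub (dvd_frobenius_sub_pow (y i)) (m - i)
      rw [← pow_mul, ← pow_succ', show m - i + 1 = m + 1 - i by omega] at h1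
      calc (p : WittVector p k) ^ (m + 1) = p ^ i * p ^ (m + 1 - i) := by
            rw [← pow_add]; congr 1; omega
        _ ∣ _ := mul_dvd_mul_left _ h1
  choose! c hc using step
  let F : (n : ℕ) → ((m : ℕ) → m < n → WittVector p k) → WittVector p k :=
    fun n g => c n (fun m => if h : m < n then g m h else 0)
  let y : ℕ → WittVector p k := fun n => Nat.strongRec (motive := fun _ => WittVector p k) F n
  have hy0 : ∀ n, y n = c n (fun m => if m < n then y m else 0) := by
    intro n
    change Nat.strongRec (motive := fun _ => WittVector p k) F n = _
    rw [Nat.strongRec_eq]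
    simp [F, y]
  refine ⟨y, fun n => ?_⟩
  induction n using Nat.strong_induction_on with
  | _ n ih =>
    have key := hc n (fun m => if m < n then y m else 0) (by
      intro m hm
      rw [← ih m hm]
      refine Finset.sum_congr rfl fun i hi => ?_
      have : i < n := by have := Finset.mem_range.mp hi; omega
      simp [this])
    rw [← hy0] at key
    rw [Finset.sum_congr rfl (g := fun i => (p : WittVector p k) ^ i * y i ^ p ^ (n - i))] at key
    · rw [Finset.sum_range_succ, Nat.sub_self, pow_zero, pow_one, key]
      abel
    · intro i hi
      simp [Finset.mem_range.mp hi]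

theorem exists_cartier (x : WittVector p k) :
    ∃ y : WittVector p (WittVector p k), ∀ n,
      WittVector.ghostComponent n y = (WittVector.frobenius^[n]) x := by
  obtain ⟨y, hy⟩ := exists_cartier_coeff p k x
  refine ⟨WittVector.mk p y, fun n => ?_⟩
  rw [← hy n, WittVector.ghostComponent_apply, aeval_wittPolynomial]
  rfl

/-- The Cartier homomorphism `Δ : W(k) → W(W(k))`, characterised by `w_n(Δ(x)) = f^n(x)`. -/
def cartier : WittVector p k →+* WittVector p (WittVector p k) where
  toFun x := (exists_cartier p k x).choose
  map_one' := ghost_ext fun n => by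
    rw [(exists_cartier p k 1).choose_spec n, map_one, iterate_map_one]
  map_zero' := ghost_ext fun n => by
    rw [(exists_cartier p k 0).choose_spec n, map_zero, iterate_map_zero]
  map_mul' x y := ghost_ext fun n => by
    rw [(exists_cartier p k (x * y)).choose_spec n, map_mul,
      (exists_cartier p k x).choose_spec n, (exists_cartier p k y).choose_spec n,
      iterate_map_mul]
  map_add' x y := ghost_ext fun n => by
    rw [(exists_cartier p k (x + y)).choose_spec n, map_add,
      (exists_cartier p k x).choose_spec n, (exists_cartier p k y).choose_spec n,
      iterate_map_add]

theorem ghostComponent_cartier (n : ℕ) (x : WittVector p k) :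
    WittVector.ghostComponent n (cartier p k x) = (WittVector.frobenius^[n]) x :=
  (exists_cartier p k x).choose_spec n

theorem frobenius_cartier (x : WittVector p k) :
    WittVector.frobenius (cartier p k x) = cartier p k (WittVector.frobenius x) :=
  ghost_ext fun n => by
    rw [WittVector.ghostComponent_frobenius, ghostComponent_cartier, ghostComponent_cartier,
      Function.iterate_succ_apply]

end Cartier

/-! ### `ℤ_p`-algebra and `W(k)`-algebra structures -/

section Algebras

variable (p : ℕ) [hp : Fact p.Prime] (k : Type*) [Field k] [CharP k p]

/-- The canonical map `ℤ_p = W(𝔽_p) → W(k)`. -/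
def padicToWitt : ℤ_[p] →+* WittVector p k :=
  (WittVector.map (ZMod.castHom (dvd_refl p) k)).comp
    (WittVector.equiv p).symm.toRingHom

instance algebraPadicWitt : Algebra ℤ_[p] (WittVector p k) := (padicToWitt p k).toAlgebra

/-- Frobenius commutes with functoriality of Witt vectors. -/
theorem map_frobenius_comm {R S : Type*} [CommRing R] [CommRing S] (g : R →+* S)
    (x : WittVector p R) :
    WittVector.map g (WittVector.frobenius x) = WittVector.frobenius (WittVector.map g x) := by
  ext n
  rw [WittVector.map_coeff, WittVector.coeff_frobenius, WittVector.coeff_frobenius,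
    MvPolynomial.map_aeval]
  apply MvPolynomial.eval₂Hom_congr (RingHom.ext_int _ _) _ rfl
  ext i
  rw [WittVector.map_coeff]

theorem frobenius_algebraMap_padic (x : ℤ_[p]) :
    WittVector.frobenius (algebraMap ℤ_[p] (WittVector p k) x) = algebraMap _ _ x := by
  change WittVector.frobenius (WittVector.map _ _) = WittVector.map _ _
  rw [← map_frobenius_comm, WittVector.frobenius_zmodp]

end Algebras

/-! ### The Witt frame -/

section Frame

variable (p : ℕ) [hp : Fact p.Prime]

/-- The ring `W(R)`, regarded as a `W(k)`-algebra (for a `W(k)`-algebra `R`) via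
`W(k) → W(W(k)) → W(R)`.  The parameter `k` only serves to record this structure. -/
@[nolint unusedArguments]
def WittOver (_k : Type*) (R : Type*) : Type _ := WittVector p R

/-- The degree `n` piece of the graded Witt ring `W(R)^⊕`. An element `s` of this piece is recorded as
the pair `(τ(s), σ(s))`, which determines it:
* for `n ≤ 0` the piece is `W(R) · t^{-n}`, with `τ(ξ t^{-n}) = ξ` and `σ(ξ t^{-n}) = p^{-n} f(ξ)`;
* for `n ≥ 1` the piece is `I_R = v(W(R))`, with `τ(v(a)) = p^{n-1} v(a)` and `σ(v(a)) = a`. -/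
def wittPiece (R : Type*) [CommRing R] (n : ℤ) :
    AddSubgroup (WittVector p R × WittVector p R) where
  carrier := {x | if n ≤ 0 then x.2 = (p : WittVector p R) ^ (-n).toNat * WittVector.frobenius x.1
    else x.1 = (p : WittVector p R) ^ (n - 1).toNat * WittVector.verschiebung x.2}
  zero_mem' := by
    rw [Set.mem_ofPred_eq]
    split_ifs <;> simp
  add_mem' := by
    intro a b ha hb
    rw [Set.mem_ofPred_eq] at *
    split_ifs at * with h
    · rw [Prod.snd_add, Prod.fst_add, ha, hb, map_add, mul_add]
    · rw [Prod.snd_add, Prod.fst_add, ha, hb, map_add, mul_add]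
  neg_mem' := by
    intro a ha
    rw [Set.mem_ofPred_eq] at *
    split_ifs at * with h
    · rw [Prod.snd_neg, Prod.fst_neg, ha, map_neg, mul_neg]
    · rw [Prod.snd_neg, Prod.fst_neg, ha, map_neg, mul_neg]

variable {p} in
theorem mem_wittPiece_nonpos {R : Type*} [CommRing R] {n : ℤ} (hn : n ≤ 0)
    {x : WittVector p R × WittVector p R} :
    x ∈ wittPiece p R n ↔
      x.2 = (p : WittVector p R) ^ (-n).toNat * WittVector.frobenius x.1 := by
  change (if n ≤ 0 then _ else _) ↔ _
  rw [if_pos hn]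

variable {p} in
theorem mem_wittPiece_pos {R : Type*} [CommRing R] {n : ℤ} (hn : 0 < n)
    {x : WittVector p R × WittVector p R} :
    x ∈ wittPiece p R n ↔
      x.1 = (p : WittVector p R) ^ (n - 1).toNat * WittVector.verschiebung x.2 := by
  change (if n ≤ 0 then _ else _) ↔ _
  rw [if_neg (not_le.mpr hn)]

variable {p} in
theorem verschiebung_natCast_mul {R : Type*} [CommRing R] (m : ℕ) (x : WittVector p R) :
    WittVector.verschiebung ((m : WittVector p R) * x) = m * WittVector.verschiebung x := by
  rw [← nsmul_eq_mul, map_nsmul, nsmul_eq_mul]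

variable {p} in
theorem verschiebung_pow_mul {R : Type*} [CommRing R] (m : ℕ) (x : WittVector p R) :
    WittVector.verschiebung ((p : WittVector p R) ^ m * x) =
      (p : WittVector p R) ^ m * WittVector.verschiebung x := by
  have := verschiebung_natCast_mul (p ^ m) x
  push_cast at this
  exact this

variable {p} in
theorem verschiebung_mul_verschiebung {R : Type*} [CommRing R] (a b : WittVector p R) :
    WittVector.verschiebung a * WittVector.verschiebung b =
      p * WittVector.verschiebung (a * b) := by
  rw [← WittVector.verschiebung_mul_frobenius, WittVector.frobenius_verschiebung,
    ← verschiebung_natCast_mul]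
  congr 1
  ring

variable {p} in
theorem wittPiece_mul_pos_nonpos {R : Type*} [CommRing R] {n m : ℤ} (hn : 0 < n) (hm : m ≤ 0)
    {x y : WittVector p R × WittVector p R} (hx : x ∈ wittPiece p R n)
    (hy : y ∈ wittPiece p R m) : x * y ∈ wittPiece p R (n + m) := by
  rw [mem_wittPiece_pos hn] at hx
  rw [mem_wittPiece_nonpos hm] at hy
  obtain ⟨a, rfl⟩ : ∃ a : ℕ, n = a + 1 := ⟨(n - 1).toNat, by omega⟩
  obtain ⟨b, rfl⟩ : ∃ b : ℕ, m = -b := ⟨(-m).toNat, by omega⟩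
  rw [show ((a : ℤ) + 1 - 1).toNat = a by omega] at hx
  rw [show (-(-(b : ℤ))).toNat = b by omega] at hy
  rcases le_or_gt ((a : ℤ) + 1 + -b) 0 with h | h
  · rw [mem_wittPiece_nonpos h, Prod.snd_mul, Prod.fst_mul, hx, hy, map_mul, map_mul, map_pow,
      map_natCast, WittVector.frobenius_verschiebung]
    obtain ⟨c, rfl⟩ : ∃ c : ℕ, b = a + 1 + c := ⟨b - (a + 1), by omega⟩
    rw [show (-((a : ℤ) + 1 + -((a + 1 + c : ℕ) : ℤ))).toNat = c by omega]
    ring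
  · rw [mem_wittPiece_pos h, Prod.snd_mul, Prod.fst_mul, hx, hy]
    obtain ⟨c, rfl⟩ : ∃ c : ℕ, a = b + c := ⟨a - b, by omega⟩
    rw [show (((b + c : ℕ) : ℤ) + 1 + -(b : ℤ) - 1).toNat = c by omega,
      mul_left_comm, verschiebung_pow_mul, WittVector.verschiebung_mul_frobenius]
    ring

instance wittPiece_gradedMonoid (R : Type*) [CommRing R] :
    SetLike.GradedMonoid (wittPiece p R) where
  one_mem := by
    rw [mem_wittPiece_nonpos le_rfl]
    simp
  mul_mem := by
    intro n m x y hx hy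
    rcases le_or_gt n 0 with hn | hn
    · rcases le_or_gt m 0 with hm | hm
      · rw [mem_wittPiece_nonpos hn] at hx
        rw [mem_wittPiece_nonpos hm] at hy
        rw [mem_wittPiece_nonpos (by omega), Prod.snd_mul, Prod.fst_mul, hx, hy, map_mul,
          show (-(n + m)).toNat = (-n).toNat + (-m).toNat by omega]
        ring
      · rw [mul_comm, add_comm]
        exact wittPiece_mul_pos_nonpos hm hn hy hx
    · rcases le_or_gt m 0 with hm | hm
      · exact wittPiece_mul_pos_nonpos hn hm hx hy
      · rw [mem_wittPiece_pos hn] at hx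
        rw [mem_wittPiece_pos hm] at hy
        rw [mem_wittPiece_pos (by omega), Prod.snd_mul, Prod.fst_mul, hx, hy, mul_mul_mul_comm,
          verschiebung_mul_verschiebung,
          show (n + m - 1).toNat = (n - 1).toNat + (m - 1).toNat + 1 by omega]
        ring

/-- The graded ring `W(R)^⊕ = ⨁_n W(R)^⊕_n` of the Witt frame of `R`. -/
@[nolint unusedArguments]
def WittGr (_k : Type*) (R : Type*) [CommRing R] : Type _ :=
  DirectSum ℤ fun n => wittPiece p R n

variable (k : Type*) (R : Type*) [CommRing R]

instance : CommRing (WittOver p k R) := inferInstanceAs (CommRing (WittVector p R))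

instance : CommRing (WittGr p k R) :=
  inferInstanceAs (CommRing (DirectSum ℤ fun n => wittPiece p R n))

namespace WittGr

/-- The inclusion of the degree `n` piece. -/
def of (n : ℤ) : wittPiece p R n →+ WittGr p k R :=
  DirectSum.of (fun n => wittPiece p R n) n

/-- The homogeneous elements of degree `n`. -/
def piece (n : ℤ) : AddSubgroup (WittGr p k R) := (of p k R n).range

variable {p k R} in
theorem induction {P : WittGr p k R → Prop} (h0 : P 0)
    (hof : ∀ n x, P (of p k R n x)) (hadd : ∀ x y, P x → P y → P (x + y)) (x) : P x :=
  DirectSum.induction_on (β := fun n => wittPiece p R n) x h0 hof hadd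

theorem of_mul_of {n m : ℤ} (x : wittPiece p R n) (y : wittPiece p R m) :
    of p k R n x * of p k R m y = of p k R (n + m) ⟨x * y, SetLike.mul_mem_graded x.2 y.2⟩ :=
  DirectSum.of_mul_of (A := fun n => wittPiece p R n) x y

theorem one_def : (1 : WittGr p k R) = of p k R 0 ⟨1, SetLike.GradedOne.one_mem⟩ := rfl

/-- The ring homomorphism given by a multiplicative family of additive maps. -/
def lift {B : Type*} [CommRing B] (f : ∀ n, wittPiece p R n →+ B)
    (h1 : f 0 ⟨1, SetLike.GradedOne.one_mem⟩ = 1)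
    (hm : ∀ (n m : ℤ) (x : wittPiece p R n) (y : wittPiece p R m),
      f (n + m) ⟨x * y, SetLike.mul_mem_graded x.2 y.2⟩ = f n x * f m y) : WittGr p k R →+* B :=
  DirectSum.toSemiring (A := fun n => wittPiece p R n) f h1 (fun {n m} => hm n m)

theorem lift_of {B : Type*} [CommRing B] (f : ∀ n, wittPiece p R n →+ B)
    (h1 : f 0 ⟨1, SetLike.GradedOne.one_mem⟩ = 1)
    (hm : ∀ (n m : ℤ) (x : wittPiece p R n) (y : wittPiece p R m),
      f (n + m) ⟨x * y, SetLike.mul_mem_graded x.2 y.2⟩ = f n x * f m y) (n : ℤ) (x : wittPiece p R n) :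
    lift p k R f h1 hm (of p k R n x) = f n x :=
  DirectSum.toSemiring_of (A := fun n => wittPiece p R n) f h1 (fun {n m} => hm n m) n x

/-- The pair `(τ, σ)` as a ring homomorphism. -/
def tauSigma : WittGr p k R →+* WittVector p R × WittVector p R :=
  DirectSum.coeRingHom (wittPiece p R)

theorem tauSigma_of {n : ℤ} (x : wittPiece p R n) : tauSigma p k R (of p k R n x) = x :=
  DirectSum.coeRingHom_of (wittPiece p R) n x

/-- The homomorphism `τ : W(R)^⊕ → W(R)` of the Witt frame. -/
def τ : WittGr p k R →+* WittOver p k R := (RingHom.fst _ _).comp (tauSigma p k R)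

/-- The homomorphism `σ : W(R)^⊕ → W(R)` of the Witt frame. -/
def σ : WittGr p k R →+* WittOver p k R := (RingHom.snd _ _).comp (tauSigma p k R)

/-- The identification of `W(R)` with the degree zero piece of `W(R)^⊕`. -/
def ofZero : WittOver p k R →+* WittGr p k R where
  toFun x := of p k R 0 ⟨((x : WittVector p R), WittVector.frobenius (p := p) (R := R) x), by
    rw [mem_wittPiece_nonpos le_rfl]; simp⟩
  map_zero' := by
    rw [← map_zero (of p k R 0)]
    congr 2
    exact Prod.ext rfl (map_zero (WittVector.frobenius (p := p) (R := R)))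
  map_one' := by
    rw [one_def]
    congr 2
    exact Prod.ext rfl (map_one (WittVector.frobenius (p := p) (R := R)))
  map_add' x y := by
    rw [← map_add (of p k R 0)]
    congr 2
    exact Prod.ext rfl (map_add (WittVector.frobenius (p := p) (R := R)) _ _)
  map_mul' x y := by
    rw [of_mul_of]
    congr 2
    exact Prod.ext rfl (map_mul (WittVector.frobenius (p := p) (R := R)) _ _)

theorem τ_ofZero (x : WittOver p k R) : τ p k R (ofZero p k R x) = x := by
  change (tauSigma p k R (of p k R 0 _)).1 = _
  rw [tauSigma_of]

theorem σ_ofZero (x : WittOver p k R) :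
    σ p k R (ofZero p k R x) = WittVector.frobenius (p := p) (R := R) x := by
  change (tauSigma p k R (of p k R 0 _)).2 = _
  rw [tauSigma_of]

theorem ofZero_mem (x : WittOver p k R) : ofZero p k R x ∈ piece p k R 0 := ⟨_, rfl⟩

instance : SetLike.GradedMonoid (piece p k R) where
  one_mem := ⟨_, rfl⟩
  mul_mem := by
    rintro n m _ _ ⟨x, rfl⟩ ⟨y, rfl⟩
    exact ⟨_, (of_mul_of p k R x y).symm⟩

/-- The decomposition of an element of `W(R)^⊕` into homogeneous pieces. -/
def decompose : WittGr p k R →+ DirectSum ℤ fun n => piece p k R n :=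
  DirectSum.toAddMonoid (β := fun n => wittPiece p R n) fun n =>
    (DirectSum.of (fun n => piece p k R n) n).comp (of p k R n).rangeRestrict

theorem decompose_of {n : ℤ} (x : wittPiece p R n) :
    decompose p k R (of p k R n x) =
      DirectSum.of (fun n => piece p k R n) n ⟨of p k R n x, ⟨x, rfl⟩⟩ :=
  DirectSum.toAddMonoid_of (β := fun n => wittPiece p R n) _ n x

instance : GradedRing (piece p k R) where
  decompose' := decompose p k R
  left_inv := by
    intro x
    induction x using induction with
    | h0 => simp
    | hof n x => rw [decompose_of, DirectSum.coeAddMonoidHom_of]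
    | hadd x y hx hy => rw [map_add, map_add, hx, hy]
  right_inv := by
    intro x
    induction x using DirectSum.induction_on with
    | zero => simp
    | of n x =>
      obtain ⟨_, ⟨x, rfl⟩⟩ := x
      rw [DirectSum.coeAddMonoidHom_of, decompose_of]
    | add x y hx hy => rw [map_add, map_add, hx, hy]

end WittGr

/-- The homomorphism `W(R)^⊕ → W(R)^⊕[T, T⁻¹]`, `s ↦ s T^n` for `s` of degree `n`. -/
def gradingHom : WittGr p k R →+* (WittGr p k R)[T;T⁻¹] :=
  WittGr.lift p k R
    (fun n => ((LinearMap.mulLeft (WittGr p k R)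
      (LaurentPolynomial.T n : (WittGr p k R)[T;T⁻¹])).toAddMonoidHom.comp
        (LaurentPolynomial.C : WittGr p k R →+* _).toAddMonoidHom).comp (WittGr.of p k R n))
    (by
      change LaurentPolynomial.T 0 * LaurentPolynomial.C (1 : WittGr p k R) = 1
      simp)
    (by
      intro n m x y
      change LaurentPolynomial.T (n + m) * LaurentPolynomial.C (WittGr.of p k R (n + m) _) =
        (LaurentPolynomial.T n * LaurentPolynomial.C (WittGr.of p k R n x)) *
        (LaurentPolynomial.T m * LaurentPolynomial.C (WittGr.of p k R m y))
      rw [LaurentPolynomial.T_add, mul_mul_mul_comm, ← map_mul, WittGr.of_mul_of])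

theorem gradingHom_of (n : ℤ) (x : wittPiece p R n) :
    gradingHom p k R (WittGr.of p k R n x) =
      LaurentPolynomial.T n * LaurentPolynomial.C (WittGr.of p k R n x) := by
  rw [gradingHom, WittGr.lift_of]
  rfl

end Frame

/-! ### Algebra structures on `W(R)` and `W(R)^⊕` -/

section FrameAlgebras

variable (p : ℕ) [hp : Fact p.Prime] (k : Type*) [Field k] [CharP k p] [PerfectRing k p]
  (R : Type*) [CommRing R] [Algebra (WittVector p k) R]

/-- The structure map `W(k) → W(W(k)) → W(R)`. -/
instance algebraWittOver : Algebra (WittVector p k) (WittOver p k R) :=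
  ((WittVector.map (algebraMap (WittVector p k) R)).comp (cartier p k) :
    WittVector p k →+* WittVector p R).toAlgebra

instance algebraPadicWittOver : Algebra ℤ_[p] (WittOver p k R) :=
  ((algebraMap (WittVector p k) (WittOver p k R)).comp
    (algebraMap ℤ_[p] (WittVector p k))).toAlgebra

instance algebraWittGr : Algebra (WittVector p k) (WittGr p k R) :=
  ((WittGr.ofZero p k R).comp (algebraMap (WittVector p k) (WittOver p k R))).toAlgebra

instance algebraPadicWittGr : Algebra ℤ_[p] (WittGr p k R) :=
  ((WittGr.ofZero p k R).comp (algebraMap ℤ_[p] (WittOver p k R))).toAlgebra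

instance : IsScalarTower ℤ_[p] (WittVector p k) (WittOver p k R) :=
  IsScalarTower.of_algebraMap_eq fun _ => rfl

instance : IsScalarTower ℤ_[p] (WittVector p k) (WittGr p k R) :=
  IsScalarTower.of_algebraMap_eq fun _ => rfl

theorem σ_algebraMap (x : ℤ_[p]) :
    WittGr.σ p k R (algebraMap ℤ_[p] (WittGr p k R) x) = algebraMap _ _ x := by
  change WittGr.σ p k R (WittGr.ofZero p k R _) = _
  rw [WittGr.σ_ofZero]
  change WittVector.frobenius (WittVector.map _ (cartier p k (algebraMap _ _ x))) =
    WittVector.map _ (cartier p k (algebraMap _ _ x))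
  rw [← map_frobenius_comm, frobenius_cartier, frobenius_algebraMap_padic]

/-- `τ` as a homomorphism of `ℤ_p`-algebras. -/
def tauAlg : WittGr p k R →ₐ[ℤ_[p]] WittOver p k R where
  __ := WittGr.τ p k R
  commutes' _ := WittGr.τ_ofZero p k R _

/-- `σ` as a homomorphism of `ℤ_p`-algebras. -/
def sigmaAlg : WittGr p k R →ₐ[ℤ_[p]] WittOver p k R where
  __ := WittGr.σ p k R
  commutes' x := σ_algebraMap p k R x

/-- The coaction `W(R)^⊕ → W(R)^⊕[T, T⁻¹]`, `s ↦ s T^n` for `s` of degree `n`, which is the action of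
`𝔾_m` on `Spec W(R)^⊕` given by the grading. -/
def gradingCoaction : WittGr p k R →ₐ[ℤ_[p]] (WittGr p k R)[T;T⁻¹] where
  __ := gradingHom p k R
  commutes' x := by
    refine (gradingHom_of p k R 0 _).trans ?_
    rw [LaurentPolynomial.T_zero, one_mul]
    rfl

end FrameAlgebras

/-! ### Points of an affine group scheme `G = Spec A` and its representations -/

section Points

variable {O : Type*} [CommRing O] {A : Type*} [CommRing A] [HopfAlgebra O A]

/-- For an affine group scheme `G = Spec A` over `O` and a commutative `O`-algebra `B`, the set `G(B)`
of `O`-algebra homomorphisms `A → B`, with the convolution product. -/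
abbrev Pts (O A B : Type*) [CommRing O] [CommRing A] [HopfAlgebra O A] [CommRing B]
    [Algebra O B] : Type _ := WithConv (A →ₐ[O] B)

instance ptsGroup (B : Type*) [CommRing B] [Algebra O B] : Group (Pts O A B) where
  inv f := WithConv.toConv (f.ofConv.comp (HopfAlgebra.antipodeAlgHom O A))
  inv_mul_cancel f := by
    ext a
    change _ = algebraMap O B (Coalgebra.counit a)
    rw [AlgHom.convMul_apply, ← (Coalgebra.Repr.arbitrary O a).eq]
    simp only [map_sum]
    have := congrArg f.ofConv
      (HopfAlgebra.sum_antipode_mul_eq_algebraMap_counit (Coalgebra.Repr.arbitrary O a))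
    rw [AlgHom.commutes, map_sum] at this
    rw [← this]
    refine Finset.sum_congr rfl fun i _ => ?_
    rw [map_mul]
    rfl

/-- The group homomorphism `G(B) → G(B')` induced by `B → B'`. -/
def Pts.map {B B' : Type*} [CommRing B] [Algebra O B] [CommRing B'] [Algebra O B']
    (φ : B →ₐ[O] B') : Pts O A B →* Pts O A B' where
  toFun g := WithConv.toConv (φ.comp g.ofConv)
  map_one' := by
    ext a
    exact φ.commutes _
  map_mul' g h := by
    ext a
    change φ ((g * h) a) = _
    rw [AlgHom.convMul_apply, AlgHom.convMul_apply, ← (Coalgebra.Repr.arbitrary O a).eq]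
    simp only [map_sum]
    exact Finset.sum_congr rfl fun i _ => map_mul φ _ _

end Points

section Representations

variable (O : Type) [CommRing O] (A : Type*) [CommRing A] [HopfAlgebra O A]

/-- A representation of `G = Spec A` on a finite free `O`-module, i.e. a finite free `O`-module with
a (right) `A`-comodule structure. -/
structure FreeRep where
  /-- the underlying module -/
  V : Type
  [addCommGroup : AddCommGroup V]
  [module : Module O V]
  [free : Module.Free O V]
  [finite : Module.Finite O V]
  /-- the coaction -/
  coact : V →ₗ[O] V ⊗[O] A
  coassoc : (TensorProduct.assoc O V A A).toLinearMap ∘ₗ coact.rTensor A ∘ₗ coact =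
    (Coalgebra.comul : A →ₗ[O] A ⊗[O] A).lTensor V ∘ₗ coact
  counit : (TensorProduct.rid O V).toLinearMap ∘ₗ
    (Coalgebra.counit : A →ₗ[O] O).lTensor V ∘ₗ coact = LinearMap.id

attribute [instance] FreeRep.addCommGroup FreeRep.module FreeRep.free FreeRep.finite

variable {O A}

namespace FreeRep

/-- A morphism of representations is a linear map which commutes with the coactions. -/
@[ext]
structure Hom (X Y : FreeRep O A) where
  /-- the underlying linear map -/
  lin : X.V →ₗ[O] Y.V
  comm : Y.coact ∘ₗ lin = lin.rTensor A ∘ₗ X.coact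

instance : Category (FreeRep O A) where
  Hom X Y := Hom X Y
  id X := ⟨LinearMap.id, by simp⟩
  comp f g := ⟨g.lin ∘ₗ f.lin, by
    rw [← LinearMap.comp_assoc, g.comm, LinearMap.comp_assoc, f.comm, LinearMap.rTensor_comp,
      LinearMap.comp_assoc]⟩

@[ext]
theorem hom_ext {X Y : FreeRep O A} {f g : X ⟶ Y} (h : f.lin = g.lin) : f = g := Hom.ext h

@[simp] theorem id_lin (X : FreeRep O A) : Hom.lin (𝟙 X) = LinearMap.id := rfl
@[simp] theorem comp_lin {X Y Z : FreeRep O A} (f : X ⟶ Y) (g : Y ⟶ Z) :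
    (f ≫ g).lin = g.lin ∘ₗ f.lin := rfl

/-- The forgetful functor to `O`-modules. -/
@[simps] def forget : FreeRep O A ⥤ ModuleCat.{0} O where
  obj X := ModuleCat.of O X.V
  map f := ModuleCat.ofHom f.lin

instance : (forget (O := O) (A := A)).Faithful where
  map_injective h := hom_ext (congrArg ModuleCat.Hom.hom h)

/-- Construct an isomorphism of representations from an equivariant linear isomorphism. -/
@[simps] def isoMk {X Y : FreeRep O A} (e : X.V ≃ₗ[O] Y.V)
    (h : Y.coact ∘ₗ e.toLinearMap = e.toLinearMap.rTensor A ∘ₗ X.coact) : X ≅ Y where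
  hom := ⟨e, h⟩
  inv := ⟨e.symm, by
    ext y
    obtain ⟨x, rfl⟩ := e.surjective y
    have h2 := LinearMap.congr_fun h x
    simp only [LinearMap.comp_apply, LinearEquiv.coe_coe] at h2 ⊢
    rw [h2, LinearEquiv.symm_apply_apply, ← LinearMap.comp_apply, ← LinearMap.rTensor_comp]
    simp⟩
  hom_inv_id := by ext x; simp
  inv_hom_id := by ext x; simp

/-- The action of a point `g ∈ G(B)` on `V ⊗ B` (written `B ⊗ V`), `v ↦ ∑ v₀ ⊗ g(v₁)`. -/
def act (X : FreeRep O A) {B : Type*} [CommRing B] [Algebra O B] (g : Pts O A B) :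
    B ⊗[O] X.V →ₗ[B] B ⊗[O] X.V :=
  LinearMap.liftBaseChange B ((TensorProduct.comm O X.V B).toLinearMap ∘ₗ
    g.ofConv.toLinearMap.lTensor X.V ∘ₗ X.coact)

theorem act_tmul (X : FreeRep O A) {B : Type*} [CommRing B] [Algebra O B] (g : Pts O A B)
    (b : B) (v : X.V) : X.act g (b ⊗ₜ v) =
      b • TensorProduct.comm O X.V B (g.ofConv.toLinearMap.lTensor X.V (X.coact v)) := by
  simp [act]

theorem act_one (X : FreeRep O A) {B : Type*} [CommRing B] [Algebra O B] :
    X.act (1 : Pts O A B) = LinearMap.id := by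
  apply TensorProduct.AlgebraTensorModule.curry_injective
  ext v
  change X.act 1 ((1 : B) ⊗ₜ v) = 1 ⊗ₜ v
  rw [act_tmul, one_smul]
  have h := LinearMap.congr_fun X.counit v
  simp only [LinearMap.comp_apply, LinearMap.id_apply] at h
  conv_rhs => rw [← h]
  generalize X.coact v = z
  induction z with
  | zero => simp
  | add x y hx hy => simp only [map_add, hx, hy, TensorProduct.tmul_add]
  | tmul w a =>
    simp only [LinearMap.lTensor_tmul, TensorProduct.comm_tmul, LinearEquiv.coe_coe,
      TensorProduct.rid_tmul, TensorProduct.tmul_smul]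
    change algebraMap O B (Coalgebra.counit a) ⊗ₜ[O] w = _
    rw [Algebra.algebraMap_eq_smul_one, TensorProduct.smul_tmul']

theorem act_mul (X : FreeRep O A) {B : Type*} [CommRing B] [Algebra O B] (g h : Pts O A B) :
    X.act (g * h) = X.act g ∘ₗ X.act h := by
  apply TensorProduct.AlgebraTensorModule.curry_injective
  ext v
  change X.act (g * h) ((1 : B) ⊗ₜ v) = X.act g (X.act h (1 ⊗ₜ v))
  rw [act_tmul, act_tmul, one_smul, one_smul]
  -- the pairing `V ⊗ (A ⊗ A) → B ⊗ V`
  let P : X.V ⊗[O] (A ⊗[O] A) →ₗ[O] B ⊗[O] X.V :=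
    (TensorProduct.comm O X.V B).toLinearMap ∘ₗ
      (LinearMap.mul' O B ∘ₗ TensorProduct.map g.ofConv.toLinearMap h.ofConv.toLinearMap).lTensor
        X.V
  have hc := congrArg P (LinearMap.congr_fun X.coassoc v)
  simp only [LinearMap.comp_apply, LinearEquiv.coe_coe] at hc
  have h1 : ∀ z : X.V ⊗[O] A, P ((Coalgebra.comul : A →ₗ[O] A ⊗[O] A).lTensor X.V z) =
      TensorProduct.comm O X.V B ((g * h).ofConv.toLinearMap.lTensor X.V z) := by
    intro z
    induction z with
    | zero => simp
    | add x y hx hy => simp only [map_add, hx, hy]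
    | tmul w a => rfl
  have h2 : ∀ z : X.V ⊗[O] A, P (TensorProduct.assoc O X.V A A (X.coact.rTensor A z)) =
      X.act g (TensorProduct.comm O X.V B (h.ofConv.toLinearMap.lTensor X.V z)) := by
    intro z
    induction z with
    | zero => simp
    | add x y hx hy => simp only [map_add, hx, hy]
    | tmul w a =>
      simp only [LinearMap.rTensor_tmul, LinearMap.lTensor_tmul, TensorProduct.comm_tmul, act_tmul]
      generalize X.coact w = y
      induction y with
      | zero => simp
      | add x y hx hy =>
        simp only [map_add, TensorProduct.add_tmul, smul_add, hx, hy]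
      | tmul u c =>
        simp [P, TensorProduct.smul_tmul', mul_comm]
  rw [← h1, ← h2]
  exact hc.symm

theorem act_map (X : FreeRep O A) {B B' : Type*} [CommRing B] [Algebra O B] [CommRing B']
    [Algebra O B'] (φ : B →ₐ[O] B') (g : Pts O A B) (z : B ⊗[O] X.V) :
    X.act (Pts.map φ g) (φ.toLinearMap.rTensor X.V z) =
      φ.toLinearMap.rTensor X.V (X.act g z) := by
  induction z with
  | zero => simp
  | add x y hx hy => simp only [map_add, hx, hy]
  | tmul b v =>
    simp only [LinearMap.rTensor_tmul, act_tmul]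
    generalize X.coact v = y
    induction y with
    | zero => simp
    | add x y hx hy => simp only [map_add, smul_add, hx, hy]
    | tmul u c =>
      simp [TensorProduct.smul_tmul', Pts.map]

theorem act_hom {X Y : FreeRep O A} (f : X ⟶ Y) {B : Type*} [CommRing B] [Algebra O B]
    (g : Pts O A B) (z : B ⊗[O] X.V) :
    Y.act g (f.lin.lTensor B z) = f.lin.lTensor B (X.act g z) := by
  induction z with
  | zero => simp
  | add x y hx hy => simp only [map_add, hx, hy]
  | tmul b v =>
    have := LinearMap.congr_fun f.comm v
    simp only [LinearMap.comp_apply] at this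
    simp only [LinearMap.lTensor_tmul, act_tmul, this]
    generalize X.coact v = y
    induction y with
    | zero => simp
    | add x y hx hy => simp only [map_add, smul_add, hx, hy]
    | tmul u c => simp [TensorProduct.smul_tmul']

/-- The action of `g ∈ G(B)` as a linear automorphism of `V ⊗ B`. -/
def actEquiv (X : FreeRep O A) {B : Type*} [CommRing B] [Algebra O B] (g : Pts O A B) :
    (B ⊗[O] X.V) ≃ₗ[B] (B ⊗[O] X.V) :=
  LinearEquiv.ofLinearMap (X.act g) (X.act g⁻¹)
    (by rw [← act_mul, mul_inv_cancel, act_one]) (by rw [← act_mul, inv_mul_cancel, act_one])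

/-! #### Tensor products of representations -/

/-- The product `(V ⊗ A) ⊗ (W ⊗ A) → (V ⊗ W) ⊗ A`. -/
def mulCoeff (V W : Type*) [AddCommGroup V] [Module O V] [AddCommGroup W] [Module O W]
    (A : Type*) [CommRing A] [Algebra O A] :
    (V ⊗[O] A) ⊗[O] (W ⊗[O] A) →ₗ[O] (V ⊗[O] W) ⊗[O] A :=
  (LinearMap.mul' O A).lTensor (V ⊗[O] W) ∘ₗ
    (TensorProduct.tensorTensorTensorComm O V A W A).toLinearMap

@[simp] theorem mulCoeff_tmul {V W : Type*} [AddCommGroup V] [Module O V] [AddCommGroup W]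
    [Module O W] {A : Type*} [CommRing A] [Algebra O A] (v : V) (w : W) (a b : A) :
    mulCoeff (O := O) V W A ((v ⊗ₜ a) ⊗ₜ (w ⊗ₜ b)) = (v ⊗ₜ w) ⊗ₜ (a * b) := by
  simp [mulCoeff]

/-- The tensor product of two representations. -/
def tensor (X Y : FreeRep O A) : FreeRep O A where
  V := X.V ⊗[O] Y.V
  coact := mulCoeff X.V Y.V A ∘ₗ TensorProduct.map X.coact Y.coact
  coassoc := by
    ext v w
    let M : (X.V ⊗[O] (A ⊗[O] A)) ⊗[O] (Y.V ⊗[O] (A ⊗[O] A)) →ₗ[O]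
        (X.V ⊗[O] Y.V) ⊗[O] (A ⊗[O] A) := mulCoeff X.V Y.V (A ⊗[O] A)
    have h1 : ∀ (x : X.V ⊗[O] A) (y : Y.V ⊗[O] A),
        TensorProduct.assoc O _ A A
          ((mulCoeff X.V Y.V A ∘ₗ TensorProduct.map X.coact Y.coact).rTensor A
            (mulCoeff X.V Y.V A (x ⊗ₜ y))) =
        M (TensorProduct.assoc O _ A A (X.coact.rTensor A x) ⊗ₜ
          TensorProduct.assoc O _ A A (Y.coact.rTensor A y)) := by
      intro x y
      induction x with
      | zero => simp
      | add x x' hx hx' => simp only [TensorProduct.add_tmul, map_add, hx, hx']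
      | tmul v a =>
        induction y with
        | zero => simp
        | add y y' hy hy' => simp only [TensorProduct.tmul_add, map_add, hy, hy']
        | tmul w b =>
          simp only [mulCoeff_tmul, LinearMap.rTensor_tmul, LinearMap.comp_apply,
            TensorProduct.map_tmul]
          generalize X.coact v = x
          generalize Y.coact w = y
          induction x with
          | zero => simp
          | add x x' hx hx' => simp only [TensorProduct.add_tmul, map_add, hx, hx']
          | tmul v' a' =>
            induction y with
            | zero => simp
            | add y y' hy hy' =>
              simp only [TensorProduct.tmul_add, TensorProduct.add_tmul, map_add, hy, hy']
            | tmul w' b' => simp [M]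
    have h2 : ∀ (x : X.V ⊗[O] A) (y : Y.V ⊗[O] A),
        (Coalgebra.comul : A →ₗ[O] A ⊗[O] A).lTensor (X.V ⊗[O] Y.V)
          (mulCoeff X.V Y.V A (x ⊗ₜ y)) =
        M ((Coalgebra.comul : A →ₗ[O] A ⊗[O] A).lTensor X.V x ⊗ₜ
          (Coalgebra.comul : A →ₗ[O] A ⊗[O] A).lTensor Y.V y) := by
      intro x y
      induction x with
      | zero => simp
      | add x x' hx hx' => simp only [TensorProduct.add_tmul, map_add, hx, hx']
      | tmul v a =>
        induction y with
        | zero => simp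
        | add y y' hy hy' => simp only [TensorProduct.tmul_add, map_add, hy, hy']
        | tmul w b => simp [M]
    have hX := LinearMap.congr_fun X.coassoc v
    have hY := LinearMap.congr_fun Y.coassoc w
    simp only [LinearMap.comp_apply, LinearEquiv.coe_coe] at hX hY
    change TensorProduct.assoc O _ A A
          ((mulCoeff X.V Y.V A ∘ₗ TensorProduct.map X.coact Y.coact).rTensor A
            (mulCoeff X.V Y.V A (X.coact v ⊗ₜ Y.coact w))) =
      (Coalgebra.comul : A →ₗ[O] A ⊗[O] A).lTensor (X.V ⊗[O] Y.V)
          (mulCoeff X.V Y.V A (X.coact v ⊗ₜ Y.coact w))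
    rw [h1, h2, hX, hY]
  counit := by
    ext v w
    have h : ∀ (x : X.V ⊗[O] A) (y : Y.V ⊗[O] A),
        TensorProduct.rid O _ ((Coalgebra.counit : A →ₗ[O] O).lTensor (X.V ⊗[O] Y.V)
          (mulCoeff X.V Y.V A (x ⊗ₜ y))) =
        TensorProduct.rid O _ ((Coalgebra.counit : A →ₗ[O] O).lTensor X.V x) ⊗ₜ
        TensorProduct.rid O _ ((Coalgebra.counit : A →ₗ[O] O).lTensor Y.V y) := by
      intro x y
      induction x with
      | zero => simp
      | add x x' hx hx' => simp only [TensorProduct.add_tmul, map_add, hx, hx']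
      | tmul v a =>
        induction y with
        | zero => simp
        | add y y' hy hy' => simp only [TensorProduct.tmul_add, map_add, hy, hy']
        | tmul w b =>
          simp only [mulCoeff_tmul, LinearMap.lTensor_tmul, TensorProduct.rid_tmul,
            Bialgebra.counit_mul, TensorProduct.tmul_smul, TensorProduct.smul_tmul', mul_smul]
          rw [smul_comm]
    have hX := LinearMap.congr_fun X.counit v
    have hY := LinearMap.congr_fun Y.counit w
    simp only [LinearMap.comp_apply, LinearEquiv.coe_coe, LinearMap.id_apply] at hX hY
    change TensorProduct.rid O _ ((Coalgebra.counit : A →ₗ[O] O).lTensor (X.V ⊗[O] Y.V)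
          (mulCoeff X.V Y.V A (X.coact v ⊗ₜ Y.coact w))) = v ⊗ₜ w
    rw [h, hX, hY]

theorem tensor_coact (X Y : FreeRep O A) (v : X.V) (w : Y.V) :
    (tensor X Y).coact (v ⊗ₜ w) = mulCoeff X.V Y.V A (X.coact v ⊗ₜ Y.coact w) := rfl

/-- The trivial representation on `O`. -/
def unit : FreeRep O A where
  V := O
  coact := (TensorProduct.mk O O A).flip 1
  coassoc := by
    ext
    simp [Algebra.TensorProduct.one_def]
  counit := by
    ext
    simp

/-- The tensor product of two morphisms. -/
def tensorMap {X Y X' Y' : FreeRep O A} (f : X ⟶ Y) (g : X' ⟶ Y') :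
    tensor X X' ⟶ tensor Y Y' where
  lin := TensorProduct.map f.lin g.lin
  comm := by
    apply TensorProduct.ext'
    intro v w
    have hf := LinearMap.congr_fun f.comm v
    have hg := LinearMap.congr_fun g.comm w
    simp only [LinearMap.comp_apply] at hf hg
    change mulCoeff Y.V Y'.V A (Y.coact (f.lin v) ⊗ₜ Y'.coact (g.lin w)) =
      (TensorProduct.map f.lin g.lin).rTensor A
        (mulCoeff X.V X'.V A (X.coact v ⊗ₜ X'.coact w))
    rw [hf, hg]
    generalize X.coact v = x
    generalize X'.coact w = y
    induction x with
    | zero => simp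
    | add x x' hx hx' => simp only [TensorProduct.add_tmul, map_add, hx, hx']
    | tmul v a =>
      induction y with
      | zero => simp
      | add y y' hy hy' => simp only [TensorProduct.tmul_add, map_add, hy, hy']
      | tmul w b => simp

theorem assoc_comm (X Y Z : FreeRep O A) :
    (tensor X (tensor Y Z)).coact ∘ₗ (TensorProduct.assoc O X.V Y.V Z.V).toLinearMap =
      (TensorProduct.assoc O X.V Y.V Z.V).toLinearMap.rTensor A ∘ₗ
        (tensor (tensor X Y) Z).coact := by
  apply TensorProduct.ext_threefold
  intro u v w
  change mulCoeff X.V (Y.V ⊗[O] Z.V) A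
      (X.coact u ⊗ₜ mulCoeff Y.V Z.V A (Y.coact v ⊗ₜ Z.coact w)) =
    (TensorProduct.assoc O X.V Y.V Z.V).toLinearMap.rTensor A
      (mulCoeff (X.V ⊗[O] Y.V) Z.V A (mulCoeff X.V Y.V A (X.coact u ⊗ₜ Y.coact v) ⊗ₜ Z.coact w))
  generalize X.coact u = x
  generalize Y.coact v = y
  generalize Z.coact w = z
  induction x with
  | zero => simp
  | add x x' hx hx' => simp only [TensorProduct.add_tmul, map_add, hx, hx']
  | tmul v a =>
    induction y with
    | zero => simp
    | add y y' hy hy' =>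
      simp only [TensorProduct.tmul_add, TensorProduct.add_tmul, map_add, hy, hy']
    | tmul w b =>
      induction z with
      | zero => simp
      | add y y' hy hy' => simp only [TensorProduct.tmul_add, map_add, hy, hy']
      | tmul w b => simp [mul_assoc]

theorem lid_comm (X : FreeRep O A) :
    X.coact ∘ₗ (TensorProduct.lid O X.V).toLinearMap =
      (TensorProduct.lid O X.V).toLinearMap.rTensor A ∘ₗ (tensor unit X).coact := by
  ext v
  change X.coact ((1 : O) • v) = (TensorProduct.lid O X.V).toLinearMap.rTensor A
    (mulCoeff O X.V A (((1 : O) ⊗ₜ (1 : A)) ⊗ₜ X.coact v))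
  rw [one_smul]
  generalize X.coact v = x
  induction x with
  | zero => simp
  | add x x' hx hx' => simp only [TensorProduct.tmul_add, map_add, ← hx, ← hx']
  | tmul v a => simp

theorem rid_comm (X : FreeRep O A) :
    X.coact ∘ₗ (TensorProduct.rid O X.V).toLinearMap =
      (TensorProduct.rid O X.V).toLinearMap.rTensor A ∘ₗ (tensor X unit).coact := by
  ext v
  change X.coact ((1 : O) • v) = (TensorProduct.rid O X.V).toLinearMap.rTensor A
    (mulCoeff X.V O A (X.coact v ⊗ₜ ((1 : O) ⊗ₜ (1 : A))))
  rw [one_smul]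
  generalize X.coact v = x
  induction x with
  | zero => simp
  | add x x' hx hx' => simp only [TensorProduct.add_tmul, map_add, ← hx, ← hx']
  | tmul v a => simp

theorem comm_comm (X Y : FreeRep O A) :
    (tensor Y X).coact ∘ₗ (TensorProduct.comm O X.V Y.V).toLinearMap =
      (TensorProduct.comm O X.V Y.V).toLinearMap.rTensor A ∘ₗ (tensor X Y).coact := by
  ext v w
  change mulCoeff Y.V X.V A (Y.coact w ⊗ₜ X.coact v) =
    (TensorProduct.comm O X.V Y.V).toLinearMap.rTensor A
      (mulCoeff X.V Y.V A (X.coact v ⊗ₜ Y.coact w))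
  generalize X.coact v = x
  generalize Y.coact w = y
  induction x with
  | zero => simp
  | add x x' hx hx' => simp only [TensorProduct.tmul_add, TensorProduct.add_tmul, map_add, hx, hx']
  | tmul v a =>
    induction y with
    | zero => simp
    | add y y' hy hy' =>
      simp only [TensorProduct.tmul_add, TensorProduct.add_tmul, map_add, hy, hy']
    | tmul w b => simp [mul_comm]

instance : MonoidalCategoryStruct (FreeRep O A) where
  tensorObj X Y := tensor X Y
  tensorHom f g := tensorMap f g
  whiskerLeft X _ _ f := tensorMap (𝟙 X) f
  whiskerRight f Y := tensorMap f (𝟙 Y)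
  tensorUnit := unit
  associator X Y Z := isoMk (TensorProduct.assoc O X.V Y.V Z.V) (assoc_comm X Y Z)
  leftUnitor X := isoMk (TensorProduct.lid O X.V) (lid_comm X)
  rightUnitor X := isoMk (TensorProduct.rid O X.V) (rid_comm X)

/-- The forgetful functor preserves the tensor structure on the nose. -/
def inducing : Monoidal.InducingFunctorData (forget (O := O) (A := A)) where
  μIso X Y := Iso.refl _
  εIso := Iso.refl _
  whiskerLeft_eq X _ _ f := by
    apply ModuleCat.hom_ext; apply TensorProduct.ext'; intro x y; rfl
  whiskerRight_eq f Y := by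
    apply ModuleCat.hom_ext; apply TensorProduct.ext'; intro x y; rfl
  tensorHom_eq f g := by
    apply ModuleCat.hom_ext; apply TensorProduct.ext'; intro x y; rfl
  associator_eq X Y Z := by
    apply ModuleCat.hom_ext; apply TensorProduct.ext_threefold; intro x y z; rfl
  leftUnitor_eq X := by
    apply ModuleCat.hom_ext; apply TensorProduct.ext'; intro x y; rfl
  rightUnitor_eq X := by
    apply ModuleCat.hom_ext; apply TensorProduct.ext'; intro x y; rfl

instance : MonoidalCategory (FreeRep O A) := Monoidal.induced forget inducing

instance : (forget (O := O) (A := A)).Monoidal := Monoidal.fromInducedMonoidal forget inducing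

instance : BraidedCategory (FreeRep O A) :=
  BraidedCategory.ofFaithful forget
    (fun X Y => isoMk (TensorProduct.comm O X.V Y.V) (comm_comm X Y)) (fun X Y => by
      apply ModuleCat.hom_ext; apply TensorProduct.ext'; intro x y; rfl)

instance : (forget (O := O) (A := A)).Braided where
  braided X Y := by
    apply ModuleCat.hom_ext; apply TensorProduct.ext'; intro x y; rfl

instance : SymmetricCategory (FreeRep O A) := SymmetricCategory.ofFaithful forget

end FreeRep

end Representations

/-! ### Finite projective graded modules -/

section GradedModules

theorem isInternal_of_proj {M : Type*} [AddCommGroup M] (P : ℤ → AddSubgroup M) (D : ℤ → M →+ M)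
    (h1 : ∀ i, ∀ x ∈ P i, D i x = x) (h2 : ∀ i j, i ≠ j → ∀ x ∈ P i, D j x = 0)
    (h3 : ∀ x, x ∈ AddSubgroup.closure (⋃ i, (P i : Set M))) : DirectSum.IsInternal P := by
  classical
  have key : ∀ (z : DirectSum ℤ fun i => P i) (j : ℤ),
      D j (DirectSum.coeAddMonoidHom P z) = z j := by
    intro z j
    induction z using DirectSum.induction_on with
    | zero => simp
    | of i x =>
      rw [DirectSum.coeAddMonoidHom_of]
      by_cases hij : i = j
      · subst hij
        rw [DirectSum.of_eq_same, h1 i x x.2]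
      · rw [DirectSum.of_eq_of_ne _ _ _ (Ne.symm hij), h2 i j hij x x.2]
        rfl
    | add x y hx hy => rw [map_add, map_add, hx, hy]; rfl
  constructor
  · rw [injective_iff_map_eq_zero]
    intro z hz
    ext j
    rw [← key z j, hz, map_zero]
    rfl
  · intro x
    have : AddSubgroup.closure (⋃ i, (P i : Set M)) ≤ (DirectSum.coeAddMonoidHom P).range := by
      rw [AddSubgroup.closure_le]
      intro y hy
      obtain ⟨i, hi⟩ := Set.mem_iUnion.mp hy
      exact ⟨DirectSum.of (fun i => P i) i ⟨y, hi⟩, DirectSum.coeAddMonoidHom_of P i _⟩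
    exact this (h3 x)

/-- The projection to the piece of degree `i`. -/
def internalProj {M : Type*} [AddCommGroup M] {P : ℤ → AddSubgroup M}
    (h : DirectSum.IsInternal P) (i : ℤ) : M →+ M :=
  letI := h.chooseDecomposition
  ((P i).subtype.comp (DFinsupp.evalAddMonoidHom i)).comp
    (DirectSum.decomposeAddEquiv P).toAddMonoidHom

section
variable {M : Type*} [AddCommGroup M] {P : ℤ → AddSubgroup M}

theorem internalProj_mem (h : DirectSum.IsInternal P) (i : ℤ) (x : M) : internalProj h i x ∈ P i :=
  letI := h.chooseDecomposition
  SetLike.coe_mem (DirectSum.decompose P x i)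

theorem internalProj_same (h : DirectSum.IsInternal P) {i : ℤ} {x : M} (hx : x ∈ P i) : internalProj h i x = x :=
  letI := h.chooseDecomposition
  DirectSum.decompose_of_mem_same P hx

theorem internalProj_ne (h : DirectSum.IsInternal P) {i j : ℤ} {x : M} (hx : x ∈ P i) (hij : i ≠ j) :
    internalProj h j x = 0 :=
  letI := h.chooseDecomposition
  DirectSum.decompose_of_mem_ne P hx hij

theorem internal_induction (h : DirectSum.IsInternal P) {C : M → Prop} (h0 : C 0) (hof : ∀ i, ∀ x ∈ P i, C x)
    (hadd : ∀ x y, C x → C y → C (x + y)) (x : M) : C x :=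
  letI := h.chooseDecomposition
  DirectSum.Decomposition.inductionOn P h0 (fun m => hof _ m m.2) hadd x

/-- An additive bijection preserving internal gradings also reflects them. -/
theorem mem_of_map_mem (h : DirectSum.IsInternal P) {N : Type*} [AddCommGroup N]
    {Q : ℤ → AddSubgroup N} (h' : DirectSum.IsInternal Q) (e : M →+ N) (he : Function.Injective e)
    (hm : ∀ i, ∀ x ∈ P i, e x ∈ Q i) {i : ℤ} {x : M} (hx : e x ∈ Q i) : x ∈ P i := by
  have key : ∀ (j : ℤ) (y : M), internalProj h' j (e y) = e (internalProj h j y) := by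
    intro j y
    induction y using internal_induction h with
    | h0 => simp
    | hof l y hy =>
      by_cases hl : l = j
      · subst hl
        rw [internalProj_same h hy, internalProj_same h' (hm _ _ hy)]
      · rw [internalProj_ne h hy hl, internalProj_ne h' (hm _ _ hy) hl, map_zero]
    | hadd x y hx hy => simp only [map_add, hx, hy]
  have := key i x
  rw [internalProj_same h' hx] at this
  rw [he this]
  exact internalProj_mem h i x

end

variable {S : Type r} [CommRing S] (𝒜 : ℤ → AddSubgroup S) [GradedRing 𝒜]

/-- A finite projective graded module over a `ℤ`-graded ring. -/
structure GrProj where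
  /-- the underlying module -/
  M : Type r
  [addCommGroup : AddCommGroup M]
  [module : Module S M]
  [finite : Module.Finite S M]
  [projective : Module.Projective S M]
  /-- the graded pieces -/
  piece : ℤ → AddSubgroup M
  smul_mem : ∀ {i j : ℤ} {s : S} {m : M}, s ∈ 𝒜 i → m ∈ piece j → s • m ∈ piece (i + j)
  isInternal : DirectSum.IsInternal piece

attribute [instance] GrProj.addCommGroup GrProj.module GrProj.finite GrProj.projective

variable {𝒜}

namespace GrProj

/-- A morphism of graded modules is a linear map which preserves the gradings. -/
@[ext]
structure Hom (X Y : GrProj 𝒜) where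
  /-- the underlying linear map -/
  lin : X.M →ₗ[S] Y.M
  map_mem : ∀ i, ∀ x ∈ X.piece i, lin x ∈ Y.piece i

instance : Category (GrProj 𝒜) where
  Hom X Y := Hom X Y
  id X := ⟨LinearMap.id, fun _ _ h => h⟩
  comp f g := ⟨g.lin ∘ₗ f.lin, fun i x h => g.map_mem i _ (f.map_mem i x h)⟩

@[ext]
theorem hom_ext {X Y : GrProj 𝒜} {f g : X ⟶ Y} (h : f.lin = g.lin) : f = g := Hom.ext h

@[simp] theorem id_lin (X : GrProj 𝒜) : Hom.lin (𝟙 X) = LinearMap.id := rfl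
@[simp] theorem comp_lin {X Y Z : GrProj 𝒜} (f : X ⟶ Y) (g : Y ⟶ Z) :
    (f ≫ g).lin = g.lin ∘ₗ f.lin := rfl

/-- The forgetful functor to modules. -/
@[simps] def forget : GrProj 𝒜 ⥤ ModuleCat.{r} S where
  obj X := ModuleCat.of S X.M
  map f := ModuleCat.ofHom f.lin

instance : (forget (𝒜 := 𝒜)).Faithful where
  map_injective h := hom_ext (congrArg ModuleCat.Hom.hom h)

/-- Construct an isomorphism of graded modules from a linear isomorphism preserving degrees. -/
@[simps] def isoMk {X Y : GrProj 𝒜} (e : X.M ≃ₗ[S] Y.M)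
    (h : ∀ i, ∀ x ∈ X.piece i, e x ∈ Y.piece i) : X ≅ Y where
  hom := ⟨e, h⟩
  inv := ⟨e.symm, fun i y hy => mem_of_map_mem X.isInternal Y.isInternal
    (e : X.M →+ Y.M) e.injective h (by simpa using hy)⟩
  hom_inv_id := by ext x; simp
  inv_hom_id := by ext x; simp

/-- The degree `l` piece of `M ⊗ N`, spanned by the `m ⊗ n` with `deg m + deg n = l`. -/
def tensorPiece {M N : Type*} [AddCommGroup M] [Module S M] [AddCommGroup N] [Module S N]
    (P : ℤ → AddSubgroup M) (Q : ℤ → AddSubgroup N) (l : ℤ) : AddSubgroup (M ⊗[S] N) :=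
  AddSubgroup.closure {z | ∃ i j, i + j = l ∧ ∃ x ∈ P i, ∃ y ∈ Q j, z = x ⊗ₜ[S] y}

section
variable {M N L : Type*} [AddCommGroup M] [Module S M] [AddCommGroup N] [Module S N]
  [AddCommGroup L] [Module S L] {P : ℤ → AddSubgroup M} {Q : ℤ → AddSubgroup N}
  {U : ℤ → AddSubgroup L}

theorem tmul_mem {i j : ℤ} {x : M} {y : N} (hx : x ∈ P i) (hy : y ∈ Q j) :
    x ⊗ₜ[S] y ∈ tensorPiece P Q (i + j) :=
  AddSubgroup.subset_closure ⟨i, j, rfl, x, hx, y, hy, rfl⟩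

/-- To check that a linear map out of a tensor product preserves degrees, it suffices to consider
pure tensors. -/
theorem map_mem_of_tmul (f : M ⊗[S] N →ₗ[S] L)
    (h : ∀ i j, ∀ x ∈ P i, ∀ y ∈ Q j, f (x ⊗ₜ y) ∈ U (i + j)) (l : ℤ)
    (z : M ⊗[S] N) (hz : z ∈ tensorPiece P Q l) : f z ∈ U l := by
  induction hz using AddSubgroup.closure_induction with
  | mem z hz =>
    obtain ⟨a, b, rfl, x, hx, y, hy, rfl⟩ := hz
    exact h a b x hx y hy
  | zero => simp
  | add x y _ _ hx hy => rw [map_add]; exact add_mem hx hy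
  | neg x _ hx => rw [map_neg]; exact neg_mem hx

theorem assoc_mem (i : ℤ) (w : (M ⊗[S] N) ⊗[S] L)
    (hw : w ∈ tensorPiece (tensorPiece P Q) U i) :
    TensorProduct.assoc S M N L w ∈ tensorPiece P (tensorPiece Q U) i := by
  refine map_mem_of_tmul (P := tensorPiece P Q) (Q := U)
    (TensorProduct.assoc S M N L).toLinearMap (fun i j x hx z hz => ?_) i w hw
  change TensorProduct.assoc S M N L (x ⊗ₜ z) ∈ tensorPiece P (tensorPiece Q U) (i + j)
  induction hx using AddSubgroup.closure_induction with
  | mem x hx =>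
    obtain ⟨a, b, rfl, x, hx, y, hy, rfl⟩ := hx
    rw [TensorProduct.assoc_tmul, add_assoc]
    exact tmul_mem hx (tmul_mem hy hz)
  | zero => rw [TensorProduct.zero_tmul, map_zero]; exact zero_mem _
  | add x y _ _ hx hy => rw [TensorProduct.add_tmul, map_add]; exact add_mem hx hy
  | neg x _ hx => rw [TensorProduct.neg_tmul, map_neg]; exact neg_mem hx

theorem comm_mem (i : ℤ) (w : M ⊗[S] N) (hw : w ∈ tensorPiece P Q i) :
    TensorProduct.comm S M N w ∈ tensorPiece Q P i :=
  map_mem_of_tmul (TensorProduct.comm S M N).toLinearMap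
    (fun i j x hx y hy => by
      rw [add_comm]
      exact tmul_mem hy hx) i w hw

end

theorem lid_mem (X : GrProj 𝒜) (i : ℤ) (w : S ⊗[S] X.M) (hw : w ∈ tensorPiece 𝒜 X.piece i) :
    TensorProduct.lid S X.M w ∈ X.piece i :=
  map_mem_of_tmul (TensorProduct.lid S X.M).toLinearMap
    (fun i j x hx y hy => by
      change TensorProduct.lid S X.M (x ⊗ₜ y) ∈ _
      rw [TensorProduct.lid_tmul]
      exact X.smul_mem hx hy) i w hw

theorem rid_mem (X : GrProj 𝒜) (i : ℤ) (w : X.M ⊗[S] S) (hw : w ∈ tensorPiece X.piece 𝒜 i) :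
    TensorProduct.rid S X.M w ∈ X.piece i :=
  map_mem_of_tmul (TensorProduct.rid S X.M).toLinearMap
    (fun i j x hx y hy => by
      change TensorProduct.rid S X.M (x ⊗ₜ y) ∈ _
      rw [TensorProduct.rid_tmul, add_comm]
      exact X.smul_mem hy hx) i w hw

theorem internalProj_smul (X : GrProj 𝒜) {a : ℤ} {s : S} (hs : s ∈ 𝒜 a) (j : ℤ) (x : X.M) :
    internalProj X.isInternal j (s • x) = s • internalProj X.isInternal (j - a) x := by
  induction x using internal_induction X.isInternal with
  | h0 => simp
  | hof l x hx =>
    by_cases hl : l = j - a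
    · rw [hl] at hx
      rw [internalProj_same _ hx, internalProj_same _ (i := j)]
      have := X.smul_mem hs hx
      rwa [show a + (j - a) = j by ring] at this
    · rw [internalProj_ne _ hx hl, internalProj_ne _ (X.smul_mem hs hx) (by omega), smul_zero]
  | hadd x y hx hy => simp only [map_add, smul_add, hx, hy]

/-- The projection of `M ⊗ N` to degree `l`, as a biadditive map. -/
def tensorProjAux (X Y : GrProj 𝒜) (l : ℤ) : X.M →+ Y.M →+ X.M ⊗[S] Y.M :=
  letI := X.isInternal.chooseDecomposition
  (DirectSum.toAddMonoid fun i => AddMonoidHom.mk' (fun x : X.piece i =>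
    (AddMonoidHom.mk' (fun y => (x : X.M) ⊗ₜ[S] internalProj Y.isInternal (l - i) y)
      (fun y y' => by rw [map_add, TensorProduct.tmul_add]) : Y.M →+ X.M ⊗[S] Y.M))
    (fun x x' => by
      ext y
      exact TensorProduct.add_tmul _ _ _)).comp (DirectSum.decomposeAddEquiv X.piece).toAddMonoidHom

theorem tensorProjAux_apply (X Y : GrProj 𝒜) (l : ℤ) {i : ℤ} {x : X.M} (hx : x ∈ X.piece i)
    (y : Y.M) : tensorProjAux X Y l x y = x ⊗ₜ[S] internalProj Y.isInternal (l - i) y := by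
  let _ := X.isInternal.chooseDecomposition
  change (DirectSum.toAddMonoid _ : (DirectSum ℤ fun i => X.piece i) →+ Y.M →+ X.M ⊗[S] Y.M) (DirectSum.decompose X.piece x) y = _
  rw [DirectSum.decompose_of_mem X.piece hx, DirectSum.toAddMonoid_of]
  rfl

/-- The projection of `M ⊗ N` to degree `l`. -/
def tensorProj (X Y : GrProj 𝒜) (l : ℤ) : X.M ⊗[S] Y.M →+ X.M ⊗[S] Y.M :=
  TensorProduct.liftAddHom (tensorProjAux X Y l) (by
    intro s x y
    induction x using internal_induction X.isInternal with
    | h0 => simp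
    | hof i x hx =>
      rw [tensorProjAux_apply X Y l hx]
      induction s using DirectSum.Decomposition.inductionOn 𝒜 with
      | zero => simp
      | homogeneous s =>
        rename_i a
        rw [tensorProjAux_apply X Y l (X.smul_mem s.2 hx), internalProj_smul Y s.2,
          TensorProduct.smul_tmul, show l - (a + i) = l - i - a by ring]
      | add s t hs ht =>
        simp only [add_smul, map_add, AddMonoidHom.add_apply, hs, ht, TensorProduct.tmul_add]
    | hadd x x' hx hx' => simp only [smul_add, map_add, AddMonoidHom.add_apply, hx, hx'])

theorem tensor_isInternal (X Y : GrProj 𝒜) :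
    DirectSum.IsInternal (tensorPiece (S := S) X.piece Y.piece) := by
  have key : ∀ (i : ℤ), ∀ z ∈ tensorPiece (S := S) X.piece Y.piece i, ∀ l,
      tensorProj X Y l z = if i = l then z else 0 := by
    intro i z hz l
    induction hz using AddSubgroup.closure_induction with
    | mem z hz =>
      obtain ⟨a, b, rfl, x, hx, y, hy, rfl⟩ := hz
      change tensorProjAux X Y l x y = _
      rw [tensorProjAux_apply X Y l hx]
      split_ifs with h
      · rw [internalProj_same]
        rwa [show l - a = b by omega]
      · rw [internalProj_ne _ hy (by omega), TensorProduct.tmul_zero]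
    | zero => simp
    | add x y _ _ hx hy =>
      rw [map_add, hx, hy]
      split_ifs <;> simp
    | neg x _ hx =>
      rw [map_neg, hx]
      split_ifs <;> simp
  refine isInternal_of_proj _ (tensorProj X Y) (fun i x hx => by rw [key i x hx, if_pos rfl])
    (fun i j hij x hx => by rw [key i x hx, if_neg hij]) fun z => ?_
  induction z with
  | zero => exact zero_mem _
  | add x y hx hy => exact add_mem hx hy
  | tmul x y =>
    induction x using internal_induction X.isInternal with
    | h0 => simp
    | hof i x hx =>
      induction y using internal_induction Y.isInternal with
      | h0 => simp
      | hof j y hy =>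
        exact AddSubgroup.subset_closure (Set.mem_iUnion.mpr ⟨i + j, tmul_mem hx hy⟩)
      | hadd y y' hy hy' =>
        rw [TensorProduct.tmul_add]
        exact add_mem hy hy'
    | hadd x x' hx hx' =>
      rw [TensorProduct.add_tmul]
      exact add_mem hx hx'

/-- The tensor product of graded modules. -/
def tensor (X Y : GrProj 𝒜) : GrProj 𝒜 where
  M := X.M ⊗[S] Y.M
  piece := tensorPiece X.piece Y.piece
  smul_mem := by
    intro i j s m hs hm
    induction hm using AddSubgroup.closure_induction with
    | mem z hz =>
      obtain ⟨a, b, rfl, x, hx, y, hy, rfl⟩ := hz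
      rw [TensorProduct.smul_tmul', ← add_assoc]
      exact tmul_mem (X.smul_mem hs hx) hy
    | zero => simp
    | add x y _ _ hx hy => rw [smul_add]; exact add_mem hx hy
    | neg x _ hx => rw [smul_neg]; exact neg_mem hx
  isInternal := tensor_isInternal X Y

variable (𝒜) in
/-- The unit object, the graded ring itself. -/
def unit : GrProj 𝒜 where
  M := S
  piece := 𝒜
  smul_mem hs hm := SetLike.mul_mem_graded hs hm
  isInternal := DirectSum.Decomposition.isInternal 𝒜

/-- The tensor product of two morphisms. -/
def tensorMap {X Y X' Y' : GrProj 𝒜} (f : X ⟶ Y) (g : X' ⟶ Y') :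
    tensor X X' ⟶ tensor Y Y' where
  lin := TensorProduct.map f.lin g.lin
  map_mem := map_mem_of_tmul _ fun i j x hx y hy =>
    tmul_mem (f.map_mem i x hx) (g.map_mem j y hy)

instance : MonoidalCategoryStruct (GrProj 𝒜) where
  tensorObj X Y := tensor X Y
  tensorHom f g := tensorMap f g
  whiskerLeft X _ _ f := tensorMap (𝟙 X) f
  whiskerRight f Y := tensorMap f (𝟙 Y)
  tensorUnit := unit 𝒜
  associator X Y Z := isoMk (TensorProduct.assoc S X.M Y.M Z.M) assoc_mem
  leftUnitor X := isoMk (TensorProduct.lid S X.M) (lid_mem X)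
  rightUnitor X := isoMk (TensorProduct.rid S X.M) (rid_mem X)

/-- The forgetful functor preserves the tensor structure on the nose. -/
def inducing : Monoidal.InducingFunctorData (forget (𝒜 := 𝒜)) where
  μIso X Y := Iso.refl _
  εIso := Iso.refl _
  whiskerLeft_eq X _ _ f := by
    apply ModuleCat.hom_ext; apply TensorProduct.ext'; intro x y; rfl
  whiskerRight_eq f Y := by
    apply ModuleCat.hom_ext; apply TensorProduct.ext'; intro x y; rfl
  tensorHom_eq f g := by
    apply ModuleCat.hom_ext; apply TensorProduct.ext'; intro x y; rfl
  associator_eq X Y Z := by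
    apply ModuleCat.hom_ext; apply TensorProduct.ext_threefold; intro x y z; rfl
  leftUnitor_eq X := by
    apply ModuleCat.hom_ext; apply TensorProduct.ext'; intro x y; rfl
  rightUnitor_eq X := by
    apply ModuleCat.hom_ext; apply TensorProduct.ext'; intro x y; rfl

instance : MonoidalCategory (GrProj 𝒜) := Monoidal.induced forget inducing

instance : (forget (𝒜 := 𝒜)).Monoidal := Monoidal.fromInducedMonoidal forget inducing

instance : BraidedCategory (GrProj 𝒜) :=
  BraidedCategory.ofFaithful forget
    (fun X Y => isoMk (TensorProduct.comm S X.M Y.M) comm_mem) (fun X Y => by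
      apply ModuleCat.hom_ext; apply TensorProduct.ext'; intro x y; rfl)

instance : (forget (𝒜 := 𝒜)).Braided where
  braided X Y := by
    apply ModuleCat.hom_ext; apply TensorProduct.ext'; intro x y; rfl

instance : SymmetricCategory (GrProj 𝒜) := SymmetricCategory.ofFaithful forget

end GrProj

end GradedModules

/-! ### Pairs `(M, P M ≅ Q M)` for two tensor functors `P`, `Q` -/

section IsoPairs

open Functor.LaxMonoidal Functor.OplaxMonoidal Functor.Monoidal

universe v₁ v₂ u₁ u₂

variable {C : Type u₁} [Category.{v₁} C] {E : Type u₂} [Category.{v₂} E]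

/-- Pairs consisting of an object `M` and an isomorphism `P M ≅ Q M`. -/
structure IsoPair (P Q : C ⥤ E) where
  /-- the underlying object -/
  obj : C
  /-- the isomorphism -/
  frob : P.obj obj ≅ Q.obj obj

namespace IsoPair

variable {P Q : C ⥤ E}

/-- A morphism of pairs is a morphism of the underlying objects commuting with the isomorphisms. -/
@[ext]
structure Hom (X Y : IsoPair P Q) where
  /-- the underlying morphism -/
  hom : X.obj ⟶ Y.obj
  comm : X.frob.hom ≫ Q.map hom = P.map hom ≫ Y.frob.hom

instance : Category (IsoPair P Q) where
  Hom X Y := Hom X Y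
  id X := ⟨𝟙 _, by simp⟩
  comp f g := ⟨f.hom ≫ g.hom, by
    rw [Functor.map_comp, ← Category.assoc, f.comm, Category.assoc, g.comm, Functor.map_comp,
      Category.assoc]⟩

@[ext]
theorem hom_ext {X Y : IsoPair P Q} {f g : X ⟶ Y} (h : f.hom = g.hom) : f = g := Hom.ext h

@[simp] theorem id_hom (X : IsoPair P Q) : Hom.hom (𝟙 X) = 𝟙 X.obj := rfl
@[simp] theorem comp_hom {X Y Z : IsoPair P Q} (f : X ⟶ Y) (g : Y ⟶ Z) :
    (f ≫ g).hom = f.hom ≫ g.hom := rfl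

variable (P Q) in
/-- The functor which forgets the isomorphism. -/
@[simps] def forget : IsoPair P Q ⥤ C where
  obj X := X.obj
  map f := f.hom

instance : (forget P Q).Faithful where
  map_injective h := hom_ext h

/-- Construct an isomorphism of pairs. -/
@[simps] def isoMk {X Y : IsoPair P Q} (e : X.obj ≅ Y.obj)
    (h : X.frob.hom ≫ Q.map e.hom = P.map e.hom ≫ Y.frob.hom) : X ≅ Y where
  hom := ⟨e.hom, h⟩
  inv := ⟨e.inv, by
    rw [← cancel_epi (P.map e.hom), ← Category.assoc, ← h, Category.assoc, ← Functor.map_comp,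
      ← Category.assoc, ← Functor.map_comp]
    simp⟩

variable [MonoidalCategory C] [MonoidalCategory E] [P.Monoidal] [Q.Monoidal]

/-- The tensor product of two pairs. -/
@[simps] def tensor (X Y : IsoPair P Q) : IsoPair P Q where
  obj := X.obj ⊗ Y.obj
  frob := (μIso P X.obj Y.obj).symm ≪≫ (X.frob ⊗ᵢ Y.frob) ≪≫ μIso Q X.obj Y.obj

variable (P Q) in
/-- The unit pair. -/
@[simps] def unit : IsoPair P Q where
  obj := 𝟙_ C
  frob := (εIso P).symm ≪≫ εIso Q

theorem raw_natural {X X' Y Y' : C} {a : P.obj X ⟶ Q.obj X} {b : P.obj X' ⟶ Q.obj X'}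
    {a' : P.obj Y ⟶ Q.obj Y} {b' : P.obj Y' ⟶ Q.obj Y'} (f : X ⟶ Y) (g : X' ⟶ Y')
    (hf : a ≫ Q.map f = P.map f ≫ a') (hg : b ≫ Q.map g = P.map g ≫ b') :
    (δ P X X' ≫ (a ⊗ₘ b) ≫ μ Q X X') ≫ Q.map (f ⊗ₘ g) =
      P.map (f ⊗ₘ g) ≫ δ P Y Y' ≫ (a' ⊗ₘ b') ≫ μ Q Y Y' := by
  rw [Category.assoc, Category.assoc, ← μ_natural, ← δ_natural_assoc,
    tensorHom_comp_tensorHom_assoc, tensorHom_comp_tensorHom_assoc, hf, hg]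

theorem raw_assoc {X Y Z : C} (a : P.obj X ⟶ Q.obj X) (b : P.obj Y ⟶ Q.obj Y)
    (c : P.obj Z ⟶ Q.obj Z) :
    (δ P (X ⊗ Y) Z ≫ ((δ P X Y ≫ (a ⊗ₘ b) ≫ μ Q X Y) ⊗ₘ c) ≫ μ Q (X ⊗ Y) Z) ≫
        Q.map (α_ X Y Z).hom =
      P.map (α_ X Y Z).hom ≫ δ P X (Y ⊗ Z) ≫
        (a ⊗ₘ (δ P Y Z ≫ (b ⊗ₘ c) ≫ μ Q Y Z)) ≫ μ Q X (Y ⊗ Z) := by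
  have h1 : ((δ P X Y ≫ (a ⊗ₘ b) ≫ μ Q X Y) ⊗ₘ c) =
      δ P X Y ▷ _ ≫ ((a ⊗ₘ b) ⊗ₘ c) ≫ μ Q X Y ▷ _ := by
    rw [← tensorHom_id, ← tensorHom_id, tensorHom_comp_tensorHom, tensorHom_comp_tensorHom]
    simp only [Category.id_comp, Category.comp_id]
  have h2 : (a ⊗ₘ (δ P Y Z ≫ (b ⊗ₘ c) ≫ μ Q Y Z)) =
      _ ◁ δ P Y Z ≫ (a ⊗ₘ (b ⊗ₘ c)) ≫ _ ◁ μ Q Y Z := by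
    rw [← id_tensorHom, ← id_tensorHom, tensorHom_comp_tensorHom, tensorHom_comp_tensorHom]
    simp only [Category.id_comp, Category.comp_id]
  rw [h1, h2]
  simp only [Category.assoc]
  rw [Functor.LaxMonoidal.associativity, associator_naturality_assoc]
  have := Functor.OplaxMonoidal.associativity (F := P) X Y Z
  rw [← reassoc_of% this]

theorem raw_left {X : C} (a : P.obj X ⟶ Q.obj X) :
    (δ P (𝟙_ C) X ≫ ((η P ≫ ε Q) ⊗ₘ a) ≫ μ Q (𝟙_ C) X) ≫ Q.map (λ_ X).hom =
      P.map (λ_ X).hom ≫ a := by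
  have h1 : ((η P ≫ ε Q) ⊗ₘ a) = η P ▷ _ ≫ (𝟙_ E ◁ a) ≫ ε Q ▷ _ := by
    rw [← tensorHom_id, ← tensorHom_id, ← id_tensorHom, tensorHom_comp_tensorHom, tensorHom_comp_tensorHom]
    simp only [Category.id_comp, Category.comp_id]
  rw [h1]
  simp only [Category.assoc]
  rw [← Functor.LaxMonoidal.left_unitality, leftUnitor_naturality, ← Category.assoc, ← Category.assoc]
  congr 1
  rw [Category.assoc, Functor.OplaxMonoidal.left_unitality_hom]

theorem raw_right {X : C} (a : P.obj X ⟶ Q.obj X) :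
    (δ P X (𝟙_ C) ≫ (a ⊗ₘ (η P ≫ ε Q)) ≫ μ Q X (𝟙_ C)) ≫ Q.map (ρ_ X).hom =
      P.map (ρ_ X).hom ≫ a := by
  have h1 : (a ⊗ₘ (η P ≫ ε Q)) = _ ◁ η P ≫ (a ▷ 𝟙_ E) ≫ _ ◁ ε Q := by
    rw [← tensorHom_id, ← id_tensorHom, ← id_tensorHom, tensorHom_comp_tensorHom, tensorHom_comp_tensorHom]
    simp only [Category.id_comp, Category.comp_id]
  rw [h1]
  simp only [Category.assoc]
  rw [← Functor.LaxMonoidal.right_unitality, rightUnitor_naturality, ← Category.assoc, ← Category.assoc]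
  congr 1
  rw [Category.assoc, Functor.OplaxMonoidal.right_unitality_hom]

/-- The tensor product of two morphisms. -/
@[simps] def tensorMap {X Y X' Y' : IsoPair P Q} (f : X ⟶ Y) (g : X' ⟶ Y') :
    tensor X X' ⟶ tensor Y Y' where
  hom := f.hom ⊗ₘ g.hom
  comm := raw_natural f.hom g.hom f.comm g.comm

theorem assoc_comm (X Y Z : IsoPair P Q) :
    (tensor (tensor X Y) Z).frob.hom ≫ Q.map (α_ X.obj Y.obj Z.obj).hom =
      P.map (α_ X.obj Y.obj Z.obj).hom ≫ (tensor X (tensor Y Z)).frob.hom := raw_assoc _ _ _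

theorem left_comm (X : IsoPair P Q) :
    (tensor (unit P Q) X).frob.hom ≫ Q.map (λ_ X.obj).hom =
      P.map (λ_ X.obj).hom ≫ X.frob.hom := raw_left _

theorem right_comm (X : IsoPair P Q) :
    (tensor X (unit P Q)).frob.hom ≫ Q.map (ρ_ X.obj).hom =
      P.map (ρ_ X.obj).hom ≫ X.frob.hom := raw_right _

instance : MonoidalCategoryStruct (IsoPair P Q) where
  tensorObj X Y := tensor X Y
  tensorHom f g := tensorMap f g
  whiskerLeft X _ _ f := tensorMap (𝟙 X) f
  whiskerRight f Y := tensorMap f (𝟙 Y)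
  tensorUnit := unit P Q
  associator X Y Z := isoMk (α_ X.obj Y.obj Z.obj) (assoc_comm X Y Z)
  leftUnitor X := isoMk (λ_ X.obj) (left_comm X)
  rightUnitor X := isoMk (ρ_ X.obj) (right_comm X)

variable (P Q) in
/-- The forgetful functor preserves the tensor structure on the nose. -/
def inducing : Monoidal.InducingFunctorData (forget P Q) where
  μIso X Y := Iso.refl _
  εIso := Iso.refl _
  whiskerLeft_eq X _ _ f := by
    change 𝟙 X.obj ⊗ₘ f.hom = 𝟙 _ ≫ (X.obj ◁ f.hom) ≫ 𝟙 _
    simp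
  whiskerRight_eq f Y := by
    change f.hom ⊗ₘ 𝟙 Y.obj = 𝟙 _ ≫ (f.hom ▷ Y.obj) ≫ 𝟙 _
    simp
  tensorHom_eq f g := by
    change f.hom ⊗ₘ g.hom = 𝟙 _ ≫ (f.hom ⊗ₘ g.hom) ≫ 𝟙 _
    simp
  associator_eq X Y Z := by
    change (α_ X.obj Y.obj Z.obj).hom = (𝟙 _ ≫ (𝟙 _ ⊗ₘ 𝟙 _)) ≫ (α_ X.obj Y.obj Z.obj).hom ≫
      (𝟙 _ ⊗ₘ 𝟙 _) ≫ 𝟙 _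
    simp
  leftUnitor_eq X := by
    change (λ_ X.obj).hom = (𝟙 _ ≫ (𝟙 _ ⊗ₘ 𝟙 _)) ≫ (λ_ X.obj).hom
    simp
  rightUnitor_eq X := by
    change (ρ_ X.obj).hom = (𝟙 _ ≫ (𝟙 _ ⊗ₘ 𝟙 _)) ≫ (ρ_ X.obj).hom
    simp

instance : MonoidalCategory (IsoPair P Q) := Monoidal.induced (forget P Q) (inducing P Q)

instance : (forget P Q).Monoidal := Monoidal.fromInducedMonoidal (forget P Q) (inducing P Q)

end IsoPair

end IsoPairs

namespace IsoPair
open Functor.LaxMonoidal Functor.OplaxMonoidal Functor.Monoidal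

universe v₁ v₂ u₁ u₂

variable {C : Type u₁} [Category.{v₁} C] {E : Type u₂} [Category.{v₂} E] {P Q : C ⥤ E}
  [MonoidalCategory C] [MonoidalCategory E] [BraidedCategory C] [BraidedCategory E]
  [P.Braided] [Q.Braided]

theorem braid_comm (X Y : IsoPair P Q) :
    (tensor X Y).frob.hom ≫ Q.map (β_ X.obj Y.obj).hom =
      P.map (β_ X.obj Y.obj).hom ≫ (tensor Y X).frob.hom := by
  change (δ P X.obj Y.obj ≫ (X.frob.hom ⊗ₘ Y.frob.hom) ≫ μ Q X.obj Y.obj) ≫ Q.map _ =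
    P.map _ ≫ δ P Y.obj X.obj ≫ (Y.frob.hom ⊗ₘ X.frob.hom) ≫ μ Q Y.obj X.obj
  have h1 := Functor.LaxBraided.braided (F := Q) X.obj Y.obj
  have h2 := Functor.LaxBraided.braided (F := P) X.obj Y.obj
  have h3 : P.map (β_ X.obj Y.obj).hom ≫ δ P Y.obj X.obj =
      δ P X.obj Y.obj ≫ (β_ (P.obj X.obj) (P.obj Y.obj)).hom := by
    rw [← cancel_epi (μ P X.obj Y.obj), reassoc_of% h2, μ_δ, Category.comp_id, μ_δ_assoc]
  simp only [Category.assoc]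
  rw [h1, reassoc_of% h3, BraidedCategory.braiding_naturality_assoc]

instance : BraidedCategory (IsoPair P Q) :=
  BraidedCategory.ofFaithful (forget P Q)
    (fun X Y => isoMk (β_ X.obj Y.obj) (braid_comm X Y)) (fun X Y => by
      change 𝟙 _ ≫ (β_ X.obj Y.obj).hom = (β_ X.obj Y.obj).hom ≫ 𝟙 _
      simp)

instance : (forget P Q).Braided where
  braided X Y := by
    change 𝟙 _ ≫ (β_ X.obj Y.obj).hom = (β_ X.obj Y.obj).hom ≫ 𝟙 _
    simp

end IsoPair

instance {C : Type*} [Category* C] {E : Type*} [Category* E] {P Q : C ⥤ E}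
    [MonoidalCategory C] [MonoidalCategory E] [SymmetricCategory C] [SymmetricCategory E]
    [P.Braided] [Q.Braided] : SymmetricCategory (IsoPair P Q) :=
  SymmetricCategory.ofFaithful (IsoPair.forget P Q)

/-! ### Extension of scalars is a symmetric tensor functor -/

instance extendScalarsBraided {S B : Type r} [CommRing S] [CommRing B] (f : S →+* B) :
    (ModuleCat.extendScalars.{r, r, r} f).Braided where
  braided X Y := by
    rw [← cancel_epi (Functor.OplaxMonoidal.δ (ModuleCat.extendScalars f) X Y),
      Functor.Monoidal.δ_μ_assoc,
      ← cancel_mono (Functor.OplaxMonoidal.δ (ModuleCat.extendScalars f) Y X), Category.assoc,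
      Category.assoc, Functor.Monoidal.μ_δ, Category.comp_id]
    apply ((ModuleCat.extendRestrictScalarsAdj f).homEquiv _ _).injective
    apply ModuleCat.MonoidalCategory.tensor_ext
    intro x y
    rfl

/-! ### Displays -/

section Displays

variable (p : ℕ) [hp : Fact p.Prime] (k : Type*) (R : Type r) [CommRing R]

/-- The category of finite projective graded modules over `W(R)^⊕`. -/
abbrev PGrMod : Type (r + 1) := GrProj (WittGr.piece p k R)

/-- `M ↦ M^σ = M ⊗_{W(R)^⊕, σ} W(R)`. -/
abbrev sigmaPull : PGrMod p k R ⥤ ModuleCat.{r} (WittOver p k R) :=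
  GrProj.forget ⋙ ModuleCat.extendScalars (WittGr.σ p k R)

/-- `M ↦ M^τ = M ⊗_{W(R)^⊕, τ} W(R)`. -/
abbrev tauPull : PGrMod p k R ⥤ ModuleCat.{r} (WittOver p k R) :=
  GrProj.forget ⋙ ModuleCat.extendScalars (WittGr.τ p k R)

/-- The category of displays over the Witt frame of `R`. A display is a finite projective graded
`W(R)^⊕`-module `M` with a `σ`-linear bijection `F : M → M^τ`, which is given here by its
linearization `F^♯ : M^σ ≅ M^τ`. -/
abbrev Disp : Type (r + 1) := IsoPair (sigmaPull p k R) (tauPull p k R)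

/-- The functor which sends a display to its underlying graded module. -/
abbrev Disp.forget : Disp p k R ⥤ PGrMod p k R := IsoPair.forget _ _

end Displays

/-! ### Cocharacters and weight spaces -/

section Cocharacters

variable {O : Type} [CommRing O] {A : Type*} [CommRing A] [HopfAlgebra O A]
  {K : Type*} [CommRing K] [Algebra O K] (μ : (K ⊗[O] A) →ₐc[K] K[T;T⁻¹])

/-- A cocharacter `μ : 𝔾_m → G_K` is given by a homomorphism of Hopf algebras `K ⊗ A → K[T, T⁻¹]`.
For a homomorphism of `K`-algebras `K[T, T⁻¹] → D`, i.e. for a point `t ∈ 𝔾_m(D)`, this is the point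
`μ(t) ∈ G(D)`. -/
def cochar {D : Type*} [CommRing D] [Algebra O D] [Algebra K D] [IsScalarTower O K D]
    (t : K[T;T⁻¹] →ₐ[K] D) : Pts O A D :=
  WithConv.toConv (((t.comp (μ : (K ⊗[O] A) →ₐ[K] K[T;T⁻¹])).restrictScalars O).comp
    Algebra.TensorProduct.includeRight)

section

variable {D : Type*} [CommRing D] [Algebra O D] [Algebra K D] [IsScalarTower O K D]

theorem cochar_apply (t : K[T;T⁻¹] →ₐ[K] D) (a : A) : (cochar μ t).ofConv a = t (μ (1 ⊗ₜ a)) := rfl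

theorem laurent_algHom_ext {t t' : K[T;T⁻¹] →ₐ[K] D}
    (h : ∀ n, t (LaurentPolynomial.T n) = t' (LaurentPolynomial.T n)) : t = t' := by
  refine AlgHom.ext fun x => ?_
  induction x using LaurentPolynomial.induction_on' with
  | add p q hp hq => rw [map_add, map_add, hp, hq]
  | C_mul_T n a =>
    rw [map_mul, map_mul, h, LaurentPolynomial.C_eq_algebraMap, AlgHom.commutes, AlgHom.commutes]

theorem cochar_mul (t t₁ t₂ : K[T;T⁻¹] →ₐ[K] D)
    (h : ∀ n, t (LaurentPolynomial.T n) = t₁ (LaurentPolynomial.T n) * t₂ (LaurentPolynomial.T n)) :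
    cochar μ t = cochar μ t₁ * cochar μ t₂ := by
  have h1 : t = (Algebra.TensorProduct.lift t₁ t₂ fun _ _ => Commute.all _ _).comp
      (Bialgebra.comulAlgHom K K[T;T⁻¹]) := by
    apply laurent_algHom_ext
    intro n
    rw [h, AlgHom.comp_apply, Bialgebra.comulAlgHom_apply, LaurentPolynomial.comul_T,
      Algebra.TensorProduct.lift_tmul]
  ext a
  change t (μ (1 ⊗ₜ a)) = (cochar μ t₁ * cochar μ t₂).ofConv a
  rw [AlgHom.convMul_apply, h1, AlgHom.comp_apply, Bialgebra.comulAlgHom_apply]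
  have h2 := CoalgHomClass.map_comp_comul_apply μ (1 ⊗ₜ[O] a : K ⊗[O] A)
  rw [← h2, TensorProduct.comul_tmul, ← (Coalgebra.Repr.arbitrary O a).eq]
  simp only [TensorProduct.tmul_sum, map_sum, CommSemiring.comul_apply]
  rfl

theorem cochar_one (t : K[T;T⁻¹] →ₐ[K] D) (h : ∀ n, t (LaurentPolynomial.T n) = 1) :
    cochar μ t = 1 := by
  have h1 : t = (Algebra.ofId K D).comp (Bialgebra.counitAlgHom K K[T;T⁻¹]) := by
    apply laurent_algHom_ext
    intro n
    rw [h, AlgHom.comp_apply, Bialgebra.counitAlgHom_apply, LaurentPolynomial.counit_T, map_one]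
  ext a
  change t (μ (1 ⊗ₜ a)) = algebraMap O D (Coalgebra.counit a)
  rw [h1, AlgHom.comp_apply, Bialgebra.counitAlgHom_apply,
    CoalgHomClass.counit_comp_apply μ (1 ⊗ₜ[O] a : K ⊗[O] A)]
  simp [IsScalarTower.algebraMap_apply O K D, Algebra.smul_def]

theorem cochar_map {D' : Type*} [CommRing D'] [Algebra O D'] [Algebra K D'] [IsScalarTower O K D']
    (t : K[T;T⁻¹] →ₐ[K] D) (φ : D →ₐ[K] D') :
    Pts.map (φ.restrictScalars O) (cochar μ t) = cochar μ (φ.comp t) := rfl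

end

/-- The point of `𝔾_m(B)` given by a unit `u` of `B`, i.e. the homomorphism with `T ↦ u`. -/
def gmPt (K : Type*) [CommRing K] {B : Type*} [CommRing B] [Algebra K B] (u : Bˣ) :
    K[T;T⁻¹] →ₐ[K] B where
  __ := LaurentPolynomial.eval₂ (algebraMap K B) u
  commutes' _ := LaurentPolynomial.eval₂_C _ _ _

theorem gmPt_T (K : Type*) [CommRing K] {B : Type*} [CommRing B] [Algebra K B] (u : Bˣ) (n : ℤ) :
    gmPt K u (LaurentPolynomial.T n) = (u ^ n : Bˣ) :=
  LaurentPolynomial.eval₂_T _ _ _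

theorem gmPt_mul_T (K : Type*) [CommRing K] {B : Type*} [CommRing B] [Algebra K B] (u v : Bˣ)
    (n : ℤ) : gmPt K (u * v) (LaurentPolynomial.T n) =
      gmPt K u (LaurentPolynomial.T n) * gmPt K v (LaurentPolynomial.T n) := by
  rw [gmPt_T, gmPt_T, gmPt_T, mul_zpow, Units.val_mul]

theorem gmPt_map_T (K : Type*) [CommRing K] {B B' : Type*} [CommRing B] [Algebra K B] [CommRing B']
    [Algebra K B'] (φ : B →ₐ[K] B') (u : Bˣ) (n : ℤ) :
    gmPt K (Units.map (φ : B →* B') u) (LaurentPolynomial.T n) =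
      φ (gmPt K u (LaurentPolynomial.T n)) := by
  rw [gmPt_T, gmPt_T, ← map_zpow, Units.coe_map]
  rfl

/-- The unit `T` of `B[T, T⁻¹]`. -/
def unitT (B : Type*) [CommRing B] : B[T;T⁻¹]ˣ where
  val := LaurentPolynomial.T 1
  inv := LaurentPolynomial.T (-1)
  val_inv := by rw [← LaurentPolynomial.T_add]; simp
  inv_val := by rw [← LaurentPolynomial.T_add]; simp

theorem unitT_zpow (B : Type*) [CommRing B] (n : ℤ) :
    ((unitT B ^ n : B[T;T⁻¹]ˣ) : B[T;T⁻¹]) = LaurentPolynomial.T n := by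
  rcases n with n | n
  · simp [unitT, LaurentPolynomial.T_pow]
  · rw [zpow_negSucc, ← inv_pow, Units.val_pow_eq_pow_val]
    change (LaurentPolynomial.T (-1)) ^ (n + 1) = _
    rw [LaurentPolynomial.T_pow, Int.negSucc_eq]
    congr 1
    push_cast
    ring

/-- The universal point `T` of `𝔾_m`, with values in `B[T, T⁻¹]`. -/
def univT (K : Type*) [CommRing K] (B : Type*) [CommRing B] [Algebra K B] :
    K[T;T⁻¹] →ₐ[K] B[T;T⁻¹] := gmPt K (unitT B)

theorem univT_T (K : Type*) [CommRing K] (B : Type*) [CommRing B] [Algebra K B] (n : ℤ) :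
    univT K B (LaurentPolynomial.T n) = LaurentPolynomial.T n := by
  rw [univT, gmPt_T, unitT_zpow]

/-- The inclusion of the constants `B → B[T, T⁻¹]`. -/
def cst (O B : Type*) [CommRing O] [CommRing B] [Algebra O B] : B →ₐ[O] B[T;T⁻¹] :=
  IsScalarTower.toAlgHom O B B[T;T⁻¹]

theorem cst_apply (O : Type*) {B : Type*} [CommRing O] [CommRing B] [Algebra O B] (b : B) :
    cst O B b = LaurentPolynomial.C b := rfl

/-- The coefficient of `T ^ i`. -/
def cf (B : Type*) [CommRing B] (i : ℤ) : B[T;T⁻¹] →ₗ[B] B where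
  toFun f := f.coeff i
  map_add' _ _ := rfl
  map_smul' _ _ := rfl

theorem cf_C_mul_T {B : Type*} [CommRing B] (i j : ℤ) (b : B) :
    cf B i (LaurentPolynomial.C b * LaurentPolynomial.T j) = if j = i then b else 0 := by
  rw [← LaurentPolynomial.single_eq_C_mul_T]
  change (Finsupp.single j b) i = _
  rw [Finsupp.single_apply]

namespace FreeRep

variable (X : FreeRep O A)

/-- The constants `B ⊗ V → B[T, T⁻¹] ⊗ V`. -/
abbrev cstT (B : Type*) [CommRing B] [Algebra O B] : B ⊗[O] X.V →ₗ[O] B[T;T⁻¹] ⊗[O] X.V :=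
  (cst O B).toLinearMap.rTensor X.V

/-- The coefficient of `T ^ i`, as a map `B[T, T⁻¹] ⊗ V → B ⊗ V`. -/
abbrev cfT (B : Type*) [CommRing B] [Algebra O B] (i : ℤ) :
    B[T;T⁻¹] ⊗[O] X.V →ₗ[O] B ⊗[O] X.V :=
  ((cf B i).restrictScalars O).rTensor X.V

theorem rTensor_smul {B B' : Type*} [CommRing B] [Algebra O B] [CommRing B'] [Algebra O B']
    (φ : B →ₐ[O] B') (b : B) (z : B ⊗[O] X.V) :
    φ.toLinearMap.rTensor X.V (b • z) = φ b • φ.toLinearMap.rTensor X.V z := by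
  induction z with
  | zero => simp
  | add x y hx hy => simp only [smul_add, map_add, hx, hy]
  | tmul c v => simp [TensorProduct.smul_tmul']

theorem cfT_smul_cstT {B : Type*} [CommRing B] [Algebra O B] (i j : ℤ) (z : B ⊗[O] X.V) :
    X.cfT B i ((LaurentPolynomial.T j : B[T;T⁻¹]) • X.cstT B z) = if j = i then z else 0 := by
  induction z with
  | zero => simp
  | add x y hx hy =>
    simp only [smul_add, map_add, hx, hy]
    split_ifs <;> simp
  | tmul c v =>
    have := cf_C_mul_T i j c
    rw [mul_comm] at this
    simp only [LinearMap.rTensor_tmul, TensorProduct.smul_tmul', smul_eq_mul,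
      AlgHom.toLinearMap_apply, cst_apply, LinearMap.coe_restrictScalars, this]
    split_ifs <;> simp

/-- The action of a point of `G(B)` commutes with `B`-linear maps. -/
theorem act_rTensor {B B' : Type*} [CommRing B] [Algebra O B] [CommRing B'] [Algebra O B']
    [Algebra B B'] [IsScalarTower O B B'] (ψ : B' →ₗ[B] B) (g : Pts O A B) (z : B' ⊗[O] X.V) :
    X.act g ((ψ.restrictScalars O).rTensor X.V z) =
      (ψ.restrictScalars O).rTensor X.V (X.act (Pts.map (IsScalarTower.toAlgHom O B B') g) z) := by
  induction z with
  | zero => simp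
  | add x y hx hy => simp only [map_add, hx, hy]
  | tmul b v =>
    simp only [LinearMap.rTensor_tmul, act_tmul]
    generalize X.coact v = y
    induction y with
    | zero => simp
    | add x y hx hy => simp only [map_add, smul_add, hx, hy]
    | tmul u c =>
      have : ψ (b * algebraMap B B' (g.ofConv c)) = ψ b * g.ofConv c := by
        rw [mul_comm, ← Algebra.smul_def, map_smul, smul_eq_mul, mul_comm]
      simp [TensorProduct.smul_tmul', Pts.map, this]

/-- The subspace `V^i` of `V_K = K ⊗ V` on which `𝔾_m` acts through `μ` by the character `z ↦ z^i`:
it consists of the `v` with `μ(T) v = T^i v`, where `T` is the universal point of `𝔾_m`. -/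
def weightSpace (i : ℤ) : Submodule K (K ⊗[O] X.V) where
  carrier := {v | X.act (cochar μ (univT K K)) (X.cstT K v) =
    (LaurentPolynomial.T i : K[T;T⁻¹]) • X.cstT K v}
  zero_mem' := by simp
  add_mem' := by
    intro a b ha hb
    rw [Set.mem_ofPred_eq] at *
    rw [map_add, map_add, ha, hb, smul_add]
  smul_mem' := by
    intro c x hx
    rw [Set.mem_ofPred_eq] at *
    rw [rTensor_smul, map_smul, hx, smul_comm]

theorem mem_weightSpace {i : ℤ} {v : K ⊗[O] X.V} : v ∈ X.weightSpace μ i ↔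
    X.act (cochar μ (univT K K)) (X.cstT K v) =
      (LaurentPolynomial.T i : K[T;T⁻¹]) • X.cstT K v := Iff.rfl

/-- The projection of `V_K` to `V^i`. -/
def weightProj (i : ℤ) (v : K ⊗[O] X.V) : K ⊗[O] X.V :=
  X.cfT K i (X.act (cochar μ (univT K K)) (X.cstT K v))

theorem weightProj_mem (i : ℤ) (v : K ⊗[O] X.V) : X.weightProj μ i v ∈ X.weightSpace μ i := by
  rw [mem_weightSpace]
  -- the ring of Laurent polynomials in two variables and its units
  let D := K[T;T⁻¹][T;T⁻¹]
  let φ₁ : K[T;T⁻¹] →ₐ[K] D := IsScalarTower.toAlgHom K K[T;T⁻¹] D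
  let φ₂ : K[T;T⁻¹] →ₐ[K] D := univT K K[T;T⁻¹]
  let φ : K[T;T⁻¹] →ₐ[K] D := gmPt K (Units.map (φ₁ : K[T;T⁻¹] →* D) (unitT K) * unitT K[T;T⁻¹])
  have hT : ∀ n, φ (LaurentPolynomial.T n) = LaurentPolynomial.C (LaurentPolynomial.T n) *
      LaurentPolynomial.T n := by
    intro n
    refine (gmPt_mul_T K _ _ n).trans ?_
    refine congrArg₂ _ ((gmPt_map_T K φ₁ _ n).trans (congrArg φ₁ (univT_T K K n))) (univT_T K _ n)
  have hm : cochar μ φ = cochar μ φ₁ * cochar μ φ₂ := by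
    apply cochar_mul
    intro n
    rw [hT, univT_T]
    rfl
  have hid : univT K K = AlgHom.id K K[T;T⁻¹] := by
    apply laurent_algHom_ext
    intro n
    rw [univT_T]
    rfl
  have hmap : ∀ ψ : K[T;T⁻¹] →ₐ[K] D,
      cochar μ ψ = Pts.map (ψ.restrictScalars O) (cochar μ (univT K K)) := by
    intro ψ
    rw [cochar_map, hid, AlgHom.comp_id]
  have hcst : ∀ ψ : K[T;T⁻¹] →ₐ[K] D, (ψ.restrictScalars O).toLinearMap.rTensor X.V (X.cstT K v) =
      (IsScalarTower.toAlgHom O K D).toLinearMap.rTensor X.V v := by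
    intro ψ
    rw [← LinearMap.comp_apply, ← LinearMap.rTensor_comp]
    congr 2
    exact LinearMap.ext fun x => ψ.commutes x
  have key := congrArg (X.cfT K[T;T⁻¹] i) (LinearMap.congr_fun (congrArg X.act hm)
    ((IsScalarTower.toAlgHom O K D).toLinearMap.rTensor X.V v))
  rw [act_mul, LinearMap.comp_apply] at key
  nth_rewrite 1 [← hcst φ] at key
  rw [← hcst φ₂, hmap φ, hmap φ₂, act_map, act_map, hmap φ₁] at key
  have h1 := X.act_rTensor (cf K[T;T⁻¹] i) (cochar μ (univT K K))
    ((φ₂.restrictScalars O).toLinearMap.rTensor X.V (X.act (cochar μ (univT K K)) (X.cstT K v)))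
  have key2 := key.trans h1.symm
  clear key h1
  unfold weightProj
  generalize X.act (cochar μ (univT K K)) (X.cstT K v) = z at key2
  have f1 : ∀ f : K[T;T⁻¹], cf K[T;T⁻¹] i (φ f) =
      LaurentPolynomial.T i * LaurentPolynomial.C (cf K i f) := by
    intro f
    induction f using LaurentPolynomial.induction_on' with
    | add f g hf hg => simp only [map_add, hf, hg, mul_add]
    | C_mul_T n a =>
      have : φ (LaurentPolynomial.C a * LaurentPolynomial.T n) = LaurentPolynomial.C
          (LaurentPolynomial.C a * LaurentPolynomial.T n) * LaurentPolynomial.T n := by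
        rw [map_mul, hT, LaurentPolynomial.C_eq_algebraMap, AlgHom.commutes, map_mul, mul_assoc]
        rfl
      rw [this, cf_C_mul_T, cf_C_mul_T]
      split_ifs with h
      · rw [h, mul_comm]
      · simp
  have f2 : ∀ f : K[T;T⁻¹], cf K[T;T⁻¹] i (φ₂ f) = LaurentPolynomial.C (cf K i f) := by
    intro f
    induction f using LaurentPolynomial.induction_on' with
    | add f g hf hg => simp only [map_add, hf, hg]
    | C_mul_T n a =>
      have : φ₂ (LaurentPolynomial.C a * LaurentPolynomial.T n) = LaurentPolynomial.C
          (LaurentPolynomial.C a) * LaurentPolynomial.T n := by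
        rw [map_mul, univT_T, LaurentPolynomial.C_eq_algebraMap, AlgHom.commutes]
        rfl
      rw [this, cf_C_mul_T, cf_C_mul_T]
      split_ifs with h
      · rfl
      · simp
  have e1 : ∀ z, X.cfT K[T;T⁻¹] i ((φ.restrictScalars O).toLinearMap.rTensor X.V z) =
      (LaurentPolynomial.T i : K[T;T⁻¹]) • X.cstT K (X.cfT K i z) := by
    intro z
    induction z with
    | zero => simp
    | add x y hx hy => simp only [map_add, smul_add, hx, hy]
    | tmul f v =>
      simp only [LinearMap.rTensor_tmul, TensorProduct.smul_tmul', smul_eq_mul]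
      congr 1
      exact f1 f
  have e2 : ∀ z, X.cfT K[T;T⁻¹] i ((φ₂.restrictScalars O).toLinearMap.rTensor X.V z) =
      X.cstT K (X.cfT K i z) := by
    intro z
    induction z with
    | zero => simp
    | add x y hx hy => simp only [map_add, hx, hy]
    | tmul f v =>
      simp only [LinearMap.rTensor_tmul]
      congr 1
      exact f2 f
  rw [e1 z] at key2
  have e3 := congrArg (X.act (cochar μ (univT K K))) (e2 z)
  exact e3.symm.trans key2.symm

theorem weightProj_same {i : ℤ} {v : K ⊗[O] X.V} (hv : v ∈ X.weightSpace μ i) :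
    X.weightProj μ i v = v := by
  rw [weightProj, X.mem_weightSpace μ |>.mp hv, cfT_smul_cstT, if_pos rfl]

theorem exists_sum_weightProj (v : K ⊗[O] X.V) :
    ∃ s : Finset ℤ, v = ∑ i ∈ s, X.weightProj μ i v := by
  classical
  let ev : K[T;T⁻¹] →ₐ[K] K := gmPt K 1
  have hev : ∀ n, ev (LaurentPolynomial.T n) = 1 := fun n => by rw [gmPt_T]; simp
  have key : ∀ z : K[T;T⁻¹] ⊗[O] X.V, ∃ s : Finset ℤ, ∀ s', s ⊆ s' →
      (ev.restrictScalars O).toLinearMap.rTensor X.V z = ∑ i ∈ s', X.cfT K i z := by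
    intro z
    induction z with
    | zero => exact ⟨∅, by simp⟩
    | add x y hx hy =>
      obtain ⟨s, hs⟩ := hx
      obtain ⟨t, ht⟩ := hy
      refine ⟨s ∪ t, fun u hu => ?_⟩
      simp only [map_add, Finset.sum_add_distrib]
      rw [hs u (Finset.union_subset_left hu), ht u (Finset.union_subset_right hu)]
    | tmul f v =>
      induction f using LaurentPolynomial.induction_on' with
      | add f g hf hg =>
        obtain ⟨s, hs⟩ := hf
        obtain ⟨t, ht⟩ := hg
        refine ⟨s ∪ t, fun u hu => ?_⟩
        simp only [TensorProduct.add_tmul, map_add, Finset.sum_add_distrib]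
        rw [hs u (Finset.union_subset_left hu), ht u (Finset.union_subset_right hu)]
      | C_mul_T n a =>
        refine ⟨{n}, fun u hu => ?_⟩
        have h1 : ev (LaurentPolynomial.C a * LaurentPolynomial.T n) = a := by
          rw [map_mul, hev, mul_one, LaurentPolynomial.C_eq_algebraMap, AlgHom.commutes]
          rfl
        have h2 : ∀ i, X.cfT K i ((LaurentPolynomial.C a * LaurentPolynomial.T n) ⊗ₜ v) =
            if n = i then a ⊗ₜ v else 0 := by
          intro i
          simp only [LinearMap.rTensor_tmul, LinearMap.coe_restrictScalars, cf_C_mul_T]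
          split_ifs <;> simp
        simp only [h2]
        rw [Finset.sum_ite_eq, if_pos (hu (Finset.mem_singleton_self n)), LinearMap.rTensor_tmul]
        congr 1
  have hid : univT K K = AlgHom.id K K[T;T⁻¹] := by
    apply laurent_algHom_ext
    intro n
    rw [univT_T]
    rfl
  obtain ⟨s, hs⟩ := key (X.act (cochar μ (univT K K)) (X.cstT K v))
  refine ⟨s, ?_⟩
  have h1 := X.act_map (ev.restrictScalars O) (cochar μ (univT K K)) (X.cstT K v)
  have h2 : Pts.map (ev.restrictScalars O) (cochar μ (univT K K)) = 1 := by
    rw [cochar_map, hid, AlgHom.comp_id]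
    exact cochar_one μ ev hev
  have h3 : (ev.restrictScalars O).toLinearMap.rTensor X.V (X.cstT K v) = v := by
    rw [← LinearMap.comp_apply, ← LinearMap.rTensor_comp]
    have : (ev.restrictScalars O).toLinearMap ∘ₗ (cst O K).toLinearMap = LinearMap.id :=
      LinearMap.ext fun x => ev.commutes x
    rw [this, LinearMap.rTensor_id, LinearMap.id_apply]
  rw [h2, h3, act_one, LinearMap.id_apply] at h1
  exact h1.trans (hs s subset_rfl)

theorem map_weightSpace {X Y : FreeRep O A} (f : X ⟶ Y) {i : ℤ} {v : K ⊗[O] X.V}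
    (hv : v ∈ X.weightSpace μ i) : f.lin.lTensor K v ∈ Y.weightSpace μ i := by
  have hc : ∀ w : K ⊗[O] X.V, Y.cstT K (f.lin.lTensor K w) =
      f.lin.lTensor K[T;T⁻¹] (X.cstT K w) := by
    intro w
    simp only [← LinearMap.comp_apply, LinearMap.lTensor_comp_rTensor,
      LinearMap.rTensor_comp_lTensor]
  have hs : ∀ (b : K[T;T⁻¹]) (w : K[T;T⁻¹] ⊗[O] X.V),
      f.lin.lTensor K[T;T⁻¹] (b • w) = b • f.lin.lTensor K[T;T⁻¹] w := fun b w =>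
    (f.lin.baseChange K[T;T⁻¹]).map_smul b w
  rw [mem_weightSpace] at hv ⊢
  rw [hc, act_hom, hv, hs]

end FreeRep

end Cocharacters

/-! ### The grading on `S ⊗ V` defined by a cocharacter -/

section MuGrading

/-- The canonical isomorphism `(V ⊗ B) ⊗_B (W ⊗ B) ≅ (V ⊗ W) ⊗ B`. -/
abbrev mulT (O B V W : Type*) [CommRing O] [CommRing B] [Algebra O B] [AddCommGroup V] [Module O V]
    [AddCommGroup W] [Module O W] :
    (B ⊗[O] V) ⊗[B] (B ⊗[O] W) ≃ₗ[B] B ⊗[O] (V ⊗[O] W) :=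
  (AlgebraTensorModule.distribBaseChange O B V W).symm

variable {O : Type} [CommRing O] {A : Type*} [CommRing A] [HopfAlgebra O A]

theorem mulT_tmul {B V W : Type*} [CommRing B] [Algebra O B] [AddCommGroup V] [Module O V]
    [AddCommGroup W] [Module O W] (b b' : B) (v : V) (w : W) :
    mulT O B V W ((b ⊗ₜ v) ⊗ₜ (b' ⊗ₜ w)) = (b * b') ⊗ₜ (v ⊗ₜ w) :=
  AlgebraTensorModule.distribBaseChange_symm_tmul O B v w b b'

theorem mulT_rTensor {B B' V W : Type*} [CommRing B] [Algebra O B] [CommRing B'] [Algebra O B']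
    [AddCommGroup V] [Module O V] [AddCommGroup W] [Module O W] (φ : B →ₐ[O] B') (x : B ⊗[O] V)
    (y : B ⊗[O] W) :
    mulT O B' V W (φ.toLinearMap.rTensor V x ⊗ₜ φ.toLinearMap.rTensor W y) =
      φ.toLinearMap.rTensor (V ⊗[O] W) (mulT O B V W (x ⊗ₜ y)) := by
  induction x with
  | zero => simp
  | add x x' hx hx' => simp only [map_add, TensorProduct.add_tmul, hx, hx']
  | tmul b v =>
    induction y with
    | zero => simp
    | add y y' hy hy' => simp only [map_add, TensorProduct.tmul_add, hy, hy']
    | tmul b' w => simp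

namespace FreeRep

/-- The canonical isomorphism `(V ⊗ B) ⊗_B (W ⊗ B) ≅ (V ⊗ W) ⊗ B` for two representations. -/
def mulX (X Y : FreeRep O A) (B : Type*) [CommRing B] [Algebra O B] :
    (B ⊗[O] X.V) ⊗[B] (B ⊗[O] Y.V) ≃ₗ[B] B ⊗[O] (tensor X Y).V :=
  mulT O B X.V Y.V

/-- The pure tensors in the tensor product of two representations. -/
def tm {X Y : FreeRep O A} (v : X.V) (w : Y.V) : (tensor X Y).V := v ⊗ₜ[O] w

theorem mulX_tmul (X Y : FreeRep O A) {B : Type*} [CommRing B] [Algebra O B] (b b' : B) (v : X.V)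
    (w : Y.V) : mulX X Y B ((b ⊗ₜ v) ⊗ₜ (b' ⊗ₜ w)) = (b * b') ⊗ₜ tm v w :=
  mulT_tmul _ _ _ _

theorem mulX_rTensor (X Y : FreeRep O A) {B B' : Type*} [CommRing B] [Algebra O B] [CommRing B']
    [Algebra O B'] (φ : B →ₐ[O] B') (x : B ⊗[O] X.V) (y : B ⊗[O] Y.V) :
    mulX X Y B' (φ.toLinearMap.rTensor X.V x ⊗ₜ φ.toLinearMap.rTensor Y.V y) =
      φ.toLinearMap.rTensor (tensor X Y).V (mulX X Y B (x ⊗ₜ y)) :=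
  mulT_rTensor φ x y

theorem mulT_mulCoeff {V W B : Type*} [AddCommGroup V] [Module O V] [AddCommGroup W] [Module O W]
    [CommRing B] [Algebra O B] (g : A →ₐ[O] B) (x : V ⊗[O] A) (y : W ⊗[O] A) :
    TensorProduct.comm O (V ⊗[O] W) B (g.toLinearMap.lTensor (V ⊗[O] W)
      (mulCoeff V W A (x ⊗ₜ y))) = mulT O B V W
        (TensorProduct.comm O V B (g.toLinearMap.lTensor V x) ⊗ₜ
          TensorProduct.comm O W B (g.toLinearMap.lTensor W y)) := by
  induction x with
  | zero => simp
  | add x x' hx hx' => simp only [map_add, TensorProduct.add_tmul, hx, hx']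
  | tmul v a =>
    induction y with
    | zero => simp
    | add y y' hy hy' => simp only [map_add, TensorProduct.tmul_add, hy, hy']
    | tmul w a' => simp

theorem act_tensor (X Y : FreeRep O A) {B : Type*} [CommRing B] [Algebra O B] (g : Pts O A B)
    (x : B ⊗[O] X.V) (y : B ⊗[O] Y.V) :
    (tensor X Y).act g (mulX X Y B (x ⊗ₜ y)) = mulX X Y B (X.act g x ⊗ₜ Y.act g y) := by
  induction x with
  | zero => simp
  | add x x' hx hx' => simp only [map_add, TensorProduct.add_tmul, hx, hx']
  | tmul b v =>
    induction y with
    | zero => simp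
    | add y y' hy hy' => simp only [map_add, TensorProduct.tmul_add, hy, hy']
    | tmul b' w =>
      rw [mulX_tmul, act_tmul, act_tmul, act_tmul, ← TensorProduct.smul_tmul',
        TensorProduct.tmul_smul, smul_smul, map_smul]
      congr 1
      exact mulT_mulCoeff g.ofConv (X.coact v) (Y.coact w)

variable {K : Type*} [CommRing K] [Algebra O K] (μ : (K ⊗[O] A) →ₐc[K] K[T;T⁻¹])

theorem mulX_weightSpace (X Y : FreeRep O A) {i j : ℤ} {v : K ⊗[O] X.V} {w : K ⊗[O] Y.V}
    (hv : v ∈ X.weightSpace μ i) (hw : w ∈ Y.weightSpace μ j) :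
    mulX X Y K (v ⊗ₜ w) ∈ (tensor X Y).weightSpace μ (i + j) := by
  rw [mem_weightSpace] at hv hw ⊢
  rw [← mulX_rTensor, act_tensor, hv, hw, ← TensorProduct.smul_tmul', TensorProduct.tmul_smul,
    smul_smul, map_smul, ← LaurentPolynomial.T_add]

/-- The element `1` of the trivial representation. -/
def unitOne : (unit : FreeRep O A).V := (1 : O)

theorem one_mem_weightSpace_unit : (1 : K) ⊗ₜ[O] unitOne ∈ (unit : FreeRep O A).weightSpace μ 0 := by
  have h : (unit : FreeRep O A).coact unitOne = unitOne ⊗ₜ (1 : A) := rfl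
  rw [mem_weightSpace, LinearMap.rTensor_tmul, act_tmul, h, LinearMap.lTensor_tmul,
    TensorProduct.comm_tmul]
  simp

variable {S : Type r} [CommRing S] [Algebra O S] [Algebra K S] [IsScalarTower O K S]

variable (K S) in
/-- The base change `V_K → V ⊗ S`. -/
abbrev extT (X : FreeRep O A) : K ⊗[O] X.V →ₗ[O] S ⊗[O] X.V :=
  (IsScalarTower.toAlgHom O K S).toLinearMap.rTensor X.V

/-- The degree `l` piece of `V ⊗ S = V_K ⊗_K S`, where `V_K = ⨁ V^i` is graded by the weights of
`μ`. -/
def muPiece (𝒜 : ℤ → AddSubgroup S) (X : FreeRep O A) (l : ℤ) : AddSubgroup (S ⊗[O] X.V) :=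
  AddSubgroup.closure {z | ∃ a i, a + i = l ∧ ∃ s ∈ 𝒜 a, ∃ v ∈ X.weightSpace μ i,
    z = s • X.extT K S v}

variable {𝒜 : ℤ → AddSubgroup S}

theorem smul_extT_mem (X : FreeRep O A) {a i : ℤ} {s : S} (hs : s ∈ 𝒜 a) {v : K ⊗[O] X.V}
    (hv : v ∈ X.weightSpace μ i) : s • X.extT K S v ∈ X.muPiece μ 𝒜 (a + i) :=
  AddSubgroup.subset_closure ⟨a, i, rfl, s, hs, v, hv, rfl⟩

/-- To check that a linear map preserves degrees, it suffices to consider generators. -/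
theorem map_mem_of_muPiece (X : FreeRep O A) {M : Type*} [AddCommGroup M] (P : ℤ → AddSubgroup M)
    (f : S ⊗[O] X.V →+ M) (h : ∀ a i, ∀ s ∈ 𝒜 a, ∀ v ∈ X.weightSpace μ i,
      f (s • X.extT K S v) ∈ P (a + i)) (l : ℤ) (z : S ⊗[O] X.V) (hz : z ∈ X.muPiece μ 𝒜 l) :
    f z ∈ P l := by
  induction hz using AddSubgroup.closure_induction with
  | mem z hz =>
    obtain ⟨a, b, rfl, x, hx, y, hy, rfl⟩ := hz
    exact h a b x hx y hy
  | zero => simp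
  | add x y _ _ hx hy => rw [map_add]; exact add_mem hx hy
  | neg x _ hx => rw [map_neg]; exact neg_mem hx

variable [GradedRing 𝒜]

theorem muPiece_smul_mem (X : FreeRep O A) {i j : ℤ} {s : S} {m : S ⊗[O] X.V} (hs : s ∈ 𝒜 i)
    (hm : m ∈ X.muPiece μ 𝒜 j) : s • m ∈ X.muPiece μ 𝒜 (i + j) :=
  map_mem_of_muPiece μ X (fun j => X.muPiece μ 𝒜 (i + j))
    (DistribSMul.toAddMonoidHom (S ⊗[O] X.V) s) (fun a l t ht v hv => by
      change s • t • X.extT K S v ∈ _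
      rw [smul_smul, ← add_assoc]
      exact smul_extT_mem μ X (SetLike.mul_mem_graded hs ht) hv) j m hm

theorem mem_closure_muPiece (X : FreeRep O A) (z : S ⊗[O] X.V) :
    z ∈ AddSubgroup.closure (⋃ i, (X.muPiece μ 𝒜 i : Set (S ⊗[O] X.V))) := by
  induction z with
  | zero => exact zero_mem _
  | add x y hx hy => exact add_mem hx hy
  | tmul s v =>
    have h1 : s ⊗ₜ[O] v = s • X.extT K S (1 ⊗ₜ v) := by
      simp [TensorProduct.smul_tmul']
    rw [h1]
    obtain ⟨t, ht⟩ := X.exists_sum_weightProj μ (1 ⊗ₜ v)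
    rw [ht, map_sum, Finset.smul_sum]
    refine sum_mem fun i _ => ?_
    induction s using DirectSum.Decomposition.inductionOn 𝒜 with
    | zero => rw [zero_smul]; exact zero_mem _
    | homogeneous s =>
      exact AddSubgroup.subset_closure (Set.mem_iUnion.mpr
        ⟨_, smul_extT_mem μ X s.2 (X.weightProj_mem μ i _)⟩)
    | add s t hs ht => rw [add_smul]; exact add_mem (hs (by simp [TensorProduct.smul_tmul'])) (ht (by simp [TensorProduct.smul_tmul']))

theorem muPiece_isInternal (X : FreeRep O A) (γ : S →ₐ[O] S[T;T⁻¹])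
    (hγ : ∀ a, ∀ s ∈ 𝒜 a, γ s = LaurentPolynomial.C s * LaurentPolynomial.T a)
    (hK : ∀ x, algebraMap K S x ∈ 𝒜 0) : DirectSum.IsInternal (X.muPiece μ 𝒜) := by
  let D : ℤ → S ⊗[O] X.V →+ S ⊗[O] X.V := fun l => (X.cfT S l ∘ₗ
    (X.act (cochar μ (univT K S))).restrictScalars O ∘ₗ γ.toLinearMap.rTensor X.V).toAddMonoidHom
  have hid : univT K K = AlgHom.id K K[T;T⁻¹] := by
    apply laurent_algHom_ext
    intro n
    rw [univT_T]
    rfl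
  have hD : ∀ i l, ∀ x ∈ X.muPiece μ 𝒜 i, D l x = if i = l then x else 0 := by
    intro i l x hx
    have h0 : D l x - (if i = l then x else 0) ∈ (⊥ : AddSubgroup (S ⊗[O] X.V)) := by
      let f : ℤ → S ⊗[O] X.V →+ S ⊗[O] X.V := fun i =>
        D l - (if i = l then AddMonoidHom.id _ else 0)
      induction hx using AddSubgroup.closure_induction with
      | zero => split_ifs <;> simp
      | add x y _ _ hx hy =>
        rw [AddSubgroup.mem_bot, sub_eq_zero] at *
        rw [map_add, hx, hy]
        split_ifs <;> simp
      | neg x _ hx =>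
        rw [AddSubgroup.mem_bot, sub_eq_zero] at *
        rw [map_neg, hx]
        split_ifs <;> simp
      | mem z hz =>
        obtain ⟨a, b, rfl, s, hs, v, hv, rfl⟩ := hz
        rw [AddSubgroup.mem_bot, sub_eq_zero]
        change X.cfT S l (X.act (cochar μ (univT K S))
          (γ.toLinearMap.rTensor X.V (s • X.extT K S v))) = _
        rw [rTensor_smul, hγ a s hs]
        have h1 : γ.toLinearMap.rTensor X.V (X.extT K S v) =
            ((univT K S).restrictScalars O).toLinearMap.rTensor X.V (X.cstT K v) := by
          simp only [← LinearMap.comp_apply, ← LinearMap.rTensor_comp]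
          congr 2
          refine LinearMap.ext fun x => ?_
          have h2 := hγ 0 _ (hK x)
          rw [LaurentPolynomial.T_zero, mul_one] at h2
          exact h2.trans ((univT K S).commutes x).symm
        have h3 : ((univT K S).restrictScalars O).toLinearMap.rTensor X.V (X.cstT K v) =
            X.cstT S (X.extT K S v) := by
          simp only [← LinearMap.comp_apply, ← LinearMap.rTensor_comp]
          congr 2
          exact LinearMap.ext fun x => (univT K S).commutes x
        have h4 : cochar μ (univT K S) =
            Pts.map ((univT K S).restrictScalars O) (cochar μ (univT K K)) := by
          rw [cochar_map, hid, AlgHom.comp_id]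
        rw [h1, map_smul, h4, act_map, (X.mem_weightSpace μ).mp hv, rTensor_smul, h3]
        have h5 : (univT K S).restrictScalars O (LaurentPolynomial.T b : K[T;T⁻¹]) =
            LaurentPolynomial.T b := univT_T K S b
        rw [h5, mul_comm, smul_smul, mul_right_comm, ← LaurentPolynomial.T_add, mul_smul,
          show (LaurentPolynomial.C s : S[T;T⁻¹]) = cst O S s from rfl, ← rTensor_smul]
        exact X.cfT_smul_cstT l (a + b) _
    rwa [AddSubgroup.mem_bot, sub_eq_zero] at h0
  exact isInternal_of_proj _ D (fun i x hx => by rw [hD i i x hx, if_pos rfl])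
    (fun i j hij x hx => by rw [hD i j x hx, if_neg hij]) (X.mem_closure_muPiece μ)

theorem map_muPiece {X Y : FreeRep O A} (f : X ⟶ Y) (l : ℤ) (z : S ⊗[O] X.V)
    (hz : z ∈ X.muPiece μ 𝒜 l) : f.lin.baseChange S z ∈ Y.muPiece μ 𝒜 l := by
  refine map_mem_of_muPiece μ X (Y.muPiece μ 𝒜) (f.lin.baseChange S).toAddMonoidHom
    (fun a i s hs v hv => ?_) l z hz
  change f.lin.baseChange S (s • X.extT K S v) ∈ _
  have : f.lin.baseChange S (X.extT K S v) = Y.extT K S (f.lin.lTensor K v) := by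
    change f.lin.lTensor S (X.extT K S v) = _
    simp only [← LinearMap.comp_apply, LinearMap.lTensor_comp_rTensor,
      LinearMap.rTensor_comp_lTensor]
  rw [map_smul, this]
  exact smul_extT_mem μ Y hs (map_weightSpace μ f hv)

theorem mulX_muPiece (X Y : FreeRep O A) (l : ℤ) (z : (S ⊗[O] X.V) ⊗[S] (S ⊗[O] Y.V))
    (hz : z ∈ GrProj.tensorPiece (X.muPiece μ 𝒜) (Y.muPiece μ 𝒜) l) :
    mulX X Y S z ∈ (tensor X Y).muPiece μ 𝒜 l := by
  refine GrProj.map_mem_of_tmul (mulX X Y S).toLinearMap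
    (fun i j x hx y hy => ?_) l z hz
  refine map_mem_of_muPiece μ X (fun i => (tensor X Y).muPiece μ 𝒜 (i + j))
    ((mulX X Y S).toLinearMap ∘ₗ
      (TensorProduct.mk S _ _).flip y).toAddMonoidHom (fun a i s hs v hv => ?_) i x hx
  refine map_mem_of_muPiece μ Y (fun j => (tensor X Y).muPiece μ 𝒜 (a + i + j))
    ((mulX X Y S).toLinearMap ∘ₗ
      TensorProduct.mk S _ _ (s • X.extT K S v)).toAddMonoidHom (fun b j t ht w hw => ?_) j y hy
  change mulX X Y S ((s • X.extT K S v) ⊗ₜ (t • Y.extT K S w)) ∈ _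
  rw [← TensorProduct.smul_tmul', TensorProduct.tmul_smul, smul_smul, map_smul, mulX_rTensor,
    show a + i + (b + j) = a + b + (i + j) by ring]
  exact smul_extT_mem μ (tensor X Y) (SetLike.mul_mem_graded hs ht) (mulX_weightSpace μ X Y hv hw)

theorem unit_muPiece (l : ℤ) (s : S) (hs : s ∈ 𝒜 l) :
    s ⊗ₜ[O] unitOne ∈ (unit : FreeRep O A).muPiece μ 𝒜 l := by
  have h := smul_extT_mem (S := S) μ unit hs (one_mem_weightSpace_unit (A := A) μ)
  rw [LinearMap.rTensor_tmul, TensorProduct.smul_tmul', add_zero] at h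
  simpa using h

end FreeRep

end MuGrading

/-! ### Exact tensor functors -/

section ExactTensorFunctors

universe v₁ v₂ u₁ u₂ w₁ w₂

variable {O : Type*} [CommRing O] {S : Type*} [CommRing S]
  {C : Type u₁} [Category.{v₁} C] [MonoidalCategory C] [SymmetricCategory C]
  {D : Type u₂} [Category.{v₂} D] [MonoidalCategory D] [SymmetricCategory D]

/-- A sequence of modules `M → N → P` is short exact if `0 → M → N → P → 0` is exact. -/
def ShortExact {M N P : ModuleCat.{w₁} O} (f : M ⟶ N) (g : N ⟶ P) : Prop :=
  Function.Injective f.hom ∧ Function.Exact f.hom g.hom ∧ Function.Surjective g.hom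

/-- Exact tensor functors between two categories of modules with additional structure. The functors
`U : C ⥤ Mod O` and `U' : D ⥤ Mod S` give the underlying modules; exactness of a sequence is
exactness of the sequence of underlying modules. A tensor functor is a symmetric strong monoidal
functor. -/
structure ExactTensorFunctor (U : C ⥤ ModuleCat.{w₁} O) (U' : D ⥤ ModuleCat.{w₂} S) where
  /-- the underlying functor -/
  functor : C ⥤ D
  /-- the tensor structure -/
  [braided : functor.Braided]
  exact : ∀ {X Y Z : C} (f : X ⟶ Y) (g : Y ⟶ Z), ShortExact (U.map f) (U.map g) →
    ShortExact (U'.map (functor.map f)) (U'.map (functor.map g))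

attribute [instance] ExactTensorFunctor.braided

namespace ExactTensorFunctor

variable {U : C ⥤ ModuleCat.{w₁} O} {U' : D ⥤ ModuleCat.{w₂} S}

/-- A morphism of tensor functors is a monoidal natural transformation. -/
@[ext]
structure Hom (F G : ExactTensorFunctor U U') where
  /-- the underlying natural transformation -/
  nat : F.functor ⟶ G.functor
  [isMonoidal : NatTrans.IsMonoidal nat]

attribute [instance] Hom.isMonoidal

instance : Category (ExactTensorFunctor U U') where
  Hom F G := Hom F G
  id F := ⟨𝟙 _⟩
  comp f g := ⟨f.nat ≫ g.nat⟩

@[ext]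
theorem hom_ext {F G : ExactTensorFunctor U U'} {f g : F ⟶ G} (h : f.nat = g.nat) : f = g :=
  Hom.ext h

@[simp] theorem id_nat (F : ExactTensorFunctor U U') : Hom.nat (𝟙 F) = 𝟙 F.functor := rfl
@[simp] theorem comp_nat {F G H : ExactTensorFunctor U U'} (f : F ⟶ G) (g : G ⟶ H) :
    (f ≫ g).nat = f.nat ≫ g.nat := rfl

end ExactTensorFunctor

end ExactTensorFunctors

/-! ### Graded fiber functors and Tannakian displays -/

section FiberFunctors

variable (p : ℕ) [hp : Fact p.Prime] (k : Type*) (A : Type*) [CommRing A] [HopfAlgebra ℤ_[p] A]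
  (R : Type r) [CommRing R]

/-- A graded fiber functor over `W(R)^⊕` is an exact tensor functor from the representations of
`G = Spec A` on finite free `ℤ_p`-modules to finite projective graded `W(R)^⊕`-modules. -/
abbrev GradedFiberFunctor :=
  ExactTensorFunctor (FreeRep.forget (O := ℤ_[p]) (A := A))
    (GrProj.forget (𝒜 := WittGr.piece p k R))

/-- A Tannakian `G`-display over `R` is an exact tensor functor from the representations of `G` on
finite free `ℤ_p`-modules to displays over the Witt frame of `R`. -/
abbrev TannakianDisplay :=
  ExactTensorFunctor (FreeRep.forget (O := ℤ_[p]) (A := A))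
    (Disp.forget p k R ⋙ GrProj.forget)

variable {p k A R} in
/-- The graded fiber functor `υ ∘ D` underlying a Tannakian display `D`. -/
@[simps] def TannakianDisplay.toGradedFiberFunctor (D : TannakianDisplay p k A R) :
    GradedFiberFunctor p k A R where
  functor := D.functor ⋙ Disp.forget p k R
  exact f g h := D.exact f g h

end FiberFunctors

/-! ### The graded fiber functor `C_μ` -/

section StandardFunctor

variable {p : ℕ} [hp : Fact p.Prime] {k : Type*} [Field k] [CharP k p] [PerfectRing k p]
  {A : Type*} [CommRing A] [HopfAlgebra ℤ_[p] A]
  (μ : (WittVector p k ⊗[ℤ_[p]] A) →ₐc[WittVector p k] (WittVector p k)[T;T⁻¹])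
  (R : Type r) [CommRing R] [Algebra (WittVector p k) R]

theorem gradingCoaction_apply {a : ℤ} {s : WittGr p k R} (hs : s ∈ WittGr.piece p k R a) :
    gradingCoaction p k R s = LaurentPolynomial.C s * LaurentPolynomial.T a := by
  obtain ⟨x, rfl⟩ := hs
  rw [mul_comm]
  exact gradingHom_of p k R a x

theorem algebraMap_mem_piece (x : WittVector p k) :
    algebraMap (WittVector p k) (WittGr p k R) x ∈ WittGr.piece p k R 0 :=
  WittGr.ofZero_mem p k R _

/-- Extensionality for linear maps out of `(V ⊗ B) ⊗_B (W ⊗ B)`. -/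
theorem baseChange_ext₂ {O B V W M : Type*} [CommRing O] [CommRing B] [Algebra O B]
    [AddCommGroup V] [Module O V] [AddCommGroup W] [Module O W] [AddCommGroup M] [Module B M]
    {f g : (B ⊗[O] V) ⊗[B] (B ⊗[O] W) →ₗ[B] M}
    (h : ∀ v w, f ((1 ⊗ₜ v) ⊗ₜ (1 ⊗ₜ w)) = g ((1 ⊗ₜ v) ⊗ₜ (1 ⊗ₜ w))) : f = g := by
  apply TensorProduct.ext'
  intro x y
  induction x with
  | zero => simp
  | add x x' hx hx' => simp only [map_add, TensorProduct.add_tmul, hx, hx']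
  | tmul b v =>
    induction y with
    | zero => simp
    | add y y' hy hy' => simp only [map_add, TensorProduct.tmul_add, hy, hy']
    | tmul b' w =>
      have h1 : (b ⊗ₜ[O] v) ⊗ₜ[B] (b' ⊗ₜ[O] w) =
          (b * b') • ((1 ⊗ₜ[O] v) ⊗ₜ[B] (1 ⊗ₜ[O] w)) := by
        have h2 : b ⊗ₜ[O] v = b • (1 ⊗ₜ[O] v) := by simp [TensorProduct.smul_tmul']
        have h3 : b' ⊗ₜ[O] w = b' • (1 ⊗ₜ[O] w) := by simp [TensorProduct.smul_tmul']
        rw [h2, h3, ← TensorProduct.smul_tmul', TensorProduct.tmul_smul, smul_smul]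
      rw [h1, map_smul, map_smul, h]

/-- Extensionality for linear maps out of `V ⊗ B`. -/
theorem baseChange_ext {O B V M : Type*} [CommRing O] [CommRing B] [Algebra O B]
    [AddCommGroup V] [Module O V] [AddCommGroup M] [Module B M]
    {f g : B ⊗[O] V →ₗ[B] M} (h : ∀ v, f (1 ⊗ₜ v) = g (1 ⊗ₜ v)) : f = g := by
  refine LinearMap.ext fun x => ?_
  induction x with
  | zero => simp
  | add x x' hx hx' => simp only [map_add, hx, hx']
  | tmul b v =>
    rw [← mul_one b, ← smul_eq_mul, ← TensorProduct.smul_tmul', map_smul, map_smul, h]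

/-- Extensionality for linear maps out of `((V ⊗ B) ⊗_B (W ⊗ B)) ⊗_B (Z ⊗ B)`. -/
theorem baseChange_ext₃ {O B V W Z M : Type*} [CommRing O] [CommRing B] [Algebra O B]
    [AddCommGroup V] [Module O V] [AddCommGroup W] [Module O W] [AddCommGroup Z] [Module O Z]
    [AddCommGroup M] [Module B M]
    {f g : ((B ⊗[O] V) ⊗[B] (B ⊗[O] W)) ⊗[B] (B ⊗[O] Z) →ₗ[B] M}
    (h : ∀ v w z, f (((1 ⊗ₜ v) ⊗ₜ (1 ⊗ₜ w)) ⊗ₜ (1 ⊗ₜ z)) =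
      g (((1 ⊗ₜ v) ⊗ₜ (1 ⊗ₜ w)) ⊗ₜ (1 ⊗ₜ z))) : f = g := by
  apply TensorProduct.ext
  apply baseChange_ext₂
  intro v w
  exact baseChange_ext fun z => h v w z

/-- The canonical isomorphism `B ≅ O ⊗ B`. -/
def unitX (O : Type) [CommRing O] (A : Type*) [CommRing A] [HopfAlgebra O A]
    (B : Type*) [CommRing B] [Algebra O B] : B ≃ₗ[B] B ⊗[O] (FreeRep.unit : FreeRep O A).V :=
  (AlgebraTensorModule.rid O B B).symm

theorem unitX_apply {O : Type} [CommRing O] {A : Type*} [CommRing A] [HopfAlgebra O A]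
    {B : Type*} [CommRing B] [Algebra O B] (b : B) :
    unitX O A B b = b ⊗ₜ FreeRep.unitOne := rfl

namespace StdFunctor

/-- The graded `W(R)^⊕`-module `V ⊗ W(R)^⊕ = V_{W(k)} ⊗_{W(k)} W(R)^⊕`. -/
def obj (X : FreeRep ℤ_[p] A) : PGrMod p k R where
  M := WittGr p k R ⊗[ℤ_[p]] X.V
  piece := X.muPiece μ (WittGr.piece p k R)
  smul_mem hs hm := X.muPiece_smul_mem μ hs hm
  isInternal := X.muPiece_isInternal μ (gradingCoaction p k R)
    (fun _ _ hs => gradingCoaction_apply R hs) (algebraMap_mem_piece R)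

/-- The functor `V ↦ V ⊗ W(R)^⊕`. -/
@[simps] def functor : FreeRep ℤ_[p] A ⥤ PGrMod p k R where
  obj X := obj μ R X
  map f := ⟨f.lin.baseChange (WittGr p k R), FreeRep.map_muPiece μ f⟩
  map_id _ := GrProj.hom_ext (LinearMap.baseChange_id)
  map_comp f g := GrProj.hom_ext (LinearMap.baseChange_comp (f := f.lin) (g := g.lin))

/-- The comparison of tensor products. -/
def muIso (X Y : FreeRep ℤ_[p] A) : obj μ R X ⊗ obj μ R Y ≅ obj μ R (X ⊗ Y) :=
  GrProj.isoMk (X := obj μ R X ⊗ obj μ R Y) (Y := obj μ R (X ⊗ Y))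
    (FreeRep.mulX X Y (WittGr p k R)) (X.mulX_muPiece μ Y)

/-- The comparison of unit objects. -/
def epsIso : 𝟙_ (PGrMod p k R) ≅ obj μ R (𝟙_ (FreeRep ℤ_[p] A)) :=
  GrProj.isoMk (X := GrProj.unit _) (Y := obj μ R FreeRep.unit)
    (unitX ℤ_[p] A (WittGr p k R))
    (fun l s hs => FreeRep.unit_muPiece (S := WittGr p k R) μ l s hs)

/-- The tensor structure on the functor `V ↦ V ⊗ W(R)^⊕`. -/
def core : (functor μ R).CoreMonoidal where
  εIso := epsIso μ R
  μIso := muIso μ R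
  μIso_hom_natural_left := by
    intro X Y f X'
    apply GrProj.hom_ext
    apply baseChange_ext₂
    intro v w
    change FreeRep.mulX Y X' (WittGr p k R) ((1 ⊗ₜ f.lin v) ⊗ₜ (1 ⊗ₜ w)) =
      (f ▷ X').lin.baseChange (WittGr p k R) (FreeRep.mulX X X' (WittGr p k R)
        ((1 ⊗ₜ v) ⊗ₜ (1 ⊗ₜ w)))
    rw [FreeRep.mulX_tmul, FreeRep.mulX_tmul]
    rfl
  μIso_hom_natural_right := by
    intro X Y X' f
    apply GrProj.hom_ext
    apply baseChange_ext₂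
    intro v w
    change FreeRep.mulX X' Y (WittGr p k R) ((1 ⊗ₜ v) ⊗ₜ (1 ⊗ₜ f.lin w)) =
      (X' ◁ f).lin.baseChange (WittGr p k R) (FreeRep.mulX X' X (WittGr p k R)
        ((1 ⊗ₜ v) ⊗ₜ (1 ⊗ₜ w)))
    rw [FreeRep.mulX_tmul, FreeRep.mulX_tmul]
    rfl
  associativity := by
    intro X Y Z
    apply GrProj.hom_ext
    apply baseChange_ext₃
    intro v w z
    change (α_ X Y Z).hom.lin.baseChange (WittGr p k R)
      (FreeRep.mulX (FreeRep.tensor X Y) Z (WittGr p k R)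
        ((FreeRep.mulX X Y (WittGr p k R) ((1 ⊗ₜ v) ⊗ₜ (1 ⊗ₜ w))) ⊗ₜ (1 ⊗ₜ z))) =
      FreeRep.mulX X (FreeRep.tensor Y Z) (WittGr p k R)
        ((1 ⊗ₜ v) ⊗ₜ (FreeRep.mulX Y Z (WittGr p k R) ((1 ⊗ₜ w) ⊗ₜ (1 ⊗ₜ z))))
    rw [FreeRep.mulX_tmul, FreeRep.mulX_tmul, FreeRep.mulX_tmul, FreeRep.mulX_tmul]
    simp only [mul_one]
    rfl
  left_unitality := by
    intro X
    apply GrProj.hom_ext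
    apply TensorProduct.ext
    apply LinearMap.ext_ring
    apply baseChange_ext
    intro v
    change (1 : WittGr p k R) • ((1 : WittGr p k R) ⊗ₜ[ℤ_[p]] v) =
      (λ_ X).hom.lin.baseChange (WittGr p k R) (FreeRep.mulX FreeRep.unit X (WittGr p k R)
        ((unitX ℤ_[p] A (WittGr p k R) 1) ⊗ₜ (1 ⊗ₜ v)))
    rw [unitX_apply, FreeRep.mulX_tmul, one_smul, mul_one]
    change 1 ⊗ₜ v = (1 : WittGr p k R) ⊗ₜ[ℤ_[p]] ((1 : ℤ_[p]) • v)
    rw [one_smul]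
  right_unitality := by
    intro X
    apply GrProj.hom_ext
    apply TensorProduct.ext
    apply baseChange_ext
    intro v
    apply LinearMap.ext_ring
    change (1 : WittGr p k R) • ((1 : WittGr p k R) ⊗ₜ[ℤ_[p]] v) =
      (ρ_ X).hom.lin.baseChange (WittGr p k R) (FreeRep.mulX X FreeRep.unit (WittGr p k R)
        ((1 ⊗ₜ v) ⊗ₜ (unitX ℤ_[p] A (WittGr p k R) 1)))
    rw [unitX_apply, FreeRep.mulX_tmul, one_smul, mul_one]
    change 1 ⊗ₜ v = (1 : WittGr p k R) ⊗ₜ[ℤ_[p]] ((1 : ℤ_[p]) • v)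
    rw [one_smul]

instance : (functor μ R).Monoidal := (core μ R).toMonoidal

instance : (functor μ R).Braided where
  braided X Y := by
    apply GrProj.hom_ext
    apply baseChange_ext₂
    intro v w
    change (β_ X Y).hom.lin.baseChange (WittGr p k R) (FreeRep.mulX X Y (WittGr p k R)
      ((1 ⊗ₜ v) ⊗ₜ (1 ⊗ₜ w))) = FreeRep.mulX Y X (WittGr p k R) ((1 ⊗ₜ w) ⊗ₜ (1 ⊗ₜ v))
    rw [FreeRep.mulX_tmul, FreeRep.mulX_tmul]
    rfl

theorem map_exact {X Y Z : FreeRep ℤ_[p] A} (f : X ⟶ Y) (g : Y ⟶ Z)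
    (h : ShortExact (FreeRep.forget.map f) (FreeRep.forget.map g)) :
    ShortExact (GrProj.forget.map ((functor μ R).map f))
      (GrProj.forget.map ((functor μ R).map g)) := by
  obtain ⟨h1, h2, h3⟩ := h
  obtain ⟨l, hl⟩ : ∃ l, l ∘ₗ f.lin = LinearMap.id :=
    ((Function.Exact.split_tfae h2 h1 h3).out 0 1).mp
      (Module.projective_lifting_property g.lin LinearMap.id h3)
  refine ⟨?_, lTensor_exact (WittGr p k R) h2 h3, LinearMap.lTensor_surjective (WittGr p k R) h3⟩
  refine Function.LeftInverse.injective (g := l.lTensor (WittGr p k R)) fun x => ?_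
  change l.lTensor (WittGr p k R) (f.lin.lTensor (WittGr p k R) x) = x
  rw [← LinearMap.comp_apply, ← LinearMap.lTensor_comp, hl, LinearMap.lTensor_id,
    LinearMap.id_apply]

end StdFunctor

/-- The graded fiber functor `C_μ`, `V ↦ V ⊗ W(R)^⊕`. -/
@[simps] def stdFunctor : GradedFiberFunctor p k A R where
  functor := StdFunctor.functor μ R
  exact := StdFunctor.map_exact μ R

end StandardFunctor

/-! ### The displays `D_U` -/

section Cancel

open Functor.LaxMonoidal Functor.OplaxMonoidal Functor.Monoidal

variable {O : Type} [CommRing O] {A : Type*} [CommRing A] [HopfAlgebra O A]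
  {S B : Type r} [CommRing S] [CommRing B] [Algebra O S] [Algebra O B] (φ : S →+* B)
  (hφ : ∀ x : O, φ (algebraMap O S x) = algebraMap O B x)

/-- The canonical isomorphism `(V ⊗ S) ⊗_{S, φ} B ≅ V ⊗ B`. -/
def cancelAlong (X : FreeRep O A) :
    (ModuleCat.extendScalars.{r, r, r} φ).obj (ModuleCat.of S (S ⊗[O] X.V)) ≅
      ModuleCat.of B (B ⊗[O] X.V) :=
  letI := φ.toAlgebra
  haveI : IsScalarTower O S B := IsScalarTower.of_algebraMap_eq fun x => (hφ x).symm
  (AlgebraTensorModule.cancelBaseChange O S B B X.V).toModuleIso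

theorem cancelAlong_tmul (X : FreeRep O A) (v : X.V) :
    letI := φ.toAlgebra
    (cancelAlong φ hφ X).hom.hom ((1 : B) ⊗ₜ[S] ((1 : S) ⊗ₜ[O] v)) = 1 ⊗ₜ v := by
  let _ := φ.toAlgebra
  have : IsScalarTower O S B := IsScalarTower.of_algebraMap_eq fun x => (hφ x).symm
  refine (AlgebraTensorModule.cancelBaseChange_tmul (R := O) (A := S) (B := B) (1 : B) v
    (1 : S)).trans ?_
  rw [one_smul]

theorem extendScalars_ext₀ {N : ModuleCat.{r} B}
    {f g : (ModuleCat.extendScalars.{r, r, r} φ).obj (ModuleCat.of S S) ⟶ N}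
    (h : letI := φ.toAlgebra; f.hom ((1 : B) ⊗ₜ[S] (1 : S)) = g.hom ((1 : B) ⊗ₜ[S] (1 : S))) :
    f = g := by
  apply ((ModuleCat.extendRestrictScalarsAdj φ).homEquiv _ _).injective
  apply ModuleCat.hom_ext
  apply LinearMap.ext_ring
  exact h

theorem extendScalars_ext₁ {V : Type} [AddCommGroup V] [Module O V] {N : ModuleCat.{r} B}
    {f g : (ModuleCat.extendScalars.{r, r, r} φ).obj (ModuleCat.of S (S ⊗[O] V)) ⟶ N}
    (h : ∀ v : V, letI := φ.toAlgebra
      f.hom ((1 : B) ⊗ₜ[S] ((1 : S) ⊗ₜ[O] v)) = g.hom ((1 : B) ⊗ₜ[S] ((1 : S) ⊗ₜ[O] v))) :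
    f = g := by
  apply ((ModuleCat.extendRestrictScalarsAdj φ).homEquiv _ _).injective
  apply ModuleCat.hom_ext
  apply baseChange_ext
  exact h

theorem extendScalars_ext₂ {V W : Type} [AddCommGroup V] [Module O V] [AddCommGroup W]
    [Module O W] {N : ModuleCat.{r} B}
    {f g : (ModuleCat.extendScalars.{r, r, r} φ).obj
      (ModuleCat.of S (S ⊗[O] V) ⊗ ModuleCat.of S (S ⊗[O] W)) ⟶ N}
    (h : ∀ (v : V) (w : W), letI := φ.toAlgebra
      f.hom ((1 : B) ⊗ₜ[S] (((1 : S) ⊗ₜ[O] v) ⊗ₜ[S] ((1 : S) ⊗ₜ[O] w))) =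
        g.hom ((1 : B) ⊗ₜ[S] (((1 : S) ⊗ₜ[O] v) ⊗ₜ[S] ((1 : S) ⊗ₜ[O] w)))) :
    f = g := by
  apply ((ModuleCat.extendRestrictScalarsAdj φ).homEquiv _ _).injective
  apply ModuleCat.hom_ext
  apply baseChange_ext₂
  exact h

variable {φ} in
theorem cancelAlong_naturality {X Y : FreeRep O A} (f : X ⟶ Y) :
    (ModuleCat.extendScalars.{r, r, r} φ).map (ModuleCat.ofHom (f.lin.baseChange S)) ≫
      (cancelAlong φ hφ Y).hom =
    (cancelAlong φ hφ X).hom ≫ ModuleCat.ofHom (f.lin.baseChange B) := by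
  apply extendScalars_ext₁
  intro v
  refine (cancelAlong_tmul φ hφ Y (f.lin v)).trans ?_
  exact (congrArg (f.lin.baseChange B) (cancelAlong_tmul φ hφ X v)).symm

/-- The action of a point of `G(B)` as an isomorphism. -/
def actIso (X : FreeRep O A) (g : Pts O A B) :
    ModuleCat.of B (B ⊗[O] X.V) ≅ ModuleCat.of B (B ⊗[O] X.V) :=
  (X.actEquiv g).toModuleIso

/-- The isomorphism `(V ⊗ S) ⊗_{S, σ} B ≅ V ⊗ B ≅ (V ⊗ S) ⊗_{S, τ} B` in which the first and the last
identifications are the canonical ones, and which is given on `V ⊗ B` by `g ∈ G(B)`. -/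
def frobIso {σ τ : S →+* B} (hσ : ∀ x : O, σ (algebraMap O S x) = algebraMap O B x)
    (hτ : ∀ x : O, τ (algebraMap O S x) = algebraMap O B x) (g : Pts O A B) (X : FreeRep O A) :
    (ModuleCat.extendScalars.{r, r, r} σ).obj (ModuleCat.of S (S ⊗[O] X.V)) ≅
      (ModuleCat.extendScalars.{r, r, r} τ).obj (ModuleCat.of S (S ⊗[O] X.V)) :=
  cancelAlong σ hσ X ≪≫ actIso X g ≪≫ (cancelAlong τ hτ X).symm

theorem frobIso_naturality {σ τ : S →+* B} (hσ : ∀ x : O, σ (algebraMap O S x) = algebraMap O B x)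
    (hτ : ∀ x : O, τ (algebraMap O S x) = algebraMap O B x) (g : Pts O A B) {X Y : FreeRep O A}
    (f : X ⟶ Y) :
    (frobIso hσ hτ g X).hom ≫
      (ModuleCat.extendScalars.{r, r, r} τ).map (ModuleCat.ofHom (f.lin.baseChange S)) =
    (ModuleCat.extendScalars.{r, r, r} σ).map (ModuleCat.ofHom (f.lin.baseChange S)) ≫
      (frobIso hσ hτ g Y).hom := by
  have h : (actIso X g).hom ≫ ModuleCat.ofHom (f.lin.baseChange B) =
      ModuleCat.ofHom (f.lin.baseChange B) ≫ (actIso Y g).hom := by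
    apply ModuleCat.hom_ext
    refine LinearMap.ext fun z => ?_
    exact (FreeRep.act_hom f g z).symm
  simp only [frobIso, Iso.trans_hom, Iso.symm_hom, Category.assoc]
  rw [← cancel_mono (cancelAlong τ hτ Y).hom]
  simp only [Category.assoc, Iso.inv_hom_id, Category.comp_id]
  rw [cancelAlong_naturality, Iso.inv_hom_id_assoc, h, ← Category.assoc,
    ← cancelAlong_naturality, Category.assoc]

/-- The comparison `(V ⊗ B) ⊗ (W ⊗ B) ≅ (V ⊗ W) ⊗ B` as a morphism. -/
def mulHom (X Y : FreeRep O A) (B : Type r) [CommRing B] [Algebra O B] :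
    ModuleCat.of B (B ⊗[O] X.V) ⊗ ModuleCat.of B (B ⊗[O] Y.V) ⟶
      ModuleCat.of B (B ⊗[O] (FreeRep.tensor X Y).V) :=
  ModuleCat.ofHom (FreeRep.mulX X Y B).toLinearMap

theorem cancelAlong_mul (X Y : FreeRep O A) :
    (ModuleCat.extendScalars.{r, r, r} φ).map (mulHom X Y S) ≫
      (cancelAlong φ hφ (FreeRep.tensor X Y)).hom =
    δ (ModuleCat.extendScalars.{r, r, r} φ) _ _ ≫
      ((cancelAlong φ hφ X).hom ⊗ₘ (cancelAlong φ hφ Y).hom) ≫ mulHom X Y B := by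
  apply extendScalars_ext₂
  intro v w
  have h1 : FreeRep.mulX X Y S ((1 ⊗ₜ v) ⊗ₜ (1 ⊗ₜ w)) = 1 ⊗ₜ FreeRep.tm v w := by
    rw [FreeRep.mulX_tmul, one_mul]
  have h2 : FreeRep.mulX X Y B ((1 ⊗ₜ v) ⊗ₜ (1 ⊗ₜ w)) = 1 ⊗ₜ FreeRep.tm v w := by
    rw [FreeRep.mulX_tmul, one_mul]
  let _ := φ.toAlgebra
  change (cancelAlong φ hφ (FreeRep.tensor X Y)).hom.hom ((1 : B) ⊗ₜ[S]
      (FreeRep.mulX X Y S ((1 ⊗ₜ v) ⊗ₜ (1 ⊗ₜ w)))) =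
    FreeRep.mulX X Y B ((cancelAlong φ hφ X).hom.hom ((1 : B) ⊗ₜ[S] ((1 : S) ⊗ₜ[O] v)) ⊗ₜ
      (cancelAlong φ hφ Y).hom.hom ((1 : B) ⊗ₜ[S] ((1 : S) ⊗ₜ[O] w)))
  rw [h1]
  erw [cancelAlong_tmul φ hφ X v, cancelAlong_tmul φ hφ Y w]
  exact (cancelAlong_tmul φ hφ _ _).trans h2.symm

theorem cancelAlong_unit :
    (ModuleCat.extendScalars.{r, r, r} φ).map (ModuleCat.ofHom (unitX O A S).toLinearMap) ≫
      (cancelAlong φ hφ (FreeRep.unit : FreeRep O A)).hom =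
    η (ModuleCat.extendScalars.{r, r, r} φ) ≫ ModuleCat.ofHom (unitX O A B).toLinearMap := by
  apply extendScalars_ext₀
  refine (cancelAlong_tmul φ hφ FreeRep.unit FreeRep.unitOne).trans ?_
  let _ := φ.toAlgebra
  change _ = unitX O A B (AlgebraTensorModule.rid S B B ((1 : B) ⊗ₜ[S] (1 : S)))
  rw [AlgebraTensorModule.rid_tmul, one_smul]
  rfl

theorem mulHom_act (X Y : FreeRep O A) (g : Pts O A B) :
    ((actIso X g).hom ⊗ₘ (actIso Y g).hom) ≫ mulHom X Y B =
      mulHom X Y B ≫ (actIso (FreeRep.tensor X Y) g).hom := by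
  apply ModuleCat.hom_ext
  apply TensorProduct.ext'
  intro x y
  exact (FreeRep.act_tensor X Y g x y).symm

theorem unitX_act (g : Pts O A B) :
    ModuleCat.ofHom (unitX O A B).toLinearMap ≫ (actIso (FreeRep.unit : FreeRep O A) g).hom =
      ModuleCat.ofHom (unitX O A B).toLinearMap := by
  apply ModuleCat.hom_ext
  apply LinearMap.ext_ring
  change (FreeRep.unit : FreeRep O A).act g ((1 : B) ⊗ₜ FreeRep.unitOne) = 1 ⊗ₜ FreeRep.unitOne
  have h : (FreeRep.unit : FreeRep O A).coact FreeRep.unitOne = FreeRep.unitOne ⊗ₜ (1 : A) := rfl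
  rw [FreeRep.act_tmul, h, LinearMap.lTensor_tmul, TensorProduct.comm_tmul]
  simp

theorem frobIso_mul {σ τ : S →+* B} (hσ : ∀ x : O, σ (algebraMap O S x) = algebraMap O B x)
    (hτ : ∀ x : O, τ (algebraMap O S x) = algebraMap O B x) (g : Pts O A B) (X Y : FreeRep O A) :
    (δ (ModuleCat.extendScalars.{r, r, r} σ) _ _ ≫
      ((frobIso hσ hτ g X).hom ⊗ₘ (frobIso hσ hτ g Y).hom) ≫
        μ (ModuleCat.extendScalars.{r, r, r} τ) _ _) ≫
        (ModuleCat.extendScalars.{r, r, r} τ).map (mulHom X Y S) =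
      (ModuleCat.extendScalars.{r, r, r} σ).map (mulHom X Y S) ≫
        (frobIso hσ hτ g (FreeRep.tensor X Y)).hom := by
  have h : μ (ModuleCat.extendScalars.{r, r, r} τ) _ _ ≫
      (ModuleCat.extendScalars.{r, r, r} τ).map (mulHom X Y S) ≫
        (cancelAlong τ hτ (FreeRep.tensor X Y)).hom =
      ((cancelAlong τ hτ X).hom ⊗ₘ (cancelAlong τ hτ Y).hom) ≫ mulHom X Y B := by
    rw [cancelAlong_mul, μ_δ_assoc]
  rw [← cancel_mono (cancelAlong τ hτ (FreeRep.tensor X Y)).hom]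
  simp only [Category.assoc]
  rw [h]
  simp only [frobIso, Iso.trans_hom, Iso.symm_hom, Category.assoc, Iso.inv_hom_id,
    Category.comp_id]
  rw [tensorHom_comp_tensorHom_assoc, Category.assoc, Category.assoc, Category.assoc,
    Category.assoc, Iso.inv_hom_id, Category.comp_id, Iso.inv_hom_id, Category.comp_id,
    ← Category.assoc ((ModuleCat.extendScalars σ).map _), cancelAlong_mul, Category.assoc,
    Category.assoc, ← mulHom_act, tensorHom_comp_tensorHom_assoc]

theorem frobIso_unit {σ τ : S →+* B} (hσ : ∀ x : O, σ (algebraMap O S x) = algebraMap O B x)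
    (hτ : ∀ x : O, τ (algebraMap O S x) = algebraMap O B x) (g : Pts O A B) :
    (η (ModuleCat.extendScalars.{r, r, r} σ) ≫ ε (ModuleCat.extendScalars.{r, r, r} τ)) ≫
        (ModuleCat.extendScalars.{r, r, r} τ).map (ModuleCat.ofHom (unitX O A S).toLinearMap) =
      (ModuleCat.extendScalars.{r, r, r} σ).map (ModuleCat.ofHom (unitX O A S).toLinearMap) ≫
        (frobIso hσ hτ g (FreeRep.unit : FreeRep O A)).hom := by
  rw [← cancel_mono (cancelAlong τ hτ (FreeRep.unit : FreeRep O A)).hom]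
  simp only [frobIso, Iso.trans_hom, Iso.symm_hom, Category.assoc, Iso.inv_hom_id,
    Category.comp_id]
  rw [cancelAlong_unit, ε_η_assoc, ← Category.assoc ((ModuleCat.extendScalars σ).map _),
    cancelAlong_unit, Category.assoc, unitX_act]

end Cancel

section DisplayOfPoint

open Functor.LaxMonoidal Functor.OplaxMonoidal Functor.Monoidal

variable {p : ℕ} [hp : Fact p.Prime] {k : Type*} [Field k] [CharP k p] [PerfectRing k p]
  {A : Type*} [CommRing A] [HopfAlgebra ℤ_[p] A]
  (μ : (WittVector p k ⊗[ℤ_[p]] A) →ₐc[WittVector p k] (WittVector p k)[T;T⁻¹])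
  {R : Type r} [CommRing R] [Algebra (WittVector p k) R]

theorem τ_algebraMap (x : ℤ_[p]) :
    WittGr.τ p k R (algebraMap ℤ_[p] (WittGr p k R) x) = algebraMap _ _ x :=
  WittGr.τ_ofZero p k R _

namespace DisplayOf

variable (U : Pts ℤ_[p] A (WittOver p k R))

/-- The display `(V ⊗ W(R)^⊕, F_U)`, where `F_U (x ⊗ s) = σ(s) ρ(U)(x ⊗ 1)`. -/
@[simps] def obj (X : FreeRep ℤ_[p] A) : Disp p k R where
  obj := StdFunctor.obj μ R X
  frob := frobIso (σ_algebraMap p k R) τ_algebraMap U X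

/-- The functor `V ↦ (V ⊗ W(R)^⊕, F_U)`. -/
@[simps] def functor : FreeRep ℤ_[p] A ⥤ Disp p k R where
  obj X := obj μ U X
  map f := ⟨(StdFunctor.functor μ R).map f,
    frobIso_naturality (σ_algebraMap p k R) τ_algebraMap U f⟩
  map_id X := IsoPair.hom_ext ((StdFunctor.functor μ R).map_id X)
  map_comp f g := IsoPair.hom_ext ((StdFunctor.functor μ R).map_comp f g)

/-- The comparison of tensor products. -/
def muIso (X Y : FreeRep ℤ_[p] A) : obj μ U X ⊗ obj μ U Y ≅ obj μ U (X ⊗ Y) :=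
  IsoPair.isoMk (X := obj μ U X ⊗ obj μ U Y) (StdFunctor.muIso μ R X Y) (by
    have h := frobIso_mul (σ_algebraMap p k R) τ_algebraMap U X Y
    have e1 : (δ (sigmaPull p k R) (StdFunctor.obj μ R X) (StdFunctor.obj μ R Y)) =
        δ (ModuleCat.extendScalars.{r, r, r} (WittGr.σ p k R))
          (GrProj.forget.obj (StdFunctor.obj μ R X)) (GrProj.forget.obj (StdFunctor.obj μ R Y)) := by
      rw [Functor.OplaxMonoidal.comp_δ]
      exact (congrArg (· ≫ _) (CategoryTheory.Functor.map_id _ _)).trans (Category.id_comp _)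
    have e2 : (Functor.LaxMonoidal.μ (tauPull p k R) (StdFunctor.obj μ R X)
        (StdFunctor.obj μ R Y)) =
        Functor.LaxMonoidal.μ (ModuleCat.extendScalars.{r, r, r} (WittGr.τ p k R))
          (GrProj.forget.obj (StdFunctor.obj μ R X)) (GrProj.forget.obj (StdFunctor.obj μ R Y)) := by
      rw [Functor.LaxMonoidal.comp_μ]
      exact (congrArg (_ ≫ ·) (CategoryTheory.Functor.map_id _ _)).trans (Category.comp_id _)
    change (δ (sigmaPull p k R) (StdFunctor.obj μ R X) (StdFunctor.obj μ R Y) ≫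
      ((frobIso (σ_algebraMap p k R) τ_algebraMap U X).hom ⊗ₘ
        (frobIso (σ_algebraMap p k R) τ_algebraMap U Y).hom) ≫
      Functor.LaxMonoidal.μ (tauPull p k R) (StdFunctor.obj μ R X)
        (StdFunctor.obj μ R Y)) ≫ _ = _
    rw [e1, e2]
    exact h)

/-- The comparison of unit objects. -/
def epsIso : 𝟙_ (Disp p k R) ≅ obj μ U (𝟙_ (FreeRep ℤ_[p] A)) :=
  IsoPair.isoMk (X := 𝟙_ (Disp p k R)) (StdFunctor.epsIso μ R) (by
    have h := frobIso_unit (σ_algebraMap p k R) τ_algebraMap U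
    have e1 : (η (sigmaPull p k R)) =
        η (ModuleCat.extendScalars.{r, r, r} (WittGr.σ p k R)) := by
      rw [Functor.OplaxMonoidal.comp_η]
      exact (congrArg (· ≫ _) (CategoryTheory.Functor.map_id _ _)).trans (Category.id_comp _)
    have e2 : (ε (tauPull p k R)) =
        ε (ModuleCat.extendScalars.{r, r, r} (WittGr.τ p k R)) := by
      rw [Functor.LaxMonoidal.comp_ε]
      exact (congrArg (_ ≫ ·) (CategoryTheory.Functor.map_id _ _)).trans (Category.comp_id _)
    change (η (sigmaPull p k R) ≫ ε (tauPull p k R)) ≫ _ = _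
    rw [e1, e2]
    exact h)

/-- The tensor structure on `V ↦ (V ⊗ W(R)^⊕, F_U)`. -/
def core : (functor μ U).CoreMonoidal where
  εIso := epsIso μ U
  μIso := muIso μ U
  μIso_hom_natural_left f X' := by
    apply IsoPair.hom_ext
    refine Eq.trans ?_ ((StdFunctor.core μ R).μIso_hom_natural_left f X')
    exact congrArg (· ≫ _) (tensorHom_id _ _)
  μIso_hom_natural_right X' f := by
    apply IsoPair.hom_ext
    refine Eq.trans ?_ ((StdFunctor.core μ R).μIso_hom_natural_right X' f)
    exact congrArg (· ≫ _) (id_tensorHom _ _)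
  associativity X Y Z := by
    apply IsoPair.hom_ext
    refine Eq.trans ?_ (((StdFunctor.core μ R).associativity X Y Z).trans ?_)
    · exact congrArg (· ≫ _) (tensorHom_id _ _)
    · exact congrArg (_ ≫ ·) (congrArg (· ≫ _) (id_tensorHom _ _).symm)
  left_unitality X := by
    apply IsoPair.hom_ext
    refine ((StdFunctor.core μ R).left_unitality X).trans ?_
    exact congrArg (· ≫ _) (tensorHom_id _ _).symm
  right_unitality X := by
    apply IsoPair.hom_ext
    refine ((StdFunctor.core μ R).right_unitality X).trans ?_
    exact congrArg (· ≫ _) (id_tensorHom _ _).symm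

instance : (functor μ U).Monoidal := (core μ U).toMonoidal

instance : (functor μ U).Braided where
  braided X Y := by
    apply IsoPair.hom_ext
    exact Functor.LaxBraided.braided (F := StdFunctor.functor μ R) X Y

end DisplayOf

/-- The Tannakian display `D_U`, `V ↦ (V ⊗ W(R)^⊕, F_U)`. -/
@[simps] def displayOf (U : Pts ℤ_[p] A (WittOver p k R)) : TannakianDisplay p k A R where
  functor := DisplayOf.functor μ U
  exact := StdFunctor.map_exact μ R

/-- The underlying graded fiber functor of `D_U` is `C_μ`. -/
def displayOfIso (U : Pts ℤ_[p] A (WittOver p k R)) :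
    (displayOf μ U).toGradedFiberFunctor ≅ stdFunctor μ R :=
  have hε : ε ((displayOf μ U).toGradedFiberFunctor).functor = ε (stdFunctor μ R).functor := by
    change ε (DisplayOf.functor μ U ⋙ Disp.forget p k R) = ε (StdFunctor.functor μ R)
    rw [Functor.LaxMonoidal.comp_ε]
    exact Category.id_comp _
  have hμ (X Y : FreeRep ℤ_[p] A) :
      Functor.LaxMonoidal.μ ((displayOf μ U).toGradedFiberFunctor).functor X Y =
        Functor.LaxMonoidal.μ (stdFunctor μ R).functor X Y := by
    change Functor.LaxMonoidal.μ (DisplayOf.functor μ U ⋙ Disp.forget p k R) X Y =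
      Functor.LaxMonoidal.μ (StdFunctor.functor μ R) X Y
    rw [Functor.LaxMonoidal.comp_μ]
    exact Category.id_comp _
  { hom :=
      { nat :=
          { app X := 𝟙 ((StdFunctor.functor μ R).obj X)
            naturality X Y f := (Category.comp_id _).trans (Category.id_comp _).symm }
        isMonoidal :=
          { unit := (Category.comp_id _).trans hε
            tensor X Y := (Category.comp_id _).trans ((hμ X Y).trans
              ((congrArg (· ≫ _) (id_tensorHom_id _ _)).trans (Category.id_comp _)).symm) } }
    inv :=
      { nat :=
          { app X := 𝟙 ((StdFunctor.functor μ R).obj X)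
            naturality X Y f := (Category.comp_id _).trans (Category.id_comp _).symm }
        isMonoidal :=
          { unit := (Category.comp_id _).trans hε.symm
            tensor X Y := (Category.comp_id _).trans ((hμ X Y).symm.trans
              ((congrArg (· ≫ _) (id_tensorHom_id _ _)).trans (Category.id_comp _)).symm) } }
    hom_inv_id := by
      apply ExactTensorFunctor.hom_ext
      apply NatTrans.ext
      funext X
      exact Category.id_comp _
    inv_hom_id := by
      apply ExactTensorFunctor.hom_ext
      apply NatTrans.ext
      funext X
      exact Category.id_comp _ }

end DisplayOfPoint

/-! ### Base change and type -/

section BaseChange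

variable (p : ℕ) [hp : Fact p.Prime] (k : Type*) {R R' : Type*} [CommRing R] [CommRing R']

/-- The homomorphism `W(R)^⊕_n → W(R')^⊕_n` induced by `R → R'`. -/
def wittPieceMap (φ : R →+* R') (n : ℤ) : wittPiece p R n →+ wittPiece p R' n where
  toFun x := ⟨(WittVector.map φ x.1.1, WittVector.map φ x.1.2), by
    rcases le_or_gt n 0 with hn | hn
    · have h := x.2
      rw [mem_wittPiece_nonpos hn] at h ⊢
      change WittVector.map φ x.1.2 = _ * WittVector.frobenius (WittVector.map φ x.1.1)
      rw [h, map_mul, map_pow, map_natCast, map_frobenius_comm]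
    · have h := x.2
      rw [mem_wittPiece_pos hn] at h ⊢
      change WittVector.map φ x.1.1 = _ * WittVector.verschiebung (WittVector.map φ x.1.2)
      rw [h, map_mul, map_pow, map_natCast, WittVector.map_verschiebung]⟩
  map_zero' := Subtype.ext (Prod.ext (map_zero _) (map_zero _))
  map_add' _ _ := Subtype.ext (Prod.ext (map_add _ _ _) (map_add _ _ _))

/-- The homomorphism `W(R)^⊕ → W(R')^⊕` induced by `R → R'`. -/
def WittGr.map (φ : R →+* R') : WittGr p k R →+* WittGr p k R' :=
  WittGr.lift p k R (fun n => (WittGr.of p k R' n).comp (wittPieceMap p φ n))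
    (by
      change WittGr.of p k R' 0 _ = 1
      rw [WittGr.one_def]
      congr 1
      exact Subtype.ext (Prod.ext (map_one _) (map_one _)))
    (by
      intro n m x y
      change WittGr.of p k R' (n + m) _ = WittGr.of p k R' n _ * WittGr.of p k R' m _
      rw [WittGr.of_mul_of]
      congr 1
      exact Subtype.ext (Prod.ext (map_mul _ _ _) (map_mul _ _ _)))

theorem WittGr.map_of (φ : R →+* R') (n : ℤ) (x : wittPiece p R n) :
    WittGr.map p k φ (WittGr.of p k R n x) = WittGr.of p k R' n (wittPieceMap p φ n x) :=
  WittGr.lift_of p k R _ _ _ n x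

theorem WittGr.map_id : WittGr.map p k (RingHom.id R) = RingHom.id (WittGr p k R) := by
  refine RingHom.ext fun x => ?_
  induction x using WittGr.induction with
  | h0 => simp
  | hof n x =>
    rw [WittGr.map_of]
    refine congrArg (WittGr.of p k R n) (Subtype.ext (Prod.ext ?_ ?_))
    · change WittVector.map (RingHom.id R) x.1.1 = x.1.1
      ext; simp
    · change WittVector.map (RingHom.id R) x.1.2 = x.1.2
      ext; simp
  | hadd x y hx hy => rw [map_add, map_add, hx, hy]

end BaseChange

section OfType

variable {p : ℕ} [hp : Fact p.Prime] {k : Type*} [Field k] [CharP k p] [PerfectRing k p]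
  {A : Type*} [CommRing A] [HopfAlgebra ℤ_[p] A]
  (μ : (WittVector p k ⊗[ℤ_[p]] A) →ₐc[WittVector p k] (WittVector p k)[T;T⁻¹])
  {R : Type r} [CommRing R] [Algebra (WittVector p k) R]

variable (p k) in
/-- The functor which sends a graded `W(R)^⊕`-module `M` to the underlying module of its base change
`M ⊗_{W(R)^⊕} W(R')^⊕`. -/
abbrev pullModule {R R' : Type r} [CommRing R] [CommRing R'] (φ : R →+* R') :
    PGrMod p k R ⥤ ModuleCat.{r} (WittGr p k R') :=
  GrProj.forget ⋙ ModuleCat.extendScalars (WittGr.map p k φ)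

/-- The canonical map `M → M ⊗_{W(R)^⊕} W(R')^⊕`. -/
def toPull {R R' : Type r} [CommRing R] [CommRing R'] (φ : R →+* R') (X : PGrMod p k R) (m : X.M) :
    (pullModule p k φ).obj X :=
  letI := (WittGr.map p k φ).toAlgebra
  (1 : WittGr p k R') ⊗ₜ[WittGr p k R] m

/-- A graded fiber functor `F` over `W(R)^⊕` is of type `μ` if for some faithfully flat `R → R'` its
base change to `W(R')^⊕` is isomorphic to `C_μ`: there is an isomorphism of tensor functors
`F(V) ⊗ W(R')^⊕ ≅ V ⊗ W(R')^⊕` which respects the gradings. -/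
def IsOfType (F : GradedFiberFunctor p k A R) : Prop :=
  ∃ (R' : Type r) (_ : CommRing R') (_ : Algebra (WittVector p k) R') (_ : Algebra R R')
    (_ : IsScalarTower (WittVector p k) R R') (_ : Module.FaithfullyFlat R R')
    (e : F.functor ⋙ pullModule p k (algebraMap R R') ≅ StdFunctor.functor μ R' ⋙ GrProj.forget),
    NatTrans.IsMonoidal e.hom ∧
      ∀ (X : FreeRep ℤ_[p] A) (l : ℤ), ∀ m ∈ (F.functor.obj X).piece l,
        (e.hom.app X).hom (toPull (algebraMap R R') (F.functor.obj X) m) ∈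
          (StdFunctor.obj μ R' X).piece l

/-- `C_μ` is compatible with base change. -/
def stdPullIso {R' : Type r} [CommRing R'] [Algebra (WittVector p k) R'] (φ : R →+* R')
    (h : ∀ x : ℤ_[p], WittGr.map p k φ (algebraMap _ _ x) = algebraMap _ _ x) :
    StdFunctor.functor (A := A) μ R ⋙ pullModule p k φ ≅ StdFunctor.functor μ R' ⋙ GrProj.forget :=
  NatIso.ofComponents (fun X => cancelAlong (WittGr.map p k φ) h X)
    (fun f => cancelAlong_naturality h f)

open Functor.LaxMonoidal Functor.OplaxMonoidal Functor.Monoidal in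
theorem stdPullIso_isMonoidal {R' : Type r} [CommRing R'] [Algebra (WittVector p k) R']
    (φ : R →+* R') (h : ∀ x : ℤ_[p], WittGr.map p k φ (algebraMap _ _ x) = algebraMap _ _ x) :
    NatTrans.IsMonoidal (stdPullIso (A := A) μ φ h).hom where
  unit := by
    have h1 := cancelAlong_unit (A := A) (WittGr.map p k φ) h
    have e1 : ε (StdFunctor.functor (A := A) μ R ⋙ pullModule p k φ) =
        ε (ModuleCat.extendScalars.{r, r, r} (WittGr.map p k φ)) ≫
          (ModuleCat.extendScalars.{r, r, r} (WittGr.map p k φ)).map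
            (ModuleCat.ofHom (unitX ℤ_[p] A (WittGr p k R)).toLinearMap) := by
      rw [Functor.LaxMonoidal.comp_ε, Functor.LaxMonoidal.comp_ε]
      refine congrArg₂ (· ≫ ·) ?_ rfl
      exact (congrArg (_ ≫ ·) (CategoryTheory.Functor.map_id _ _)).trans (Category.comp_id _)
    have e2 : ε (StdFunctor.functor (A := A) μ R' ⋙ GrProj.forget) =
        ModuleCat.ofHom (unitX ℤ_[p] A (WittGr p k R')).toLinearMap := by
      rw [Functor.LaxMonoidal.comp_ε]
      exact Category.id_comp _
    rw [e1, e2]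
    refine (Category.assoc _ _ _).trans ((congrArg (_ ≫ ·) h1).trans ?_)
    rw [ε_η_assoc]
  tensor X Y := by
    have h1 := cancelAlong_mul (A := A) (WittGr.map p k φ) h X Y
    have e1 : Functor.LaxMonoidal.μ (StdFunctor.functor (A := A) μ R ⋙ pullModule p k φ) X Y =
        Functor.LaxMonoidal.μ (ModuleCat.extendScalars.{r, r, r} (WittGr.map p k φ))
          (GrProj.forget.obj (StdFunctor.obj μ R X)) (GrProj.forget.obj (StdFunctor.obj μ R Y)) ≫
          (ModuleCat.extendScalars.{r, r, r} (WittGr.map p k φ)).map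
            (mulHom X Y (WittGr p k R)) := by
      rw [Functor.LaxMonoidal.comp_μ, Functor.LaxMonoidal.comp_μ]
      refine congrArg₂ (· ≫ ·) ?_ rfl
      exact (congrArg (_ ≫ ·) (CategoryTheory.Functor.map_id _ _)).trans (Category.comp_id _)
    have e2 : Functor.LaxMonoidal.μ (StdFunctor.functor (A := A) μ R' ⋙ GrProj.forget) X Y =
        mulHom X Y (WittGr p k R') := by
      rw [Functor.LaxMonoidal.comp_μ]
      exact Category.id_comp _
    rw [e1, e2]
    refine (Category.assoc _ _ _).trans ((congrArg (_ ≫ ·) h1).trans ?_)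
    exact μ_δ_assoc _ _ _ _

theorem cancelBaseChange_one_tmul {O S B V : Type*} [CommRing O] [CommRing S] [CommRing B]
    [Algebra O S] [Algebra O B] [Algebra S B] [IsScalarTower O S B] [AddCommGroup V] [Module O V]
    (z : S ⊗[O] V) : AlgebraTensorModule.cancelBaseChange O S B B V (1 ⊗ₜ z) =
      (IsScalarTower.toAlgHom O S B).toLinearMap.rTensor V z := by
  induction z with
  | zero => simp
  | add x y hx hy => rw [TensorProduct.tmul_add, map_add, hx, hy, map_add]
  | tmul s v =>
    rw [AlgebraTensorModule.cancelBaseChange_tmul, LinearMap.rTensor_tmul, Algebra.smul_def, mul_one]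
    rfl

theorem cancelAlong_one_tmul {O : Type} [CommRing O] {A : Type*} [CommRing A] [HopfAlgebra O A]
    {S B : Type r} [CommRing S] [CommRing B] [Algebra O S] [Algebra O B] (φ : S →+* B)
    (hφ : ∀ x : O, φ (algebraMap O S x) = algebraMap O B x) (X : FreeRep O A) (z : S ⊗[O] X.V) :
    letI := φ.toAlgebra
    (cancelAlong φ hφ X).hom.hom ((1 : B) ⊗ₜ[S] z) =
      ({ φ with commutes' := hφ } : S →ₐ[O] B).toLinearMap.rTensor X.V z := by
  let _ := φ.toAlgebra
  have : IsScalarTower O S B := IsScalarTower.of_algebraMap_eq fun x => (hφ x).symm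
  exact cancelBaseChange_one_tmul z

theorem cancelAlong_id {O : Type} [CommRing O] {A : Type*} [CommRing A] [HopfAlgebra O A]
    {S : Type r} [CommRing S] [Algebra O S] (φ : S →+* S)
    (hφ : ∀ x : O, φ (algebraMap O S x) = algebraMap O S x) (h : φ = RingHom.id S)
    (X : FreeRep O A) (z : S ⊗[O] X.V) :
    (cancelAlong φ hφ X).hom.hom (letI := φ.toAlgebra; (1 : S) ⊗ₜ[S] z) = z := by
  refine (cancelAlong_one_tmul φ hφ X z).trans ?_
  have h2 : ({ φ with commutes' := hφ } : S →ₐ[O] S).toLinearMap = LinearMap.id := by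
    refine LinearMap.ext fun x => ?_
    exact RingHom.congr_fun h x
  rw [h2, LinearMap.rTensor_id, LinearMap.id_apply]

theorem isOfType_std : IsOfType μ (stdFunctor (A := A) μ R) := by
  have hid : WittGr.map p k (algebraMap R R) = RingHom.id _ := WittGr.map_id p k
  have h : ∀ x : ℤ_[p], WittGr.map p k (algebraMap R R) (algebraMap _ _ x) = algebraMap _ _ x := by
    intro x
    rw [hid, RingHom.id_apply]
  refine ⟨R, inferInstance, inferInstance, Algebra.id R, inferInstance, inferInstance,
    stdPullIso μ (algebraMap R R) h, stdPullIso_isMonoidal μ (algebraMap R R) h, ?_⟩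
  intro X l m hm
  have := cancelAlong_id (WittGr.map p k (algebraMap R R)) h hid X m
  change (cancelAlong (WittGr.map p k (algebraMap R R)) h X).hom.hom _ ∈ _
  exact this.symm ▸ hm

theorem IsOfType.of_iso {F G : GradedFiberFunctor p k A R} (i : F ≅ G) (hG : IsOfType μ G) :
    IsOfType μ F := by
  obtain ⟨R', _, _, _, _, _, e, he, hd⟩ := hG
  let j : F.functor ≅ G.functor :=
    { hom := i.hom.nat
      inv := i.inv.nat
      hom_inv_id := congrArg ExactTensorFunctor.Hom.nat i.hom_inv_id
      inv_hom_id := congrArg ExactTensorFunctor.Hom.nat i.inv_hom_id }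
  have hj : NatTrans.IsMonoidal j.hom := i.hom.isMonoidal
  refine ⟨R', inferInstance, inferInstance, inferInstance, inferInstance, inferInstance,
    Functor.isoWhiskerRight j (pullModule p k (algebraMap R R')) ≪≫ e, ?_, ?_⟩
  · have : NatTrans.IsMonoidal
        (Functor.isoWhiskerRight j (pullModule p k (algebraMap R R'))).hom :=
      inferInstanceAs (NatTrans.IsMonoidal
        (Functor.whiskerRight j.hom (pullModule p k (algebraMap R R'))))
    exact inferInstanceAs (NatTrans.IsMonoidal (_ ≫ e.hom))
  · intro X l m hm
    exact hd X l _ ((j.hom.app X).map_mem l m hm)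

end OfType

/-! ### Banal displays -/

section Banal

variable {p : ℕ} [hp : Fact p.Prime] {k : Type*} [Field k] [CharP k p] [PerfectRing k p]
  {A : Type*} [CommRing A] [HopfAlgebra ℤ_[p] A]
  (μ : (WittVector p k ⊗[ℤ_[p]] A) →ₐc[WittVector p k] (WittVector p k)[T;T⁻¹])
  {R : Type r} [CommRing R] [Algebra (WittVector p k) R]

/-- A Tannakian `(G, μ)`-display is a Tannakian `G`-display whose underlying graded fiber functor is of
type `μ`. -/
def IsMuDisplay (D : TannakianDisplay p k A R) : Prop := IsOfType μ D.toGradedFiberFunctor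

/-- A Tannakian `(G, μ)`-display is banal if its underlying graded fiber functor is isomorphic to
`C_μ`. -/
def IsBanal (D : TannakianDisplay p k A R) : Prop :=
  Nonempty (D.toGradedFiberFunctor ≅ stdFunctor μ R)

variable (R) in
/-- The category of banal Tannakian `(G, μ)`-displays over `R`. -/
abbrev BanalDisplay :=
  ObjectProperty.FullSubcategory fun D : TannakianDisplay p k A R => IsMuDisplay μ D ∧ IsBanal μ D

/-- `D_U` as a banal Tannakian `(G, μ)`-display. -/
def banalOf (U : Pts ℤ_[p] A (WittOver p k R)) : BanalDisplay μ R where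
  obj := displayOf μ U
  property := ⟨IsOfType.of_iso μ (displayOfIso μ U) (isOfType_std μ), ⟨displayOfIso μ U⟩⟩

variable (R) in
/-- The display group `L⁺_μ G(R)`: the points `g : Spec W(R)^⊕ → G` which are equivariant for the
action of `𝔾_m` on `Spec W(R)^⊕` given by the grading, and the action `g · λ = μ(λ)⁻¹ g μ(λ)` on `G`.
This is expressed through the universal point `λ = T` of `𝔾_m` with values in `W(R)^⊕[T, T⁻¹]`. -/
def displayGroup : Subgroup (Pts ℤ_[p] A (WittGr p k R)) :=
  MonoidHom.eqLocus (Pts.map (gradingCoaction p k R))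
    ((MulAut.conj (cochar μ (univT (WittVector p k) (WittGr p k R)))⁻¹).toMonoidHom.comp
      (Pts.map (cst ℤ_[p] (WittGr p k R))))

theorem mem_displayGroup {g : Pts ℤ_[p] A (WittGr p k R)} :
    g ∈ displayGroup μ R ↔ Pts.map (gradingCoaction p k R) g =
      (cochar μ (univT (WittVector p k) (WittGr p k R)))⁻¹ * Pts.map (cst ℤ_[p] _) g *
        cochar μ (univT (WittVector p k) (WittGr p k R)) := by
  have h : ∀ a b : Pts ℤ_[p] A (WittGr p k R)[T;T⁻¹], MulAut.conj a⁻¹ b = a⁻¹ * b * a := by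
    intro a b
    rw [MulAut.conj_apply, inv_inv]
  rw [← h]
  rfl

/-- The objects of the groupoid `[L⁺G / L⁺_μ G]^pre(R)`: the elements of `L⁺G(R) = G(W(R))`. The
cocharacter `μ` enters only in the morphisms. -/
structure PreQuotient
    (_μ : (WittVector p k ⊗[ℤ_[p]] A) →ₐc[WittVector p k] (WittVector p k)[T;T⁻¹])
    (R : Type r) [CommRing R] [Algebra (WittVector p k) R] where
  /-- the point of `L⁺G(R)` -/
  pt : Pts ℤ_[p] A (WittOver p k R)

namespace PreQuotient

/-- The morphisms `U → U'`: the `h ∈ L⁺_μ G(R)` with `τ(h)⁻¹ U' σ(h) = U`. -/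
@[ext]
structure Hom (U U' : PreQuotient μ R) where
  /-- the element of `L⁺_μ G(R)` -/
  elt : displayGroup μ R
  eq : (Pts.map (tauAlg p k R) elt.1)⁻¹ * U'.pt * Pts.map (sigmaAlg p k R) elt.1 = U.pt

instance : Groupoid (PreQuotient μ R) where
  Hom U U' := Hom μ U U'
  id U := ⟨1, by simp⟩
  comp f g := ⟨g.elt * f.elt, by
    rw [← f.eq, ← g.eq]
    simp only [Subgroup.coe_mul, map_mul, mul_inv_rev, mul_assoc]⟩
  id_comp f := Hom.ext (mul_one _)
  comp_id f := Hom.ext (one_mul _)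
  assoc f g h := Hom.ext (mul_assoc _ _ _).symm
  inv f := ⟨f.elt⁻¹, by
    rw [← f.eq]
    simp only [Subgroup.coe_inv, map_inv, inv_inv, mul_assoc, mul_inv_cancel, mul_one,
      mul_inv_cancel_left]⟩
  inv_comp f := Hom.ext (mul_inv_cancel _)
  comp_inv f := Hom.ext (inv_mul_cancel _)

end PreQuotient

end Banal

end GDisplay

end

/-! The theorem is Tannakian reconstruction, used twice. For every `ℤ_p`-algebra `B`, the tensor
endomorphisms of the fiber functor `V ↦ B ⊗ V` are exactly the points of `G(B)`: existence is
`FreeRep.exists_pts_of_tensor`, uniqueness is `FreeRep.pts_ext`. In particular such endomorphisms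
are automatically invertible.

Reconstruction rests on local finiteness. Since `ℤ_p` is a principal ideal domain and `A` is flat,
every finitely generated submodule of `A` lies in a subcomodule that is finite free
(`FreeRep.exists_rep_of_fg`). So every function `a` on `G` is a matrix coefficient of a
representation `Z ⊆ A`, and an endomorphism `θ` of the fiber functor yields the value `g(a) =
ε(θ_Z(1 ⊗ a))`, where `ε` is the counit. Any two choices of `Z` sit in a common larger one, so
naturality makes `g` well defined. Compatibility of `θ` with tensor products makes `g`
multiplicative, because multiplication in `A` restricts to an equivariant map `Z ⊗ Z → A`.

For `B = W(R)^⊕` this describes the morphisms `D_U → D_{U'}`. The underlying linear maps are the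
action of a unique `h ∈ G(W(R)^⊕)`, and the two remaining conditions become conditions on `h`.
Preservation of degrees says that `h` lies in the display group
(`FreeRep.equivariant_iff_map_muPiece`), because an element `z` has degree `l` if and only if `μ(T)`
applied to the coaction of `z` equals `T^l z`. Compatibility with the Frobenius maps says `τ(h) U =
U' σ(h)` (`frobIso_act_iff`). This is full faithfulness.

For `B = W(R)` it gives essential surjectivity. An isomorphism of the underlying graded fiber
functor of `D` with `C_μ` carries the Frobenius of `D` to a tensor compatible family of maps `(V ⊗
W(R)^⊕)^σ → (V ⊗ W(R)^⊕)^τ`. Both sides are canonically `V ⊗ W(R)`, so the family is a tensor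
endomorphism of the fiber functor over `W(R)`, that is, a point `U` (`exists_frobIso`), and `D` is
isomorphic to `D_U`. -/

open CategoryTheory MonoidalCategory TensorProduct
open scoped LaurentPolynomial

noncomputable section

namespace GDisplay

set_option linter.unusedSectionVars false

universe r

/-! ### Tannakian reconstruction over a principal ideal domain -/

section Reconstruction

variable {O : Type} [CommRing O] {A : Type*} [CommRing A] [HopfAlgebra O A]

namespace FreeRep

/-- A linear map from a representation to the regular representation `A` is equivariant. -/
def IsRegularMap (X : FreeRep O A) (f : X.V →ₗ[O] A) : Prop :=
  (Coalgebra.comul : A →ₗ[O] A ⊗[O] A) ∘ₗ f = f.rTensor A ∘ₗ X.coact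

theorem IsRegularMap.comul_apply {X : FreeRep O A} {f : X.V →ₗ[O] A} (hf : X.IsRegularMap f)
    (v : X.V) : (Coalgebra.comul : A →ₗ[O] A ⊗[O] A) (f v) = f.rTensor A (X.coact v) :=
  LinearMap.congr_fun hf v

/-- The matrix coefficients `v ↦ (φ ⊗ id)(coact v)` attached to a functional `φ`. -/
def matrixCoeff (X : FreeRep O A) (φ : X.V →ₗ[O] O) : X.V →ₗ[O] A :=
  (TensorProduct.lid O A).toLinearMap ∘ₗ φ.rTensor A ∘ₗ X.coact

/-- This is coassociativity of the coaction with `φ` applied to the factor `V`. Together with the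
next two lemmas it gives Frobenius reciprocity: `φ ↦ X.matrixCoeff φ` and `f ↦ ε ∘ f` are inverse
bijections between the dual of `V` and the equivariant maps from `V` to the regular representation.
-/
theorem isRegularMap_matrixCoeff (X : FreeRep O A) (φ : X.V →ₗ[O] O) :
    X.IsRegularMap (X.matrixCoeff φ) := by
  refine LinearMap.ext fun v => ?_
  have h := LinearMap.congr_fun X.coassoc v
  simp only [LinearMap.comp_apply, LinearEquiv.coe_coe, matrixCoeff] at h ⊢
  have h1 : ∀ z : X.V ⊗[O] A, (Coalgebra.comul : A →ₗ[O] A ⊗[O] A)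
      (TensorProduct.lid O A (φ.rTensor A z)) = TensorProduct.lid O (A ⊗[O] A)
        (φ.rTensor (A ⊗[O] A) ((Coalgebra.comul : A →ₗ[O] A ⊗[O] A).lTensor X.V z)) := by
    intro z
    induction z with
    | zero => simp
    | add x y hx hy => simp only [map_add, hx, hy]
    | tmul v a => simp
  have h2 : ∀ z : X.V ⊗[O] A, (X.matrixCoeff φ).rTensor A z = TensorProduct.lid O (A ⊗[O] A)
        (φ.rTensor (A ⊗[O] A) (TensorProduct.assoc O X.V A A (X.coact.rTensor A z))) := by
    intro z
    induction z with
    | zero => simp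
    | add x y hx hy => simp only [map_add, hx, hy]
    | tmul v a =>
      simp only [LinearMap.rTensor_tmul, matrixCoeff, LinearMap.comp_apply, LinearEquiv.coe_coe]
      generalize X.coact v = y
      induction y with
      | zero => simp
      | add x y hx hy => simp only [map_add, TensorProduct.add_tmul, hx, hy]
      | tmul u c => simp [TensorProduct.smul_tmul']
  rw [h1, ← h, ← h2]
  rfl

/-- One half of Frobenius reciprocity, from the counit axiom of the comodule `V`. -/
theorem counit_matrixCoeff (X : FreeRep O A) (φ : X.V →ₗ[O] O) (v : X.V) :
    Coalgebra.counit (R := O) (X.matrixCoeff φ v) = φ v := by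
  have h := congrArg φ (LinearMap.congr_fun X.counit v)
  simp only [LinearMap.comp_apply, LinearEquiv.coe_coe, LinearMap.id_apply] at h
  rw [← h, matrixCoeff, LinearMap.comp_apply, LinearMap.comp_apply, LinearEquiv.coe_coe]
  generalize X.coact v = z
  induction z with
  | zero => simp
  | add x y hx hy => simp only [map_add, hx, hy]
  | tmul u c => simp [mul_comm]

/-- The other half of Frobenius reciprocity, from the counit axiom of the coalgebra `A`. -/
theorem IsRegularMap.eq_matrixCoeff {X : FreeRep O A} {f : X.V →ₗ[O] A} (hf : X.IsRegularMap f) :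
    f = X.matrixCoeff ((Coalgebra.counit : A →ₗ[O] O) ∘ₗ f) := by
  refine LinearMap.ext fun v => ?_
  have h := congrArg (TensorProduct.lid O A) (Coalgebra.rTensor_counit_comul (R := O) (f v))
  rw [hf.comul_apply, TensorProduct.lid_tmul, one_smul, ← LinearMap.comp_apply,
    ← LinearMap.rTensor_comp] at h
  exact h.symm

/-! #### Local finiteness of the regular representation -/

/-- A free module of finite rank embedded in `A` and stable under the coaction. -/
theorem exists_rep_of_stable [Module.Flat O A] (V : Type) [AddCommGroup V] [Module O V]
    [Module.Free O V] [Module.Finite O V] (j : V →ₗ[O] A) (hj : Function.Injective j)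
    (h : ∀ v, (Coalgebra.comul : A →ₗ[O] A ⊗[O] A) (j v) ∈ LinearMap.range (j.rTensor A)) :
    ∃ (Z : FreeRep O A) (f : Z.V →ₗ[O] A), Function.Injective f ∧ Z.IsRegularMap f ∧
      LinearMap.range f = LinearMap.range j := by
  -- Flatness of `A` and of `A ⊗ A` keeps `j` injective after tensoring. Hence the restriction of
  -- the comultiplication lifts uniquely to a coaction `c` on `V`, and an identity in `V ⊗ A ⊗ A`
  -- may be checked in `A ⊗ A ⊗ A`.
  have hjA : Function.Injective (j.rTensor A) :=
    Module.Flat.rTensor_preserves_injective_linearMap j hj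
  have hjAA : Function.Injective (j.rTensor (A ⊗[O] A)) :=
    Module.Flat.rTensor_preserves_injective_linearMap j hj
  let c : V →ₗ[O] V ⊗[O] A := (LinearEquiv.ofInjective _ hjA).symm.toLinearMap ∘ₗ
    ((Coalgebra.comul : A →ₗ[O] A ⊗[O] A) ∘ₗ j).codRestrict _ h
  have hc : ∀ v, j.rTensor A (c v) = (Coalgebra.comul : A →ₗ[O] A ⊗[O] A) (j v) := by
    intro v
    have := LinearEquiv.apply_symm_apply (LinearEquiv.ofInjective _ hjA)
      (((Coalgebra.comul : A →ₗ[O] A ⊗[O] A) ∘ₗ j).codRestrict _ h v)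
    exact congrArg Subtype.val this
  refine ⟨{ V := V, coact := c, coassoc := ?_, counit := ?_ }, j, hj,
    LinearMap.ext fun v => (hc v).symm, rfl⟩
  · refine LinearMap.ext fun v => hjAA ?_
    simp only [LinearMap.comp_apply, LinearEquiv.coe_coe]
    -- Under the embedding both sides of the coassociativity law for `c` become the two iterated
    -- comultiplications of `A`.
    have h1 : ∀ z : V ⊗[O] A, j.rTensor (A ⊗[O] A) (TensorProduct.assoc O V A A (c.rTensor A z)) =
        TensorProduct.assoc O A A A ((Coalgebra.comul : A →ₗ[O] A ⊗[O] A).rTensor A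
          (j.rTensor A z)) := by
      intro z
      induction z with
      | zero => simp
      | add x y hx hy => simp only [map_add, hx, hy]
      | tmul v a =>
        simp only [LinearMap.rTensor_tmul, ← hc]
        generalize c v = y
        induction y with
        | zero => simp
        | add x y hx hy => simp only [map_add, TensorProduct.add_tmul, hx, hy]
        | tmul u c => simp
    have h2 : ∀ z : V ⊗[O] A, j.rTensor (A ⊗[O] A)
        ((Coalgebra.comul : A →ₗ[O] A ⊗[O] A).lTensor V z) =
        (Coalgebra.comul : A →ₗ[O] A ⊗[O] A).lTensor A (j.rTensor A z) := by
      intro z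
      simp only [← LinearMap.comp_apply, LinearMap.lTensor_comp_rTensor,
        LinearMap.rTensor_comp_lTensor]
    rw [h1, h2, hc, Coalgebra.coassoc_apply]
  · refine LinearMap.ext fun v => hj ?_
    simp only [LinearMap.comp_apply, LinearEquiv.coe_coe, LinearMap.id_apply]
    have h1 : ∀ z : V ⊗[O] A, j (TensorProduct.rid O V
        ((Coalgebra.counit : A →ₗ[O] O).lTensor V z)) =
        TensorProduct.rid O A ((Coalgebra.counit : A →ₗ[O] O).lTensor A (j.rTensor A z)) := by
      intro z
      induction z with
      | zero => simp
      | add x y hx hy => simp only [map_add, hx, hy]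
      | tmul v a => simp
    rw [h1, hc, Coalgebra.lTensor_counit_comul, TensorProduct.rid_tmul, one_smul]

/-- Local finiteness of the regular representation. The comultiplications of finitely many
generators involve only finitely many left tensor factors; these span a finite `F`, and the elements
whose comultiplication comes from `F ⊗ A` form a subcomodule contained in `F`. -/
theorem exists_rep_of_fg [IsDomain O] [IsPrincipalIdealRing O] [Module.Flat O A]
    (N : Submodule O A) (hN : N.FG) :
    ∃ (Z : FreeRep O A) (f : Z.V →ₗ[O] A), Function.Injective f ∧ Z.IsRegularMap f ∧
      N ≤ LinearMap.range f := by
  classical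
  obtain ⟨s, rfl⟩ := hN
  -- `F` is a finite submodule such that `F ⊗ A` has all comultiplications of the generators in its
  -- image.
  obtain ⟨F, hF, hsF⟩ := TensorProduct.exists_finite_submodule_left_of_setFinite
    ((Coalgebra.comul : A →ₗ[O] A ⊗[O] A) '' (s : Set A)) (s.finite_toSet.image _)
  -- By right exactness, the kernel of `ψ` consists of the `a` with `Δ(a)` in the image of `F ⊗ A`.
  -- It is the largest subcomodule of `A` inside `F` and will carry the representation.
  let ψ : A →ₗ[O] (A ⧸ F) ⊗[O] A := F.mkQ.rTensor A ∘ₗ (Coalgebra.comul : A →ₗ[O] A ⊗[O] A)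
  -- If `Δ(a)` comes from `F ⊗ A`, then so does `a = (id ⊗ ε)(Δ(a))` come from `F`.
  have hψF : LinearMap.ker ψ ≤ F := by
    intro a ha
    have h1 : ∀ z : A ⊗[O] A, TensorProduct.rid O (A ⧸ F)
        ((Coalgebra.counit : A →ₗ[O] O).lTensor (A ⧸ F) (F.mkQ.rTensor A z)) =
        F.mkQ (TensorProduct.rid O A ((Coalgebra.counit : A →ₗ[O] O).lTensor A z)) := by
      intro z
      induction z with
      | zero => simp
      | add x y hx hy => simp only [map_add, hx, hy]
      | tmul v a => simp
    have h2 := h1 ((Coalgebra.comul : A →ₗ[O] A ⊗[O] A) a)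
    rw [Coalgebra.lTensor_counit_comul, TensorProduct.rid_tmul, one_smul,
      show F.mkQ.rTensor A ((Coalgebra.comul : A →ₗ[O] A ⊗[O] A) a) = 0 from ha, map_zero,
      map_zero] at h2
    exact (Submodule.Quotient.mk_eq_zero F).mp h2.symm
  have hsψ : Submodule.span O (s : Set A) ≤ LinearMap.ker ψ := by
    rw [Submodule.span_le]
    intro a ha
    obtain ⟨z, hz⟩ := hsF ⟨a, ha, rfl⟩
    change F.mkQ.rTensor A ((Coalgebra.comul : A →ₗ[O] A ⊗[O] A) a) = 0
    rw [← hz, ← LinearMap.comp_apply, ← LinearMap.rTensor_comp]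
    have : F.mkQ ∘ₗ F.subtype = 0 := by ext x; simp
    rw [this, LinearMap.rTensor_zero, LinearMap.zero_apply]
  -- The kernel is finite as a submodule of the finite module `F` over a Noetherian ring, and then
  -- free, being torsion free over a principal ideal domain.
  have : Module.Finite O (LinearMap.ker ψ) :=
    Module.Finite.of_injective (Submodule.inclusion hψF) (Submodule.inclusion_injective hψF)
  have : Module.Free O (LinearMap.ker ψ) := inferInstance
  let e := (Module.finBasis O (LinearMap.ker ψ)).equivFun.symm
  let j : (Fin (Module.finrank O (LinearMap.ker ψ)) → O) →ₗ[O] A :=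
    (LinearMap.ker ψ).subtype ∘ₗ e.toLinearMap
  have hjr : LinearMap.range j = LinearMap.ker ψ := by
    rw [LinearMap.range_comp, LinearEquiv.range, Submodule.map_top, Submodule.range_subtype]
  have hj : Function.Injective j := Subtype.val_injective.comp e.injective
  have hex : Function.Exact j ψ := LinearMap.exact_iff.mpr hjr.symm
  have hexA := Module.Flat.rTensor_exact A hex
  -- As `A` is flat, the image of `ker ψ ⊗ A` in `A ⊗ A` is the kernel of `ψ ⊗ id`. Stability thus
  -- means that `ψ ⊗ id` kills `Δ(j v)`.
  obtain ⟨Z, f, h1, h2, h3⟩ := exists_rep_of_stable _ j hj (fun v => by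
    refine (hexA _).mp ?_
    have hv : ψ (j v) = 0 := (hex _).mpr ⟨v, rfl⟩
    -- Coassociativity gives `(ψ ⊗ id) ∘ Δ = (id ⊗ Δ) ∘ ψ` up to the associator, and the right side
    -- vanishes on the kernel of `ψ`.
    have h1 : ∀ z : A ⊗[O] A, ψ.rTensor A z = (TensorProduct.assoc O (A ⧸ F) A A).symm
        (F.mkQ.rTensor (A ⊗[O] A) (TensorProduct.assoc O A A A
          ((Coalgebra.comul : A →ₗ[O] A ⊗[O] A).rTensor A z))) := by
      intro z
      induction z with
      | zero => simp
      | add x y hx hy => simp only [map_add, hx, hy]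
      | tmul a b =>
        simp only [LinearMap.rTensor_tmul, ψ, LinearMap.comp_apply]
        generalize (Coalgebra.comul : A →ₗ[O] A ⊗[O] A) a = y
        induction y with
        | zero => simp
        | add x y hx hy => simp only [map_add, TensorProduct.add_tmul, hx, hy]
        | tmul u c => simp
    have h2 : ∀ z : A ⊗[O] A, F.mkQ.rTensor (A ⊗[O] A)
        ((Coalgebra.comul : A →ₗ[O] A ⊗[O] A).lTensor A z) =
        (Coalgebra.comul : A →ₗ[O] A ⊗[O] A).lTensor (A ⧸ F) (F.mkQ.rTensor A z) := by
      intro z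
      simp only [← LinearMap.comp_apply, LinearMap.lTensor_comp_rTensor,
        LinearMap.rTensor_comp_lTensor]
    rw [h1, Coalgebra.coassoc_apply, h2]
    change (TensorProduct.assoc O (A ⧸ F) A A).symm
      ((Coalgebra.comul : A →ₗ[O] A ⊗[O] A).lTensor (A ⧸ F) (ψ (j v))) = 0
    rw [hv, map_zero, map_zero])
  exact ⟨Z, f, h1, h2, by rw [h3, hjr]; exact hsψ⟩

/-- The factorization `j⁻¹ ∘ f` is equivariant because `j ⊗ A` is still injective, so that
equivariance can be tested inside `A ⊗ A`. It allows two equivariant maps to `A` from different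
representations to be compared inside one larger subrepresentation. -/
theorem exists_hom_of_range_le [Module.Flat O A] {X Z : FreeRep O A} {f : X.V →ₗ[O] A}
    (hf : X.IsRegularMap f) {j : Z.V →ₗ[O] A} (hj : Z.IsRegularMap j)
    (hji : Function.Injective j) (h : LinearMap.range f ≤ LinearMap.range j) :
    ∃ m : X ⟶ Z, ∀ v, j (m.lin v) = f v := by
  obtain ⟨m, hm⟩ : ∃ m : X.V →ₗ[O] Z.V, ∀ v, j (m v) = f v :=
    ⟨(LinearEquiv.ofInjective j hji).symm.toLinearMap ∘ₗ
      f.codRestrict _ fun v => h (LinearMap.mem_range_self f v), fun v => congrArg Subtype.val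
        (LinearEquiv.apply_symm_apply (LinearEquiv.ofInjective j hji)
          (f.codRestrict _ (fun v => h (LinearMap.mem_range_self f v)) v))⟩
  have hjm : j ∘ₗ m = f := LinearMap.ext hm
  refine ⟨⟨m, LinearMap.ext fun v =>
    Module.Flat.rTensor_preserves_injective_linearMap (M := A) j hji ?_⟩, hm⟩
  rw [LinearMap.comp_apply, LinearMap.comp_apply, ← hj.comul_apply, hm, hf.comul_apply,
    ← LinearMap.comp_apply (j.rTensor A), ← LinearMap.rTensor_comp, hjm]

/-- Equivariance of the product is multiplicativity of the comultiplication. The regular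
representation need not have finite rank, so the product of `A` enters the reconstruction only
through these maps on finite free representations. -/
theorem isRegularMap_tensor {X Y : FreeRep O A} {f : X.V →ₗ[O] A} (hf : X.IsRegularMap f)
    {g : Y.V →ₗ[O] A} (hg : Y.IsRegularMap g) :
    (tensor X Y).IsRegularMap (LinearMap.mul' O A ∘ₗ TensorProduct.map f g) := by
  apply TensorProduct.ext'
  intro v w
  change (Coalgebra.comul : A →ₗ[O] A ⊗[O] A) (f v * g w) =
    (LinearMap.mul' O A ∘ₗ TensorProduct.map f g).rTensor A
      (mulCoeff X.V Y.V A (X.coact v ⊗ₜ Y.coact w))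
  rw [Bialgebra.comul_mul, hf.comul_apply, hg.comul_apply]
  generalize X.coact v = x
  generalize Y.coact w = y
  induction x with
  | zero => simp
  | add x x' hx hx' => simp only [TensorProduct.add_tmul, map_add, add_mul, hx, hx']
  | tmul v a =>
    induction y with
    | zero => simp
    | add y y' hy hy' => simp only [TensorProduct.tmul_add, map_add, mul_add, hy, hy']
    | tmul w b => simp

/-- The structure map `O → A` as a map on the trivial representation. -/
def unitMap (O : Type) [CommRing O] (A : Type*) [CommRing A] [HopfAlgebra O A] :
    (unit : FreeRep O A).V →ₗ[O] A := Algebra.linearMap O A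

theorem unitMap_unitOne : unitMap O A unitOne = 1 := map_one (algebraMap O A)

theorem isRegularMap_unit : (unit : FreeRep O A).IsRegularMap (unitMap O A) := by
  apply LinearMap.ext_ring
  change (Coalgebra.comul : A →ₗ[O] A ⊗[O] A) (algebraMap O A 1) =
    (Algebra.linearMap O A).rTensor A ((1 : O) ⊗ₜ (1 : A))
  rw [map_one, Bialgebra.comul_one, LinearMap.rTensor_tmul, Algebra.linearMap_apply, map_one]
  rfl

/-! #### Reconstruction of a point from its action on all representations -/

variable {B : Type*} [CommRing B] [Algebra O B]

/-- The `B`-linear extension `B ⊗ V → B` of a functional on `V`. -/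
def extFunctional (B : Type*) [CommRing B] [Algebra O B] (X : FreeRep O A) (φ : X.V →ₗ[O] O) :
    B ⊗[O] X.V →ₗ[B] B :=
  (AlgebraTensorModule.rid O B B).toLinearMap ∘ₗ φ.baseChange B

theorem extFunctional_tmul (X : FreeRep O A) (φ : X.V →ₗ[O] O) (b : B) (v : X.V) :
    X.extFunctional B φ (b ⊗ₜ v) = φ v • b := by
  simp [extFunctional]

/-- The dictionary between points and their actions: the `φ`-coordinate of `g · v` is the value of
`g` at the matrix coefficient of `φ` and `v`. -/
theorem extFunctional_act (X : FreeRep O A) (φ : X.V →ₗ[O] O) (g : Pts O A B) (v : X.V) :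
    X.extFunctional B φ (X.act g (1 ⊗ₜ v)) = g.ofConv (X.matrixCoeff φ v) := by
  rw [act_tmul, one_smul, matrixCoeff, LinearMap.comp_apply, LinearMap.comp_apply]
  generalize X.coact v = z
  induction z with
  | zero => simp
  | add x y hx hy => simp only [map_add, hx, hy]
  | tmul u c => simp [extFunctional_tmul]

theorem extFunctional_hom {X Y : FreeRep O A} (f : X ⟶ Y) (φ : Y.V →ₗ[O] O) (z : B ⊗[O] X.V) :
    Y.extFunctional B φ (f.lin.lTensor B z) = X.extFunctional B (φ ∘ₗ f.lin) z := by
  induction z with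
  | zero => simp
  | add x y hx hy => simp only [map_add, hx, hy]
  | tmul u c => simp [extFunctional_tmul]

/-- The counit is multiplicative, so the functional belonging to the product map on `X ⊗ Y` is the
tensor product of the functionals belonging to `f` and `g`. This is what makes the reconstructed
point multiplicative. -/
theorem extFunctional_mulX {X Y : FreeRep O A} (f : X.V →ₗ[O] A) (g : Y.V →ₗ[O] A)
    (x : B ⊗[O] X.V) (y : B ⊗[O] Y.V) :
    (tensor X Y).extFunctional B ((Coalgebra.counit : A →ₗ[O] O) ∘ₗ LinearMap.mul' O A ∘ₗ
        TensorProduct.map f g) (mulX X Y B (x ⊗ₜ y)) =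
      X.extFunctional B ((Coalgebra.counit : A →ₗ[O] O) ∘ₗ f) x *
        Y.extFunctional B ((Coalgebra.counit : A →ₗ[O] O) ∘ₗ g) y := by
  induction x with
  | zero => simp
  | add x x' hx hx' => simp only [TensorProduct.add_tmul, map_add, add_mul, hx, hx']
  | tmul b v =>
    induction y with
    | zero => simp
    | add y y' hy hy' => simp only [TensorProduct.tmul_add, map_add, mul_add, hy, hy']
    | tmul b' w =>
      rw [mulX_tmul, extFunctional_tmul, extFunctional_tmul, extFunctional_tmul]
      change (Coalgebra.counit (R := O) (f v * g w)) • (b * b') = _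
      rw [Bialgebra.counit_mul, smul_mul_smul_comm]
      rfl

/-- Functionals on `V` separate the elements of `B ⊗ V`. -/
theorem ext_extFunctional (X : FreeRep O A) {z z' : B ⊗[O] X.V}
    (h : ∀ φ, X.extFunctional B φ z = X.extFunctional B φ z') : z = z' := by
  let b := Module.Free.chooseBasis O X.V
  apply (b.baseChange B).ext_elem
  intro i
  -- The coordinates in the base-changed basis are the extensions of the coordinate functionals, so
  -- these finitely many functionals already separate elements.
  have key : ∀ z : B ⊗[O] X.V, (b.baseChange B).repr z i = X.extFunctional B (b.coord i) z := by
    intro z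
    induction z with
    | zero => simp
    | add x y hx hy => simp only [map_add, Finsupp.add_apply, hx, hy]
    | tmul c v => rw [extFunctional_tmul, Module.Basis.baseChange_repr_tmul]; rfl
  rw [key, key, h]

/-- A point is determined by its action on all representations. -/
theorem pts_ext [IsDomain O] [IsPrincipalIdealRing O] [Module.Flat O A] {g g' : Pts O A B}
    (h : ∀ (X : FreeRep O A) (v : X.V), X.act g (1 ⊗ₜ v) = X.act g' (1 ⊗ₜ v)) : g = g' := by
  ext a
  obtain ⟨Z, f, -, hf, hZ⟩ := exists_rep_of_fg (Submodule.span O {a})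
    (Submodule.fg_span_singleton a)
  obtain ⟨v, hv⟩ := hZ (Submodule.mem_span_singleton_self a)
  -- Every `a` is a matrix coefficient of a finite free representation, hence its value under a
  -- point is read off from the action.
  rw [← hv, hf.eq_matrixCoeff]
  change g.ofConv _ = g'.ofConv _
  rw [← extFunctional_act, ← extFunctional_act, h]

/-- A tensor endomorphism of the fiber functor `V ↦ B ⊗ V` is given by a point of `G(B)`. -/
theorem exists_pts_of_tensor [IsDomain O] [IsPrincipalIdealRing O] [Module.Flat O A]
    (θ : ∀ X : FreeRep O A, B ⊗[O] X.V →ₗ[B] B ⊗[O] X.V)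
    (hnat : ∀ {X Y : FreeRep O A} (f : X ⟶ Y) (z : B ⊗[O] X.V),
      θ Y (f.lin.lTensor B z) = f.lin.lTensor B (θ X z))
    (hunit : θ unit (1 ⊗ₜ unitOne) = 1 ⊗ₜ unitOne)
    (htensor : ∀ (X Y : FreeRep O A) (v : X.V) (w : Y.V),
      θ (tensor X Y) (1 ⊗ₜ tm v w) = mulX X Y B (θ X (1 ⊗ₜ v) ⊗ₜ θ Y (1 ⊗ₜ w))) :
    ∃ g : Pts O A B, ∀ X, θ X = X.act g := by
  classical
  let ε : A →ₗ[O] O := Coalgebra.counit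
  -- The expected value of the point at `f v`: were `θ` the action of `g`, then `extFunctional_act`
  -- and Frobenius reciprocity would give `val X f v = g (f v)` for equivariant `f`.
  let val : ∀ (X : FreeRep O A) (_ : X.V →ₗ[O] A), X.V →ₗ[O] B := fun X f =>
    ((X.extFunctional B (ε ∘ₗ f) ∘ₗ θ X).restrictScalars O) ∘ₗ TensorProduct.mk O B X.V 1
  have hval : ∀ X f v, val X f v = X.extFunctional B (ε ∘ₗ f) (θ X (1 ⊗ₜ v)) :=
    fun _ _ _ => rfl
  -- Naturality of `θ` lets a value be computed after any morphism of representations through which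
  -- `f` factors.
  have hfac : ∀ {X Z : FreeRep O A} {f : X.V →ₗ[O] A} {j : Z.V →ₗ[O] A} (m : X ⟶ Z)
      (_ : ∀ v, j (m.lin v) = f v) (v : X.V), val X f v = val Z j (m.lin v) := by
    intro X Z f j m hm v
    have h1 : (1 : B) ⊗ₜ[O] m.lin v = m.lin.lTensor B (1 ⊗ₜ v) := by simp
    rw [hval, hval, h1, hnat, extFunctional_hom]
    congr 2
    ext v
    simp [hm]
  -- The value depends only on the element `f v = h w` of `A`. Both maps factor through one finite
  -- free `Z ⊆ A` containing their images, and since `Z` embeds in `A` the two vectors coincide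
  -- there.
  have hwd : ∀ {X Y : FreeRep O A} {f : X.V →ₗ[O] A} {h : Y.V →ₗ[O] A}
      (_ : X.IsRegularMap f) (_ : Y.IsRegularMap h) (v : X.V) (w : Y.V), f v = h w →
      val X f v = val Y h w := by
    intro X Y f h hf hh v w hvw
    obtain ⟨Z, j, hji, hj, hZ⟩ := exists_rep_of_fg (LinearMap.range f ⊔ LinearMap.range h)
      (Submodule.FG.sup (Module.Finite.iff_fg.mp inferInstance)
        (Module.Finite.iff_fg.mp inferInstance))
    obtain ⟨m, hm⟩ := exists_hom_of_range_le hf hj hji (le_sup_left.trans hZ)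
    obtain ⟨n, hn⟩ := exists_hom_of_range_le hh hj hji (le_sup_right.trans hZ)
    rw [hfac m hm, hfac n hn]
    congr 1
    apply hji
    rw [hm, hn, hvw]
  have hex : ∀ a : A, ∃ (Z : FreeRep O A) (j : Z.V →ₗ[O] A), Z.IsRegularMap j ∧ ∃ v, j v = a := by
    intro a
    obtain ⟨Z, f, -, hf, hZ⟩ := exists_rep_of_fg (Submodule.span O {a})
      (Submodule.fg_span_singleton a)
    exact ⟨Z, f, hf, hZ (Submodule.mem_span_singleton_self a)⟩
  choose Z j hj w hw using hex
  -- For each `a` one representation and one vector mapping to `a` are chosen. By `hwd` any other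
  -- choice gives the same value, which is recorded in `hg`.
  let g : A → B := fun a => val (Z a) (j a) (w a)
  have hg : ∀ {X : FreeRep O A} {f : X.V →ₗ[O] A} (_ : X.IsRegularMap f) (v : X.V),
      g (f v) = val X f v := fun hf v => hwd (hj _) hf _ _ (hw _)
  -- Two elements are realized in a single representation, so that sums and products can be computed
  -- there.
  have hg2 : ∀ a b : A, ∃ (X : FreeRep O A) (f : X.V →ₗ[O] A), X.IsRegularMap f ∧
      ∃ v v', f v = a ∧ f v' = b := by
    intro a b
    obtain ⟨Z, f, -, hf, hZ⟩ := exists_rep_of_fg (Submodule.span O {a, b})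
      (Submodule.fg_span (by simp))
    obtain ⟨v, hv⟩ := hZ (Submodule.subset_span (Set.mem_insert a {b}))
    obtain ⟨v', hv'⟩ := hZ (Submodule.subset_span (Set.mem_insert_of_mem a rfl))
    exact ⟨Z, f, hf, v, v', hv, hv'⟩
  have hg_one : g 1 = 1 := by
    have h1 := hg (isRegularMap_unit (O := O) (A := A)) unitOne
    rw [hval, hunit, extFunctional_tmul, LinearMap.comp_apply, unitMap_unitOne] at h1
    rw [h1, Bialgebra.counit_one, one_smul]
  have hg_add : ∀ a b, g (a + b) = g a + g b := by
    intro a b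
    obtain ⟨X, f, hf, v, v', rfl, rfl⟩ := hg2 a b
    rw [← map_add, hg hf, hg hf, hg hf, map_add]
  have hg_smul : ∀ (c : O) a, g (c • a) = c • g a := by
    intro c a
    rw [← hw a, ← map_smul, hg (hj a), hg (hj a), map_smul]
  have hg_mul : ∀ a b, g (a * b) = g a * g b := by
    intro a b
    obtain ⟨X, f, hf, v, v', rfl, rfl⟩ := hg2 a b
    -- The product `f v * f v'` is the value at `v ⊗ v'` of an equivariant map on `X ⊗ X`, where the
    -- hypothesis on tensor products applies.
    have h1 : g (f v * f v') = val (tensor X X) (LinearMap.mul' O A ∘ₗ TensorProduct.map f f)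
        (tm v v') := hg (isRegularMap_tensor hf hf) (tm v v')
    rw [hval, htensor, extFunctional_mulX] at h1
    rw [h1, hg hf, hg hf, hval, hval]
  let G : A →ₐ[O] B := AlgHom.ofLinearMap
    { toFun := g, map_add' := hg_add, map_smul' := hg_smul } hg_one hg_mul
  refine ⟨WithConv.toConv G, fun X => ?_⟩
  apply TensorProduct.AlgebraTensorModule.curry_injective
  ext v
  change θ X (1 ⊗ₜ v) = X.act _ (1 ⊗ₜ v)
  -- It remains to compare coordinates. The `φ`-coordinate of `θ (1 ⊗ v)` is `val` for the map
  -- `X.matrixCoeff φ`, because the counit turns that map back into `φ`.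
  apply X.ext_extFunctional
  intro φ
  rw [extFunctional_act]
  change _ = g (X.matrixCoeff φ v)
  rw [hg (X.isRegularMap_matrixCoeff φ), hval]
  congr 2
  ext v
  exact (X.counit_matrixCoeff φ v).symm

end FreeRep

end Reconstruction

/-! ### Equivariance under the cocharacter as preservation of degrees -/

section Equivariance

variable {O : Type} [CommRing O] {A : Type*} [CommRing A] [HopfAlgebra O A]
  {K : Type*} [CommRing K] [Algebra O K] (μ : (K ⊗[O] A) →ₐc[K] K[T;T⁻¹])
  {S : Type r} [CommRing S] [Algebra O S] [Algebra K S] [IsScalarTower O K S]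
  {𝒜 : ℤ → AddSubgroup S} [GradedRing 𝒜]

namespace FreeRep

/-- On a generator `s • v` with `s` of degree `a` and `v` of weight `i`, the coaction `γ`
contributes `T^a` and `μ(T)` contributes `T^i`, in total `T^(a+i)`. -/
theorem act_univT_of_mem_muPiece (X : FreeRep O A) (γ : S →ₐ[O] S[T;T⁻¹])
    (hγ : ∀ a, ∀ s ∈ 𝒜 a, γ s = LaurentPolynomial.C s * LaurentPolynomial.T a)
    (hK : ∀ x, algebraMap K S x ∈ 𝒜 0) {l : ℤ} {z : S ⊗[O] X.V} (hz : z ∈ X.muPiece μ 𝒜 l) :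
    X.act (cochar μ (univT K S)) (γ.toLinearMap.rTensor X.V z) =
      (LaurentPolynomial.T l : S[T;T⁻¹]) • X.cstT S z := by
  have hid : univT K K = AlgHom.id K K[T;T⁻¹] := by
    apply laurent_algHom_ext
    intro n
    rw [univT_T]
    rfl
  induction hz using AddSubgroup.closure_induction with
  | zero => simp
  | add x y _ _ hx hy => simp only [map_add, smul_add, hx, hy]
  | neg x _ hx => simp only [map_neg, smul_neg, hx]
  | mem z hz =>
    obtain ⟨a, b, rfl, s, hs, v, hv, rfl⟩ := hz
    rw [rTensor_smul, hγ a s hs]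
    -- Since `K` lies in degree `0`, the coaction is constant on it and agrees there with every
    -- `K`-algebra map. So `V_K` can be moved along `univT`, where the weight condition is known.
    have h1 : γ.toLinearMap.rTensor X.V (X.extT K S v) =
        ((univT K S).restrictScalars O).toLinearMap.rTensor X.V (X.cstT K v) := by
      simp only [← LinearMap.comp_apply, ← LinearMap.rTensor_comp]
      congr 2
      refine LinearMap.ext fun x => ?_
      have h2 := hγ 0 _ (hK x)
      rw [LaurentPolynomial.T_zero, mul_one] at h2
      exact h2.trans ((univT K S).commutes x).symm
    have h3 : ((univT K S).restrictScalars O).toLinearMap.rTensor X.V (X.cstT K v) =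
        X.cstT S (X.extT K S v) := by
      simp only [← LinearMap.comp_apply, ← LinearMap.rTensor_comp]
      congr 2
      exact LinearMap.ext fun x => (univT K S).commutes x
    have h4 : cochar μ (univT K S) =
        Pts.map ((univT K S).restrictScalars O) (cochar μ (univT K K)) := by
      rw [cochar_map, hid, AlgHom.comp_id]
    rw [h1, map_smul, h4, act_map, (X.mem_weightSpace μ).mp hv, rTensor_smul, h3]
    have h5 : univT K S (LaurentPolynomial.T b : K[T;T⁻¹]) = LaurentPolynomial.T b :=
      univT_T K S b
    rw [AlgHom.restrictScalars_apply, h5, mul_comm, smul_smul, mul_right_comm,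
      ← LaurentPolynomial.T_add, mul_smul,
      show (LaurentPolynomial.C s : S[T;T⁻¹]) = cst O S s from rfl, ← rTensor_smul]

/-- Degrees become an equation over `S[T;T⁻¹]`, of the same kind as the equation that defines
equivariant points. For the converse, taking the coefficient of `T^l` recovers the projection to
degree `l`. -/
theorem mem_muPiece_iff (X : FreeRep O A) (γ : S →ₐ[O] S[T;T⁻¹])
    (hγ : ∀ a, ∀ s ∈ 𝒜 a, γ s = LaurentPolynomial.C s * LaurentPolynomial.T a)
    (hK : ∀ x, algebraMap K S x ∈ 𝒜 0) {l : ℤ} {z : S ⊗[O] X.V} :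
    z ∈ X.muPiece μ 𝒜 l ↔ X.act (cochar μ (univT K S)) (γ.toLinearMap.rTensor X.V z) =
      (LaurentPolynomial.T l : S[T;T⁻¹]) • X.cstT S z := by
  refine ⟨X.act_univT_of_mem_muPiece μ γ hγ hK, fun hz => ?_⟩
  have hint := X.muPiece_isInternal μ γ hγ hK
  -- The coefficient of `T^l` in `μ(T) · γ(w)` is the component of `w` in degree `l`; by additivity
  -- this need only be seen for homogeneous `w`.
  have key : ∀ w : S ⊗[O] X.V, X.cfT S l (X.act (cochar μ (univT K S))
      (γ.toLinearMap.rTensor X.V w)) = internalProj hint l w := by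
    intro w
    induction w using internal_induction hint with
    | h0 => simp
    | hof i w hw =>
      rw [X.act_univT_of_mem_muPiece μ γ hγ hK hw, cfT_smul_cstT]
      split_ifs with h
      · subst h
        rw [internalProj_same hint hw]
      · rw [internalProj_ne hint hw h]
    | hadd x y hx hy => simp only [map_add, hx, hy]
  have h := key z
  rw [hz, cfT_smul_cstT, if_pos rfl] at h
  rw [h]
  exact internalProj_mem hint l z

/-- A point of `G(S)` is equivariant for the grading of `S` and the conjugation action through `μ`
if and only if its action on all representations preserves degrees. -/
theorem equivariant_iff_map_muPiece [IsDomain O] [IsPrincipalIdealRing O] [Module.Flat O A]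
    (γ : S →ₐ[O] S[T;T⁻¹])
    (hγ : ∀ a, ∀ s ∈ 𝒜 a, γ s = LaurentPolynomial.C s * LaurentPolynomial.T a)
    (hK : ∀ x, algebraMap K S x ∈ 𝒜 0) (h : Pts O A S) :
    Pts.map γ h = (cochar μ (univT K S))⁻¹ * Pts.map (cst O S) h * cochar μ (univT K S) ↔
      ∀ (X : FreeRep O A) (l : ℤ), ∀ z ∈ X.muPiece μ 𝒜 l, X.act h z ∈ X.muPiece μ 𝒜 l := by
  -- Without inverses the condition reads `μ(T) · γ(h) = h · μ(T)`. Applied to `γ(z)` with `z` of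
  -- degree `l`, the left side is `μ(T) · γ(h z)` and the right side is `T^l • h z`.
  rw [mul_assoc, eq_inv_mul_iff_mul_eq]
  constructor
  · intro hh X l z hz
    rw [X.mem_muPiece_iff μ γ hγ hK] at hz ⊢
    rw [← act_map, ← LinearMap.comp_apply, ← act_mul, hh, act_mul, LinearMap.comp_apply, hz,
      map_smul, act_map]
  · intro hh
    apply pts_ext
    intro X v
    -- The two points are compared only on the image of `γ`. There additivity reduces to homogeneous
    -- elements, for which `h w` has the same degree as `w` by assumption.
    have key : ∀ z : S ⊗[O] X.V,
        X.act (cochar μ (univT K S) * Pts.map γ h) (γ.toLinearMap.rTensor X.V z) =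
          X.act (Pts.map (cst O S) h * cochar μ (univT K S)) (γ.toLinearMap.rTensor X.V z) := by
      intro z
      induction z using internal_induction (X.muPiece_isInternal μ γ hγ hK) with
      | h0 => simp
      | hof i w hw =>
        rw [act_mul, LinearMap.comp_apply, act_map,
          X.act_univT_of_mem_muPiece μ γ hγ hK (hh X i w hw), act_mul, LinearMap.comp_apply,
          X.act_univT_of_mem_muPiece μ γ hγ hK hw, map_smul, act_map]
      | hadd x y hx hy => simp only [map_add, hx, hy]
    -- As `γ` is unital, `1 ⊗ v` lies in the image of `γ`, and these vectors suffice for `pts_ext`.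
    have h1 := key (1 ⊗ₜ v)
    rw [LinearMap.rTensor_tmul, AlgHom.toLinearMap_apply, map_one] at h1
    exact h1

end FreeRep

end Equivariance

/-! ### Compatibility with Frobenius as an equation between points -/

section Frobenius

open Functor.LaxMonoidal Functor.OplaxMonoidal Functor.Monoidal

variable {O : Type} [CommRing O] {A : Type*} [CommRing A] [HopfAlgebra O A]
  {S B : Type r} [CommRing S] [CommRing B] [Algebra O S] [Algebra O B]

/-- Under `(V ⊗ S) ⊗_S B ≅ V ⊗ B` the base change of the action of `g` is the action of its image in
`G(B)`. Both sides are determined by the vectors `1 ⊗ (1 ⊗ v)`, and there the claim is the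
functoriality `act_map`. -/
theorem cancelAlong_act (φ : S →ₐ[O] B) (X : FreeRep O A) (g : Pts O A S) :
    (ModuleCat.extendScalars.{r, r, r} (φ : S →+* B)).map (ModuleCat.ofHom (X.act g)) ≫
      (cancelAlong (φ : S →+* B) φ.commutes X).hom =
    (cancelAlong (φ : S →+* B) φ.commutes X).hom ≫
      ModuleCat.ofHom (X.act (Pts.map φ g)) := by
  apply extendScalars_ext₁
  intro v
  refine (cancelAlong_one_tmul (φ : S →+* B) φ.commutes X (X.act g (1 ⊗ₜ v))).trans ?_
  refine (FreeRep.act_map X φ g (1 ⊗ₜ v)).symm.trans ?_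
  exact (congrArg (X.act (Pts.map φ g)) (cancelAlong_one_tmul (φ : S →+* B) φ.commutes X
    ((1 : S) ⊗ₜ[O] v))).symm

/-- After both pullbacks are identified with `V ⊗ B`, the action of `g` becomes `τ(g)` on the target
and `σ(g)` on the source, and the Frobenius maps become `U` and `U'`. For a single `X` this is an
equality of endomorphisms; an equality of points follows only from all `X` together, by `pts_ext`.
-/
theorem frobIso_act_iff (σ τ : S →ₐ[O] B) (U U' : Pts O A B) (g : Pts O A S) (X : FreeRep O A) :
    (frobIso (σ := (σ : S →+* B)) (τ := (τ : S →+* B)) σ.commutes τ.commutes U X).hom ≫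
        (ModuleCat.extendScalars.{r, r, r} (τ : S →+* B)).map (ModuleCat.ofHom (X.act g)) =
      (ModuleCat.extendScalars.{r, r, r} (σ : S →+* B)).map (ModuleCat.ofHom (X.act g)) ≫
        (frobIso (σ := (σ : S →+* B)) (τ := (τ : S →+* B)) σ.commutes τ.commutes U' X).hom ↔
      X.act (Pts.map τ g * U) = X.act (U' * Pts.map σ g) := by
  -- Composing with the canonical identifications at both ends leaves an equation between
  -- endomorphisms of `V ⊗ B`.
  rw [← cancel_mono (cancelAlong (τ : S →+* B) τ.commutes X).hom,
    ← cancel_epi (cancelAlong (σ : S →+* B) σ.commutes X).inv]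
  simp only [frobIso, Iso.trans_hom, Iso.symm_hom, Category.assoc, Iso.inv_hom_id,
    Category.comp_id]
  rw [cancelAlong_act, Iso.inv_hom_id_assoc, Iso.inv_hom_id_assoc,
    ← Category.assoc ((ModuleCat.extendScalars _).map _), cancelAlong_act, Category.assoc,
    Iso.inv_hom_id_assoc, FreeRep.act_mul, FreeRep.act_mul]
  exact ⟨fun h => congrArg ModuleCat.Hom.hom h, fun h => ModuleCat.hom_ext h⟩

end Frobenius

/-! ### Morphisms between the displays `D_U` -/

section FullyFaithful

open Functor.LaxMonoidal Functor.OplaxMonoidal Functor.Monoidal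

variable {p : ℕ} [hp : Fact p.Prime] {k : Type*} [Field k] [CharP k p] [PerfectRing k p]
  {A : Type*} [CommRing A] [HopfAlgebra ℤ_[p] A] [Module.Flat ℤ_[p] A]
  (μ : (WittVector p k ⊗[ℤ_[p]] A) →ₐc[WittVector p k] (WittVector p k)[T;T⁻¹])
  {R : Type r} [CommRing R] [Algebra (WittVector p k) R]

/-- The general criterion for `S = W(R)^⊕` over `K = W(k)`: the coaction is that of the grading, and
`W(k)` maps to degree zero. It converts membership in the display group into what a morphism of
graded modules requires. -/
theorem mem_displayGroup_iff_map_muPiece (h : Pts ℤ_[p] A (WittGr p k R)) :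
    h ∈ displayGroup μ R ↔ ∀ (X : FreeRep ℤ_[p] A) (l : ℤ),
      ∀ z ∈ X.muPiece μ (WittGr.piece p k R) l, X.act h z ∈ X.muPiece μ (WittGr.piece p k R) l := by
  rw [mem_displayGroup]
  exact FreeRep.equivariant_iff_map_muPiece μ (gradingCoaction p k R)
    (fun _ _ hs => gradingCoaction_apply R hs) (algebraMap_mem_piece R) h

namespace DisplayOf

/-- `frobIso_act_iff` for the frame maps, with `σ` and `τ` written as ring homomorphisms, as they
occur in the pullback functors of displays. -/
theorem frob_act_iff (U U' : Pts ℤ_[p] A (WittOver p k R)) (h : Pts ℤ_[p] A (WittGr p k R))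
    (X : FreeRep ℤ_[p] A) :
    (frobIso (σ_algebraMap p k R) τ_algebraMap U X).hom ≫
        (ModuleCat.extendScalars.{r, r, r} (WittGr.τ p k R)).map (ModuleCat.ofHom (X.act h)) =
      (ModuleCat.extendScalars.{r, r, r} (WittGr.σ p k R)).map (ModuleCat.ofHom (X.act h)) ≫
        (frobIso (σ_algebraMap p k R) τ_algebraMap U' X).hom ↔
      X.act (Pts.map (tauAlg p k R) h * U) = X.act (U' * Pts.map (sigmaAlg p k R) h) :=
  frobIso_act_iff (sigmaAlg p k R) (tauAlg p k R) U U' h X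

theorem map_tau_mul_eq {U U' : PreQuotient μ R} (h : U ⟶ U') :
    Pts.map (tauAlg p k R) h.elt.1 * U.pt = U'.pt * Pts.map (sigmaAlg p k R) h.elt.1 := by
  rw [← h.eq, mul_assoc, mul_inv_cancel_left]

/-- The action of `h : U ⟶ U'` on `V ⊗ W(R)^⊕`. -/
def actHom {U U' : PreQuotient μ R} (h : U ⟶ U') (X : FreeRep ℤ_[p] A) :
    obj μ U.pt X ⟶ obj μ U'.pt X where
  hom := ⟨X.act h.elt.1, (mem_displayGroup_iff_map_muPiece μ h.elt.1).mp h.elt.2 X⟩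
  comm := (frob_act_iff U.pt U'.pt h.elt.1 X).mpr (congrArg X.act (map_tau_mul_eq μ h))

/-- The action of `h : U ⟶ U'` as a natural transformation. -/
def actNat {U U' : PreQuotient μ R} (h : U ⟶ U') : functor μ U.pt ⟶ functor μ U'.pt where
  app X := actHom μ h X
  naturality X Y f := by
    apply IsoPair.hom_ext
    apply GrProj.hom_ext
    refine LinearMap.ext fun z => ?_
    exact FreeRep.act_hom f h.elt.1 z

theorem act_unitOne {O : Type} [CommRing O] {A : Type*} [CommRing A] [HopfAlgebra O A]
    {B : Type r} [CommRing B] [Algebra O B] (g : Pts O A B) :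
    (FreeRep.unit : FreeRep O A).act g ((1 : B) ⊗ₜ FreeRep.unitOne) = 1 ⊗ₜ FreeRep.unitOne :=
  LinearMap.congr_fun (congrArg ModuleCat.Hom.hom (unitX_act g)) (1 : B)

/-- A point acts diagonally on tensor products and trivially on the unit representation. -/
theorem actNat_isMonoidal {U U' : PreQuotient μ R} (h : U ⟶ U') :
    NatTrans.IsMonoidal (actNat μ h) where
  unit := by
    apply IsoPair.hom_ext
    apply GrProj.hom_ext
    apply LinearMap.ext_ring
    exact act_unitOne h.elt.1
  tensor X Y := by
    apply IsoPair.hom_ext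
    apply GrProj.hom_ext
    apply TensorProduct.ext'
    intro x y
    exact FreeRep.act_tensor X Y h.elt.1 x y

end DisplayOf

/-- The morphism `D_U ⟶ D_{U'}` given by the action of `h : U ⟶ U'`. -/
def banalMap {U U' : PreQuotient μ R} (h : U ⟶ U') : banalOf μ U.pt ⟶ banalOf μ U'.pt :=
  ObjectProperty.homMk { nat := DisplayOf.actNat μ h, isMonoidal := DisplayOf.actNat_isMonoidal μ h }

theorem banalMap_lin {U U' : PreQuotient μ R} (h : U ⟶ U') (V : FreeRep ℤ_[p] A) :
    ((banalMap μ h).hom.nat.app V).hom.lin = V.act h.elt.1 := rfl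

theorem banal_hom_ext {U U' : Pts ℤ_[p] A (WittOver p k R)} {f g : banalOf μ U ⟶ banalOf μ U'}
    (h : ∀ V : FreeRep ℤ_[p] A, (f.hom.nat.app V).hom.lin = (g.hom.nat.app V).hom.lin) :
    f = g := by
  apply ObjectProperty.hom_ext
  apply ExactTensorFunctor.hom_ext
  apply NatTrans.ext
  funext V
  apply IsoPair.hom_ext
  apply GrProj.hom_ext
  exact h V

/-- Faithfulness: a point is determined by its action on all representations. -/
theorem banalMap_injective {U U' : PreQuotient μ R} {h h' : U ⟶ U'}
    (e : banalMap μ h = banalMap μ h') : h = h' := by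
  apply PreQuotient.Hom.ext
  apply Subtype.ext
  apply FreeRep.pts_ext
  intro X v
  rw [← banalMap_lin μ h, ← banalMap_lin μ h', e]

/-- Fullness. The linear maps underlying `α` form a tensor endomorphism of `V ↦ V ⊗ W(R)^⊕`, hence
come from a point `h`. The two further properties of `α`, on degrees and on Frobenius, are the two
conditions for `h` to be a morphism of the groupoid. -/
theorem banalMap_surjective {U U' : PreQuotient μ R} (α : banalOf μ U.pt ⟶ banalOf μ U'.pt) :
    ∃ h : U ⟶ U', banalMap μ h = α := by
  let θ : ∀ X : FreeRep ℤ_[p] A,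
      WittGr p k R ⊗[ℤ_[p]] X.V →ₗ[WittGr p k R] WittGr p k R ⊗[ℤ_[p]] X.V :=
    fun X => (α.hom.nat.app X).hom.lin
  have hlin : ∀ {M N : Disp p k R} {f g : M ⟶ N}, f = g → f.hom.lin = g.hom.lin :=
    fun h => h ▸ rfl
  -- Naturality, the unit and the tensor products are read off from `α` by forgetting gradings and
  -- Frobenius. The comparison maps of `D_U` and `D_{U'}` are the same, as they do not involve the
  -- points.
  obtain ⟨h, hh⟩ := FreeRep.exists_pts_of_tensor θ
    (fun {X Y} f z => LinearMap.congr_fun (hlin (α.hom.nat.naturality f)) z)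
    (LinearMap.congr_fun (hlin (NatTrans.IsMonoidal.unit (τ := α.hom.nat))) (1 : WittGr p k R))
    (fun X Y v w => by
      have h1 := LinearMap.congr_fun (hlin (NatTrans.IsMonoidal.tensor (τ := α.hom.nat) X Y))
        ((1 ⊗ₜ v) ⊗ₜ (1 ⊗ₜ w))
      have h2 : θ (FreeRep.tensor X Y) (FreeRep.mulX X Y (WittGr p k R)
          ((1 ⊗ₜ v) ⊗ₜ (1 ⊗ₜ w))) = FreeRep.mulX X Y (WittGr p k R)
            (θ X (1 ⊗ₜ v) ⊗ₜ θ Y (1 ⊗ₜ w)) := h1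
      rwa [FreeRep.mulX_tmul, one_mul] at h2)
  -- Preservation of degrees by `α` on every representation is equivariance of `h`.
  have hmem : h ∈ displayGroup μ R := by
    rw [mem_displayGroup_iff_map_muPiece]
    intro X l z hz
    rw [← hh]
    exact (α.hom.nat.app X).hom.map_mem l z hz
  -- The Frobenius squares of `α` over all representations together give the equation of points.
  have heq : Pts.map (tauAlg p k R) h * U.pt = U'.pt * Pts.map (sigmaAlg p k R) h := by
    apply FreeRep.pts_ext
    intro X v
    refine LinearMap.congr_fun ((DisplayOf.frob_act_iff U.pt U'.pt h X).mp ?_) _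
    rw [← hh]
    exact (α.hom.nat.app X).comm
  refine ⟨⟨⟨h, hmem⟩, ?_⟩, ?_⟩
  · rw [mul_assoc, ← heq, inv_mul_cancel_left]
  · apply banal_hom_ext
    intro V
    exact (hh V).symm

end FullyFaithful

/-! ### Transport of Frobenius structures along isomorphisms -/

namespace IsoPair

open Functor.LaxMonoidal Functor.OplaxMonoidal Functor.Monoidal

universe v₁ v₂ u₁ u₂

variable {C : Type u₁} [Category.{v₁} C] {E : Type u₂} [Category.{v₂} E] {P Q : C ⥤ E}

/-- Transport of a morphism of pairs along isomorphisms of underlying objects. -/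
theorem hom_transport {M₁ M₂ : IsoPair P Q} (m : M₁ ⟶ M₂) {N₁ N₂ : C}
    (e₁ : M₁.obj ≅ N₁) (e₂ : M₂.obj ⟶ N₂) (n : N₁ ⟶ N₂)
    {a₁ : P.obj N₁ ⟶ Q.obj N₁} {a₂ : P.obj N₂ ⟶ Q.obj N₂}
    (h₁ : M₁.frob.hom ≫ Q.map e₁.hom = P.map e₁.hom ≫ a₁)
    (h₂ : M₂.frob.hom ≫ Q.map e₂ = P.map e₂ ≫ a₂) (hm : m.hom ≫ e₂ = e₁.hom ≫ n) :
    a₁ ≫ Q.map n = P.map n ≫ a₂ := by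
  -- Only `e₁` has to be invertible. After precomposition with `P.map e₁.hom` both sides are the
  -- Frobenius square of `m` extended by `e₂`.
  rw [← cancel_epi (P.map e₁.hom), ← Category.assoc, ← h₁, Category.assoc, ← Functor.map_comp,
    ← hm, Functor.map_comp, ← Category.assoc, m.comm, Category.assoc, h₂, ← Category.assoc,
    ← Functor.map_comp, hm, Functor.map_comp, Category.assoc]

variable [MonoidalCategory C] [MonoidalCategory E] [P.Monoidal] [Q.Monoidal]

/-- Transport of the compatibility with tensor products along isomorphisms of underlying objects. -/
theorem tensor_transport {M₁ M₂ M₃ : IsoPair P Q} (m : tensor M₁ M₂ ⟶ M₃) {N₁ N₂ N₃ : C}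
    (e₁ : M₁.obj ≅ N₁) (e₂ : M₂.obj ≅ N₂) (e₃ : M₃.obj ⟶ N₃) (n : N₁ ⊗ N₂ ⟶ N₃)
    {a₁ : P.obj N₁ ⟶ Q.obj N₁} {a₂ : P.obj N₂ ⟶ Q.obj N₂} {a₃ : P.obj N₃ ⟶ Q.obj N₃}
    (h₁ : M₁.frob.hom ≫ Q.map e₁.hom = P.map e₁.hom ≫ a₁)
    (h₂ : M₂.frob.hom ≫ Q.map e₂.hom = P.map e₂.hom ≫ a₂)
    (h₃ : M₃.frob.hom ≫ Q.map e₃ = P.map e₃ ≫ a₃)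
    (hm : m.hom ≫ e₃ = (e₁.hom ⊗ₘ e₂.hom) ≫ n) :
    (δ P N₁ N₂ ≫ (a₁ ⊗ₘ a₂) ≫ Functor.LaxMonoidal.μ Q N₁ N₂) ≫ Q.map n = P.map n ≫ a₃ :=
  -- The tensor product of the two compatibilities is `raw_natural`, which makes `e₁ ⊗ e₂`
  -- compatible with the tensor product Frobenius.
  hom_transport m (e₁ ⊗ᵢ e₂) e₃ n (raw_natural e₁.hom e₂.hom h₁ h₂) h₃ hm

/-- The unit pair already has the standard object underneath, so on the source the transport is
along the identity. -/
theorem unit_transport {M : IsoPair P Q} (m : unit P Q ⟶ M) {N : C} (e : M.obj ⟶ N)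
    (n : 𝟙_ C ⟶ N) {a : P.obj N ⟶ Q.obj N} (h : M.frob.hom ≫ Q.map e = P.map e ≫ a)
    (hm : m.hom ≫ e = n) : (η P ≫ ε Q) ≫ Q.map n = P.map n ≫ a :=
  hom_transport m (Iso.refl _) e n
    (by
      change (η P ≫ ε Q) ≫ Q.map (𝟙 (𝟙_ C)) = P.map (𝟙 (𝟙_ C)) ≫ η P ≫ ε Q
      simp) h (hm.trans (Category.id_comp n).symm)

end IsoPair

/-! ### The point attached to a tensor compatible family of Frobenius maps -/

section FrobeniusPoint

open Functor.LaxMonoidal Functor.OplaxMonoidal Functor.Monoidal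

variable {O : Type} [CommRing O] {A : Type*} [CommRing A] [HopfAlgebra O A]
  {S B : Type r} [CommRing S] [CommRing B] [Algebra O S] [Algebra O B]

/-- A tensor-compatible family of maps `(V ⊗ S) ⊗_{S, σ} B → (V ⊗ S) ⊗_{S, τ} B` comes from a point
of `G(B)`. -/
theorem exists_frobIso [IsDomain O] [IsPrincipalIdealRing O] [Module.Flat O A] {σ τ : S →+* B}
    (hσ : ∀ x : O, σ (algebraMap O S x) = algebraMap O B x)
    (hτ : ∀ x : O, τ (algebraMap O S x) = algebraMap O B x)
    (a : ∀ X : FreeRep O A,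
      (ModuleCat.extendScalars.{r, r, r} σ).obj (ModuleCat.of S (S ⊗[O] X.V)) ⟶
        (ModuleCat.extendScalars.{r, r, r} τ).obj (ModuleCat.of S (S ⊗[O] X.V)))
    (hnat : ∀ {X Y : FreeRep O A} (f : X ⟶ Y),
      a X ≫ (ModuleCat.extendScalars.{r, r, r} τ).map (ModuleCat.ofHom (f.lin.baseChange S)) =
        (ModuleCat.extendScalars.{r, r, r} σ).map (ModuleCat.ofHom (f.lin.baseChange S)) ≫ a Y)
    (hunit : (η (ModuleCat.extendScalars.{r, r, r} σ) ≫ ε (ModuleCat.extendScalars.{r, r, r} τ)) ≫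
        (ModuleCat.extendScalars.{r, r, r} τ).map (ModuleCat.ofHom (unitX O A S).toLinearMap) =
      (ModuleCat.extendScalars.{r, r, r} σ).map (ModuleCat.ofHom (unitX O A S).toLinearMap) ≫
        a FreeRep.unit)
    (htensor : ∀ X Y : FreeRep O A,
      (δ (ModuleCat.extendScalars.{r, r, r} σ) _ _ ≫ (a X ⊗ₘ a Y) ≫
        μ (ModuleCat.extendScalars.{r, r, r} τ) _ _) ≫
        (ModuleCat.extendScalars.{r, r, r} τ).map (mulHom X Y S) =
      (ModuleCat.extendScalars.{r, r, r} σ).map (mulHom X Y S) ≫ a (FreeRep.tensor X Y)) :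
    ∃ U : Pts O A B, ∀ X, a X = (frobIso hσ hτ U X).hom := by
  -- Both pullbacks of `V ⊗ S` are canonically `V ⊗ B`, since `σ` and `τ` agree on `O`. Through
  -- these identifications the family `a` becomes a family of endomorphisms of the fiber functor
  -- over `B`. The maps `a X` need not be assumed invertible.
  let θ : ∀ X : FreeRep O A, ModuleCat.of B (B ⊗[O] X.V) ⟶ ModuleCat.of B (B ⊗[O] X.V) :=
    fun X => (cancelAlong σ hσ X).inv ≫ a X ≫ (cancelAlong τ hτ X).hom
  have hθ : ∀ X, (cancelAlong σ hσ X).hom ≫ θ X = a X ≫ (cancelAlong τ hτ X).hom :=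
    fun X => Iso.hom_inv_id_assoc _ _
  have h1 : ∀ {X Y : FreeRep O A} (f : X ⟶ Y),
      ModuleCat.ofHom (f.lin.baseChange B) ≫ θ Y = θ X ≫ ModuleCat.ofHom (f.lin.baseChange B) := by
    intro X Y f
    rw [← cancel_epi (cancelAlong σ hσ X).hom, ← Category.assoc, ← cancelAlong_naturality,
      Category.assoc, hθ, ← Category.assoc, ← hnat, Category.assoc, cancelAlong_naturality,
      ← Category.assoc, ← Category.assoc, hθ]
  have h2 : ModuleCat.ofHom (unitX O A B).toLinearMap ≫ θ FreeRep.unit =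
      ModuleCat.ofHom (unitX O A B).toLinearMap := by
    -- The counit comparison `η` of extension of scalars is an isomorphism. Precomposing with it
    -- brings the claim to the form of `hunit`.
    rw [← cancel_epi (η (ModuleCat.extendScalars.{r, r, r} σ)), ← Category.assoc,
      ← cancelAlong_unit σ hσ, Category.assoc, hθ, ← Category.assoc, ← hunit, Category.assoc,
      cancelAlong_unit, Category.assoc, ε_η_assoc, cancelAlong_unit]
  have h3 : ∀ X Y : FreeRep O A, mulHom X Y B ≫ θ (FreeRep.tensor X Y) =
      (θ X ⊗ₘ θ Y) ≫ mulHom X Y B := by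
    intro X Y
    have h : μ (ModuleCat.extendScalars.{r, r, r} τ) _ _ ≫
        (ModuleCat.extendScalars.{r, r, r} τ).map (mulHom X Y S) ≫
          (cancelAlong τ hτ (FreeRep.tensor X Y)).hom =
        ((cancelAlong τ hτ X).hom ⊗ₘ (cancelAlong τ hτ Y).hom) ≫ mulHom X Y B := by
      rw [cancelAlong_mul, μ_δ_assoc]
    -- Precomposition with `δ` and the identifications along `σ` leads back to the pullbacks along
    -- `σ`, where `htensor` applies; `h` translates the end result from the pullbacks along `τ`.
    rw [← cancel_epi ((cancelAlong σ hσ X) ⊗ᵢ (cancelAlong σ hσ Y)).hom,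
      ← cancel_epi (δ (ModuleCat.extendScalars.{r, r, r} σ) _ _), tensorIso_hom,
      tensorHom_comp_tensorHom_assoc, hθ, hθ, ← tensorHom_comp_tensorHom_assoc, ← h]
    have h4 := cancelAlong_mul σ hσ X Y
    have h5 := congrArg (· ≫ θ (FreeRep.tensor X Y)) h4
    simp only [Category.assoc] at h5
    rw [← h5, hθ, ← Category.assoc ((ModuleCat.extendScalars σ).map _), ← htensor]
    simp only [Category.assoc]
  obtain ⟨U, hU⟩ := FreeRep.exists_pts_of_tensor (fun X => (θ X).hom)
    (fun f z => LinearMap.congr_fun (congrArg ModuleCat.Hom.hom (h1 f)) z)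
    (LinearMap.congr_fun (congrArg ModuleCat.Hom.hom h2) (1 : B))
    (fun X Y v w => by
      have h4 := LinearMap.congr_fun (congrArg ModuleCat.Hom.hom (h3 X Y))
        ((1 ⊗ₜ v) ⊗ₜ (1 ⊗ₜ w))
      have h5 : (θ (FreeRep.tensor X Y)).hom (FreeRep.mulX X Y B ((1 ⊗ₜ v) ⊗ₜ (1 ⊗ₜ w))) =
        FreeRep.mulX X Y B ((θ X).hom (1 ⊗ₜ v) ⊗ₜ (θ Y).hom (1 ⊗ₜ w)) := h4
      rwa [FreeRep.mulX_tmul, one_mul] at h5)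
  refine ⟨U, fun X => ?_⟩
  -- Undoing the two identifications turns the action of `U` into `frobIso`, by its definition.
  have h4 : θ X = (actIso X U).hom := ModuleCat.hom_ext (hU X)
  rw [← cancel_mono (cancelAlong τ hτ X).hom, ← hθ, h4]
  simp only [frobIso, Iso.trans_hom, Iso.symm_hom, Category.assoc, Iso.inv_hom_id,
    Category.comp_id]

end FrobeniusPoint

/-! ### Essential surjectivity -/

section EssSurj

open Functor.LaxMonoidal Functor.OplaxMonoidal Functor.Monoidal

variable {p : ℕ} [hp : Fact p.Prime] {k : Type*} [Field k] [CharP k p] [PerfectRing k p]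
  {A : Type*} [CommRing A] [HopfAlgebra ℤ_[p] A] [Module.Flat ℤ_[p] A]
  (μ : (WittVector p k ⊗[ℤ_[p]] A) →ₐc[WittVector p k] (WittVector p k)[T;T⁻¹])
  {R : Type r} [CommRing R] [Algebra (WittVector p k) R]

/-- The components of an isomorphism of exact tensor functors. -/
@[simps] def ExactTensorFunctor.appIso {O S : Type*} [CommRing O] [CommRing S]
    {C : Type*} [Category* C] [MonoidalCategory C] [SymmetricCategory C]
    {D : Type*} [Category* D] [MonoidalCategory D] [SymmetricCategory D]
    {U : C ⥤ ModuleCat O} {U' : D ⥤ ModuleCat S} {F G : ExactTensorFunctor U U'} (i : F ≅ G)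
    (X : C) : F.functor.obj X ≅ G.functor.obj X where
  hom := i.hom.nat.app X
  inv := i.inv.nat.app X
  hom_inv_id := congrArg (fun f : F ⟶ F => f.nat.app X) i.hom_inv_id
  inv_hom_id := congrArg (fun f : G ⟶ G => f.nat.app X) i.inv_hom_id

/-- An isomorphism of exact tensor functors from a monoidal natural isomorphism. -/
def ExactTensorFunctor.mkIso {O S : Type*} [CommRing O] [CommRing S]
    {C : Type*} [Category* C] [MonoidalCategory C] [SymmetricCategory C]
    {D : Type*} [Category* D] [MonoidalCategory D] [SymmetricCategory D]
    {U : C ⥤ ModuleCat O} {U' : D ⥤ ModuleCat S} {F G : ExactTensorFunctor U U'}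
    (e : F.functor ≅ G.functor) [NatTrans.IsMonoidal e.hom] : F ≅ G where
  hom := ⟨e.hom⟩
  inv := ⟨e.inv⟩
  hom_inv_id := ExactTensorFunctor.hom_ext e.hom_inv_id
  inv_hom_id := ExactTensorFunctor.hom_ext e.inv_hom_id

/-- The functor forgetting Frobenius is strictly monoidal, so composing with it changes the unit
constraint only by an identity. The same holds for the tensor constraint in the next lemma. This
lets the monoidality of `i` be used for the functor `D.functor` itself. -/
theorem TannakianDisplay.ε_hom (D : TannakianDisplay p k A R) :
    (ε D.functor).hom = ε D.toGradedFiberFunctor.functor := by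
  change _ = ε (D.functor ⋙ Disp.forget p k R)
  rw [Functor.LaxMonoidal.comp_ε]
  exact (Category.id_comp _).symm

theorem TannakianDisplay.μ_hom (D : TannakianDisplay p k A R) (X Y : FreeRep ℤ_[p] A) :
    (Functor.LaxMonoidal.μ D.functor X Y).hom =
      Functor.LaxMonoidal.μ D.toGradedFiberFunctor.functor X Y := by
  change _ = Functor.LaxMonoidal.μ (D.functor ⋙ Disp.forget p k R) X Y
  rw [Functor.LaxMonoidal.comp_μ]
  exact (Category.id_comp _).symm

/-- A Tannakian display with underlying graded fiber functor `C_μ` is of the form `D_U`. -/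
theorem exists_iso_displayOf (D : TannakianDisplay p k A R)
    (i : D.toGradedFiberFunctor ≅ stdFunctor μ R) :
    ∃ U : Pts ℤ_[p] A (WittOver p k R), Nonempty (displayOf μ U ≅ D) := by
  let e : ∀ X : FreeRep ℤ_[p] A, (D.functor.obj X).obj ≅ StdFunctor.obj μ R X :=
    ExactTensorFunctor.appIso i
  -- The Frobenius of `D` conjugated by `e`, so that it lives on the standard module `V ⊗ W(R)^⊕`.
  let a : ∀ X : FreeRep ℤ_[p] A, (sigmaPull p k R).obj (StdFunctor.obj μ R X) ⟶
      (tauPull p k R).obj (StdFunctor.obj μ R X) :=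
    fun X => (sigmaPull p k R).map (e X).inv ≫ (D.functor.obj X).frob.hom ≫
      (tauPull p k R).map (e X).hom
  have ha : ∀ X, (D.functor.obj X).frob.hom ≫ (tauPull p k R).map (e X).hom =
      (sigmaPull p k R).map (e X).hom ≫ a X := by
    intro X
    rw [← Category.assoc ((sigmaPull p k R).map _), ← Functor.map_comp, Iso.hom_inv_id,
      CategoryTheory.Functor.map_id, Category.id_comp]
  have hnat : ∀ {X Y : FreeRep ℤ_[p] A} (f : X ⟶ Y),
      (D.functor.map f).hom ≫ (e Y).hom = (e X).hom ≫ (StdFunctor.functor μ R).map f :=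
    fun f => i.hom.nat.naturality f
  have hε : (ε D.functor).hom ≫ (e (𝟙_ _)).hom = (StdFunctor.epsIso μ R).hom := by
    rw [TannakianDisplay.ε_hom]
    exact NatTrans.IsMonoidal.unit (τ := i.hom.nat)
  have hμ : ∀ X Y, (Functor.LaxMonoidal.μ D.functor X Y).hom ≫ (e (X ⊗ Y)).hom =
      ((e X).hom ⊗ₘ (e Y).hom) ≫ (StdFunctor.muIso μ R X Y).hom := by
    intro X Y
    rw [TannakianDisplay.μ_hom]
    exact NatTrans.IsMonoidal.tensor (τ := i.hom.nat) X Y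
  obtain ⟨U, hU⟩ := exists_frobIso (σ_algebraMap p k R) τ_algebraMap a
    (fun {X Y} f => IsoPair.hom_transport (D.functor.map f) (e X) (e Y).hom
      ((StdFunctor.functor μ R).map f) (ha X) (ha Y) (hnat f))
    (by
      have h1 := IsoPair.unit_transport (P := sigmaPull p k R) (Q := tauPull p k R)
        (ε D.functor) (e (𝟙_ _)).hom _ (ha _) hε
      -- Forgetting the grading is strictly monoidal, so the constraints of `sigmaPull` and
      -- `tauPull` are those of extension of scalars, in terms of which `exists_frobIso` is stated.
      -- The same identification is needed for tensor products below.
      have e1 : (η (sigmaPull p k R)) =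
          η (ModuleCat.extendScalars.{r, r, r} (WittGr.σ p k R)) := by
        rw [Functor.OplaxMonoidal.comp_η]
        exact (congrArg (· ≫ _) (CategoryTheory.Functor.map_id _ _)).trans (Category.id_comp _)
      have e2 : (ε (tauPull p k R)) =
          ε (ModuleCat.extendScalars.{r, r, r} (WittGr.τ p k R)) := by
        rw [Functor.LaxMonoidal.comp_ε]
        exact (congrArg (_ ≫ ·) (CategoryTheory.Functor.map_id _ _)).trans (Category.comp_id _)
      rw [e1, e2] at h1
      exact h1)
    (fun X Y => by
      have h1 := IsoPair.tensor_transport (P := sigmaPull p k R) (Q := tauPull p k R)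
        (Functor.LaxMonoidal.μ D.functor X Y) (e X) (e Y) (e (X ⊗ Y)).hom _ (ha X) (ha Y) (ha _)
        (hμ X Y)
      have e1 : (δ (sigmaPull p k R) (StdFunctor.obj μ R X) (StdFunctor.obj μ R Y)) =
          δ (ModuleCat.extendScalars.{r, r, r} (WittGr.σ p k R))
            (GrProj.forget.obj (StdFunctor.obj μ R X))
            (GrProj.forget.obj (StdFunctor.obj μ R Y)) := by
        rw [Functor.OplaxMonoidal.comp_δ]
        exact (congrArg (· ≫ _) (CategoryTheory.Functor.map_id _ _)).trans (Category.id_comp _)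
      have e2 : (Functor.LaxMonoidal.μ (tauPull p k R) (StdFunctor.obj μ R X)
          (StdFunctor.obj μ R Y)) =
          Functor.LaxMonoidal.μ (ModuleCat.extendScalars.{r, r, r} (WittGr.τ p k R))
            (GrProj.forget.obj (StdFunctor.obj μ R X))
            (GrProj.forget.obj (StdFunctor.obj μ R Y)) := by
        rw [Functor.LaxMonoidal.comp_μ]
        exact (congrArg (_ ≫ ·) (CategoryTheory.Functor.map_id _ _)).trans (Category.comp_id _)
      rw [e1, e2] at h1
      exact h1)
  -- The components of `i` themselves give the isomorphism with `D_U`: by the choice of `U`, the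
  -- transported Frobenius `a X` is the Frobenius of `D_U`.
  let E : D.functor ≅ DisplayOf.functor μ U := NatIso.ofComponents
    (fun X => IsoPair.isoMk (X := D.functor.obj X) (Y := DisplayOf.obj μ U X) (e X)
      ((ha X).trans (congrArg (_ ≫ ·) (hU X))))
    (fun f => IsoPair.hom_ext (hnat f))
  have hE : NatTrans.IsMonoidal E.hom :=
    { unit := IsoPair.hom_ext hε
      tensor := fun X Y => IsoPair.hom_ext (hμ X Y) }
  exact ⟨U, ⟨(@ExactTensorFunctor.mkIso _ _ _ _ _ _ _ _ _ _ _ _ _ _ D (displayOf μ U) E hE).symm⟩⟩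

end EssSurj

/-! ### Functoriality and the equivalence -/

theorem banalMap_id {p : ℕ} [Fact p.Prime] {k : Type*} [Field k] [CharP k p] [PerfectRing k p]
    {A : Type*} [CommRing A] [HopfAlgebra ℤ_[p] A] [Module.Flat ℤ_[p] A]
    (μ : (WittVector p k ⊗[ℤ_[p]] A) →ₐc[WittVector p k] (WittVector p k)[T;T⁻¹])
    {R : Type r} [CommRing R] [Algebra (WittVector p k) R] (U : PreQuotient μ R) :
    banalMap μ (𝟙 U) = 𝟙 (banalOf μ U.pt) :=
  banal_hom_ext μ fun V => V.act_one

theorem banalMap_comp {p : ℕ} [Fact p.Prime] {k : Type*} [Field k] [CharP k p] [PerfectRing k p]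
    {A : Type*} [CommRing A] [HopfAlgebra ℤ_[p] A] [Module.Flat ℤ_[p] A]
    (μ : (WittVector p k ⊗[ℤ_[p]] A) →ₐc[WittVector p k] (WittVector p k)[T;T⁻¹])
    {R : Type r} [CommRing R] [Algebra (WittVector p k) R] {U U' U'' : PreQuotient μ R}
    (h : U ⟶ U') (h' : U' ⟶ U'') : banalMap μ (h ≫ h') = banalMap μ h ≫ banalMap μ h' :=
  banal_hom_ext μ fun V => V.act_mul h'.elt.1 h.elt.1

end GDisplay

end

/-- The map `Ψ` on morphisms is quantified existentially so that its existence and its functor laws,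
which make up well-definedness, belong to the assertion. It is pinned down by the formula for its
linear maps, since morphisms are determined by these (`banal_hom_ext`). -/
theorem proposition3 {p : ℕ} [Fact p.Prime] {k : Type*} [Field k] [Finite k] [CharP k p]
    {A : Type*} [CommRing A] [HopfAlgebra ℤ_[p] A] [Module.Flat ℤ_[p] A]
    [Algebra.FiniteType ℤ_[p] A]
    (μ : (WittVector p k ⊗[ℤ_[p]] A) →ₐc[WittVector p k] (WittVector p k)[T;T⁻¹])
    (R : Type*) [CommRing R] [Algebra (WittVector p k) R] (hR : IsNilpotent (p : R)) :
    ∃ (Ψ : ∀ U U' : GDisplay.PreQuotient μ R,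
        (U ⟶ U') → (GDisplay.banalOf μ U.pt ⟶ GDisplay.banalOf μ U'.pt))
      (hid : ∀ U, Ψ U U (𝟙 U) = 𝟙 _)
      (hcomp : ∀ (U U' U'' : GDisplay.PreQuotient μ R) (h : U ⟶ U') (h' : U' ⟶ U''),
        Ψ U U'' (h ≫ h') = Ψ U U' h ≫ Ψ U' U'' h'),
      (∀ (U U' : GDisplay.PreQuotient μ R) (h : U ⟶ U') (V : GDisplay.FreeRep ℤ_[p] A),
        ((Ψ U U' h).hom.nat.app V).hom.lin = V.act h.elt.1) ∧
      ({ obj := fun U => GDisplay.banalOf μ U.pt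
         map := fun {U U'} h => Ψ U U' h
         map_id := hid
         map_comp := fun {U U' U''} h h' => hcomp U U' U'' h h' } :
        GDisplay.PreQuotient μ R ⥤ GDisplay.BanalDisplay μ R).IsEquivalence := by
  have hcomp : ∀ (U U' U'' : GDisplay.PreQuotient μ R) (h : U ⟶ U') (h' : U' ⟶ U''),
      GDisplay.banalMap μ (h ≫ h') = GDisplay.banalMap μ h ≫ GDisplay.banalMap μ h' :=
    fun _ _ _ => GDisplay.banalMap_comp μ
  refine ⟨fun _ _ h => GDisplay.banalMap μ h, GDisplay.banalMap_id μ, hcomp,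
    fun _ _ => GDisplay.banalMap_lin μ, ?_⟩
  exact
    { faithful := ⟨fun e => GDisplay.banalMap_injective μ e⟩
      full := ⟨fun α => GDisplay.banalMap_surjective μ α⟩
      essSurj := ⟨fun D => by
        -- Banality gives an isomorphism of the underlying graded fiber functor with `C_μ`, along
        -- which the Frobenius is transported to produce `U`.
        obtain ⟨i⟩ := D.property.2
        obtain ⟨U, ⟨e⟩⟩ := GDisplay.exists_iso_displayOf μ D.obj i
        exact ⟨⟨U⟩, ⟨ObjectProperty.isoMk _ e⟩⟩⟩ }
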